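/- Let $p\ge 2$, $X=\{0,1,\dots,p\}$, and let $X^\infty$ be the set of infinite words over $X$. For $i\in\{1,\dots,p\}$ let $e_i$ be the permutation of $X^\infty$ defined recursively by $e_i(0w)=i\,e_i(w)$, $e_i(iw)=0w$ and $e_i(jw)=jw$ for $j\ne 0,i$; let $\mathcal G_{S_p}$ be the group generated by $e_1,\dots,e_p$ (the star automaton group). For $w\in X^\infty$ let $\Gamma^p_w$ be the Schreier graph on the orbit of $w$ under $\mathcal G_{S_p}$ with respect to $\{e_1^{\pm1},\dots,e_p^{\pm1}\}$, regarded as an undirected, unlabelled, unrooted multigraph (with loops), and let $E_k$ be the set of the words $w$ such that $\Gamma^p_w$ has exactly $k$ ends. Isomorphism means isomorphism of such multigraphs, and "a class consists of $N$ graphs" means that it contains the graphs of exactly $N$ distinct orbits. Write $v\sim w$ (cofinal) if $v$ and $w$ differ only in a finite prefix. For $i,j\in\{1,\dots,p\}$ let $\phi_{i,j}$ be the map on words that replaces every letter $i$ by $j$ and fixes all other letters. For a word $u$ in the letters $0,i$, with $i\neq 0$, let $u'$ be the word obtained from $u$ by exchanging $0$ and $i$ (for the blocks below: $v_i'$ exchanges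 $0$ and $b_i$). If an infinite word $u$ has the form $u=u_1iu_2$, where $iu_2$ is the longest suffix of $u$ that starts with a letter $i\ne0$ and contains only the letters $0$ and $i$, put $\overline u=u_1iu_2'$. 1. There is exactly one isomorphism class of $2p$-ended graphs $\Gamma^p_w$, and it consists of the single graph $\Gamma^p_{0^\infty}$. 2. Let $u,v\in E_2$. Then $\Gamma^p_u$ is isomorphic to $\Gamma^p_v$ if and only if $v\sim\phi_{i,j}(u)$ or $v\sim\overline{\phi_{i,j}(u)}$ for some $i,j\in\{1,\dots,p\}$. There are uncountably many isomorphism classes of $2$-ended graphs $\Gamma^p_w$, and each of them consists of exactly $2p$ graphs. 3. Every $u\in E_1$ has a decomposition $u=0^ka_1u_1a_2u_2\cdots$ with $k\ge0$, $a_i\in\{1,\dots,p\}$, $a_i\ne a_{i+1}$, and $u_i$ a finite (possibly empty) word in the letters $0,a_i$. Let $u,v\in E_1$, with $u$ decomposed in this way. Then $\Gamma^p_u$ is isomorphic to $\Gamma^p_v$ if and only if $v\sim 0^kb_1v_1b_2v_2\cdots$ for some $b_i\in\{1,\dots,p\}$ with $b_i\ne b_{i+1}$ and some finite words $v_i$ in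 the letters $0,b_i$ such that, for every $i\geq 1$, $|v_i|=|u_i|$ and either $v_i=\phi_{a_i,b_i}(u_i)$ or $v_i=\phi_{a_i,b_i}(u_i)'$. There are uncountably many isomorphism classes of $1$-ended graphs $\Gamma^p_w$. The class of $\Gamma^p_u$, for $u\in E_1$ decomposed as above, consists of uncountably many graphs whenever $p\ge3$ or infinitely many of the blocks $u_i$ are nonempty (so for $p\ge3$ every class of $1$-ended graphs does). -/

import Mathlib

namespace StarAut

/-! ### Invertible automata and their action on infinite words -/

/-- An invertible automaton with state set `S` over the alphabet `X`: a restriction map and an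
output map which is a permutation of the alphabet for every state. -/
structure InvAutomaton (S X : Type) where
  restr : S → X → S
  out : S → Equiv.Perm X

namespace InvAutomaton

variable {S X : Type} (A : InvAutomaton S X)

/-- The state reached from `s` after reading the first `n` letters of `w`. -/
def run (s : S) (w : ℕ → X) : ℕ → S
  | 0 => s
  | n + 1 => A.restr (run s w n) (w n)

/-- The same state sequence, read off from the output word `y`. -/
def runBack (s : S) (y : ℕ → X) : ℕ → S
  | 0 => s
  | n + 1 => A.restr (runBack s y n) ((A.out (runBack s y n)).symm (y n))

theorem runBack_out (s : S) (w : ℕ → X) (n : ℕ) :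
    A.runBack s (fun m => A.out (A.run s w m) (w m)) n = A.run s w n := by
  induction n with
  | zero => rfl
  | succ n ih => simp [runBack, run, ih]

theorem run_out_symm (s : S) (y : ℕ → X) (n : ℕ) :
    A.run s (fun m => (A.out (A.runBack s y m)).symm (y m)) n = A.runBack s y n := by
  induction n with
  | zero => rfl
  | succ n ih => simp [runBack, run, ih]

/-- The transformation of the set of infinite words defined by the state `s`; it is a bijection. -/
def act (s : S) : Equiv.Perm (ℕ → X) where
  toFun w := fun n => A.out (A.run s w n) (w n)
  invFun y := fun n => (A.out (A.runBack s y n)).symm (y n)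
  left_inv w := by
    funext n
    simp only [runBack_out, Equiv.symm_apply_apply]
  right_inv y := by
    funext n
    simp only [run_out_symm, Equiv.apply_symm_apply]

/-- The automaton group, as a group of permutations of the set of infinite words. -/
def group : Subgroup (Equiv.Perm (ℕ → X)) :=
  Subgroup.closure (Set.range A.act)

end InvAutomaton

/-! ### The star automaton group -/

/-- Infinite words over the alphabet `{0, 1, …, p}`. -/
abbrev Word (p : ℕ) : Type := ℕ → Fin (p + 1)

/-- The automaton of the star graph with centre `0` and leaves `1, …, p`. The state `none` is the
sink, the state `some i` is the edge from `0` to `i.succ`: it exchanges the letters `0` and `i.succ`,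
and its only restriction different from the sink is at the letter `0`, where it is itself. -/
def starAutomaton (p : ℕ) : InvAutomaton (Option (Fin p)) (Fin (p + 1)) where
  restr s x := match s with
    | none => none
    | some i => if x = 0 then some i else none
  out s := match s with
    | none => 1
    | some i => Equiv.swap 0 i.succ

/-- The star automaton group, acting on infinite words. -/
def starGroup (p : ℕ) : Subgroup (Equiv.Perm (Word p)) := (starAutomaton p).group

/-- The generator given by the edge from `0` to `i.succ`. -/
def gen {p : ℕ} (i : Fin p) : Equiv.Perm (Word p) := (starAutomaton p).act (some i)

/-- The orbit of an infinite word: the vertex set of its Schreier graph. -/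
def orb {p : ℕ} (w : Word p) : Set (Word p) := MulAction.orbit (starGroup p) w

/-! ### Multigraphs, isomorphisms, ends -/

/-- An undirected multigraph with loops, given by its adjacency matrix: `mult u v` is the number of
edges between `u` and `v` for `u ≠ v`, and twice the number of loops at `u` for `u = v`. -/
structure Multigraph (V : Type) where
  mult : V → V → ℕ
  symm : ∀ u v, mult u v = mult v u

/-- Isomorphism of (unrooted, unlabelled) multigraphs: a bijection of the vertex sets which
preserves the multiplicities. -/
def Multigraph.Isomorphic {V W : Type} (G : Multigraph V) (H : Multigraph W) : Prop :=
  ∃ f : V ≃ W, ∀ u v, H.mult (f u) (f v) = G.mult u v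

/-- The underlying simple graph, which carries the connectivity. -/
def Multigraph.toSimple {V : Type} (G : Multigraph V) : SimpleGraph V where
  Adj u v := u ≠ v ∧ G.mult u v ≠ 0
  symm := ⟨fun u v h => ⟨h.1.symm, by rw [G.symm]; exact h.2⟩⟩
  loopless := ⟨fun _ h => h.1 rfl⟩

/-- The (orbital) Schreier graph of the word `w`: its vertices are the elements of the orbit of `w`,
and every element `s` of the symmetric generating set `{e₁, e₁⁻¹, …, e_p, e_p⁻¹}` with `s u = v`
contributes one to the entry `(u, v)` of the adjacency matrix. -/
noncomputable def schreier {p : ℕ} (w : Word p) : Multigraph (orb w) where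
  mult u v := Nat.card {i : Fin p // gen i u.1 = v.1} + Nat.card {i : Fin p // (gen i)⁻¹ u.1 = v.1}
  symm u v := by
    have h : ∀ (i : Fin p) (a b : Word p), (gen i)⁻¹ a = b ↔ gen i b = a := fun i a b =>
      Equiv.Perm.inv_eq_iff_eq.trans eq_comm
    simp only [h]
    exact add_comm _ _

/-- The set of the words whose Schreier graph has exactly `k` ends. -/
def ended (p k : ℕ) : Set (Word p) := {w | (schreier w).toSimple.end.encard = k}

/-- The isomorphism class of the Schreier graph of `u`, inside the set of all Schreier graphs of
infinite words; a Schreier graph is recorded by its vertex set, which is an orbit. -/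
def isoClass {p : ℕ} (u : Word p) : Set (Set (Word p)) :=
  {O | ∃ v : Word p, O = orb v ∧ (schreier u).Isomorphic (schreier v)}

/-! ### Operations on words -/

/-- Cofinality: the words differ only in a finite prefix. -/
def Cofinal {p : ℕ} (u v : Word p) : Prop := ∃ k, ∀ n ≥ k, u n = v n

/-- The map on letters which sends `i` to `j` and fixes all other letters. -/
def phi {p : ℕ} (i j : Fin (p + 1)) : Fin (p + 1) → Fin (p + 1) := fun k => if k = i then j else k

/-- The letter `u m` is a letter `i ≠ 0`, and from there on `u` contains only the letters `0`
and `i`. -/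
def TailAt {p : ℕ} (u : Word p) (m : ℕ) : Prop :=
  u m ≠ 0 ∧ ∀ l ≥ m, u l = 0 ∨ u l = u m

open Classical in
/-- If `u = u₁ i u₂`, where `i u₂` is the longest suffix of `u` that starts with a letter `i ≠ 0`
and contains only the letters `0` and `i`, then `bar u = u₁ i u₂'`, where `u₂'` arises from `u₂` by
exchanging `0` and `i`. (The letter `i` does not depend on the chosen position. A word without such a
suffix is left unchanged.) -/
noncomputable def bar {p : ℕ} (u : Word p) : Word p := fun n =>
  if h : ∃ m < n, TailAt u m then Equiv.swap 0 (u h.choose) (u n) else u n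

/-- `u = 0ᵏ a₀ U₀ a₁ U₁ a₂ U₂ …`, where the `aₙ` are nonzero letters with `aₙ ≠ aₙ₊₁`, and `Uₙ` is a
finite (possibly empty) word in the letters `0` and `aₙ`. -/
structure IsDecomposition {p : ℕ} (u : Word p) (k : ℕ) (a : ℕ → Fin (p + 1))
    (U : ℕ → List (Fin (p + 1))) : Prop where
  ne_zero : ∀ n, a n ≠ 0
  ne_succ : ∀ n, a n ≠ a (n + 1)
  mem : ∀ n, ∀ x ∈ U n, x = 0 ∨ x = a n
  zeros : ∀ n < k, u n = 0
  letter : ∀ n, u (k + ∑ m ∈ Finset.range n, (1 + (U m).length)) = a n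
  block : ∀ n r, ∀ h : r < (U n).length,
    u (k + ∑ m ∈ Finset.range n, (1 + (U m).length) + 1 + r) = (U n)[r]

end StarAut

/-!
Why the classification holds. The generator `gen i` is a binary odometer on the maximal prefix in the
letters `0` and `i.succ`: its orbit of `z` is a cycle of length `2 ^ n` if that prefix has length `n`,
and a line if the prefix is the whole word. The Schreier graph is a cactus built from these cycles and
lines: two of them meet in at most one vertex, and such a vertex separates them. The finite parts into
which the graph falls are described explicitly by `branch` and `hang`. Apart from the orbit of
`0 0 0 …`, which also contains the words `i i i …`, the orbits are the cofinality classes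
(`mem_orb_iff_cofinal`).

*Ends.* Words are of three kinds (`trichotomy`). The graph of `0 0 0 …` consists of `p` lines through
that vertex with finite parts hanging at them. If a word eventually uses only the letters `0` and `i`,
each infinitely often, its graph is one line with finite parts hanging at it. Every line contributes
two ends (`LineSystem.end_encard`). In all other cases (`Mixed`) there is no line, and the graph is
exhausted by finite parts, each hanging at one vertex, so that there is one end
(`end_encard_eq_one_of_forall`).

*Rigidity.* Neighbours of a vertex along different generators are separated by this vertex, while the
two neighbours on a finite cycle are not. Hence, away from the orbit of `0 0 0 …`, an isomorphism maps
cycles to cycles and lines to lines (`exists_map_move`), as a rotation or as a reflection, possibly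
with another label. As cycle lengths are preserved, so is the number of leading zeros (`lead_map`).
For two-ended graphs it follows that a word on the line is determined up to the label and the
reflection, which complements the letters (`cofinal_of_isomorphic`). For one-ended graphs, let
`P 0 < P 1 < …` be the starts of the blocks of `u`. The vertices obtained from `u` by deleting (replacing by `0`) its first `P m` letters are mapped
to the vertices obtained in the same way from the image of `u`. Two successive ones lie on a common
cycle, and the position of one relative to the other encodes the block between them up to reflection
(`blocks_of_isomorphism`).

*Construction of isomorphisms.* Permuting the nonzero letters gives isomorphisms, and so does the
reflection of a line together with all that hangs at it (`isomorphic_relabelWord`,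
`isomorphic_reflect`). For one-ended graphs, a permutation of letters followed by a reflection of the
`m`-th cycle is an isomorphism on the finite part hanging at the end of the `m`-th block; the parts
are nested, the `m`-th isomorphism being used outside the preceding part, and successive ones agree at
the cut vertices, so that they can be glued (`Similar.isomorphic`).

*Uncountability.* The words are taken from families parametrised by binary sequences, and it suffices to see
that each orbit, or each isomorphism class, meets the family in a countable set
(`not_countable_range`). For orbits this holds because cofinality classes are countable.
-/

namespace StarAut

variable {p : ℕ}

/-! ### The generators on infinite words -/

theorem run_some_of_forall (i : Fin p) (z : Word p) (n : ℕ) (h : ∀ t < n, z t = 0) :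
    (starAutomaton p).run (some i) z n = some i := by
  induction n with
  | zero => rfl
  | succ n ih =>
    rw [InvAutomaton.run, ih fun t ht => h t (by omega)]
    simp [starAutomaton, h n (by omega)]

theorem run_none (z : Word p) (n : ℕ) : (starAutomaton p).run none z n = none := by
  induction n with
  | zero => rfl
  | succ n ih => rw [InvAutomaton.run, ih]; rfl

theorem run_some_of_ne (i : Fin p) (z : Word p) (n t : ℕ) (ht : t < n) (h : z t ≠ 0) :
    (starAutomaton p).run (some i) z n = none := by
  induction n with
  | zero => omega
  | succ n ih =>
    rw [InvAutomaton.run]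
    by_cases htn : t < n
    · rw [ih htn]; rfl
    · obtain rfl : t = n := by omega
      cases hr : (starAutomaton p).run (some i) z t with
      | none => rfl
      | some j => simp [starAutomaton, h]

theorem gen_of_forall {i : Fin p} {z : Word p} {n : ℕ} (h : ∀ t < n, z t = 0) :
    gen i z n = Equiv.swap 0 i.succ (z n) := by
  change (starAutomaton p).out ((starAutomaton p).run (some i) z n) (z n) = _
  rw [run_some_of_forall i z n h]; rfl

theorem gen_of_ne {i : Fin p} {z : Word p} {n t : ℕ} (ht : t < n) (h : z t ≠ 0) :
    gen i z n = z n := by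
  change (starAutomaton p).out ((starAutomaton p).run (some i) z n) (z n) = _
  rw [run_some_of_ne i z n t ht h]; rfl

/-- Either the generator has stopped before the position `n`, or it still acts there. -/
theorem gen_dichotomy (i : Fin p) (z : Word p) (n : ℕ) :
    ((∃ t < n, z t ≠ 0) ∧ gen i z n = z n) ∨
      ((∀ t < n, z t = 0) ∧ gen i z n = Equiv.swap 0 i.succ (z n)) := by
  by_cases h : ∃ t < n, z t ≠ 0
  · obtain ⟨t, ht, h'⟩ := h
    exact .inl ⟨⟨t, ht, h'⟩, gen_of_ne ht h'⟩
  · push Not at h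
    exact .inr ⟨h, gen_of_forall h⟩

theorem gen_inv_of_forall {i : Fin p} {z : Word p} {n : ℕ} (h : ∀ t < n, z t = i.succ) :
    (gen i)⁻¹ z n = Equiv.swap 0 i.succ (z n) := by
  obtain ⟨x, rfl⟩ : ∃ x, z = gen i x := ⟨(gen i)⁻¹ z, by simp⟩
  have hx : ∀ t < n, x t = 0 := by
    intro t
    induction t using Nat.strong_induction_on with
    | _ t ih =>
      intro ht
      have h1 := gen_of_forall (i := i) (z := x) (n := t) fun s hs => ih s hs (by omega)
      rw [h t ht] at h1
      have := congrArg (Equiv.swap (0 : Fin (p + 1)) i.succ) h1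
      simpa using this.symm
  rw [gen_of_forall hx]; simp

theorem gen_inv_of_ne {i : Fin p} {z : Word p} {n t : ℕ} (ht : t < n) (h : z t ≠ i.succ) :
    (gen i)⁻¹ z n = z n := by
  obtain ⟨x, rfl⟩ : ∃ x, z = gen i x := ⟨(gen i)⁻¹ z, by simp⟩
  have hx : ∃ s < n, x s ≠ 0 := by
    by_contra hc
    push Not at hc
    rw [gen_of_forall fun s hs => hc s (by omega), hc t ht] at h
    simp at h
  obtain ⟨s, hs, hs'⟩ := hx
  rw [gen_of_ne hs hs']; simp

theorem gen_congr_lt {i : Fin p} {z z' : Word p} {n : ℕ} (h : ∀ t < n, z t = z' t) :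
    ∀ t < n, gen i z t = gen i z' t := by
  intro t ht
  by_cases hc : ∃ s < t, z s ≠ 0
  · obtain ⟨s, hs, hs'⟩ := hc
    rw [gen_of_ne hs hs', gen_of_ne hs (by rwa [← h s (by omega)]), h t ht]
  · push Not at hc
    rw [gen_of_forall hc, gen_of_forall fun s hs => by rw [← h s (by omega), hc s hs], h t ht]

theorem gen_inv_congr_lt {i : Fin p} {z z' : Word p} {n : ℕ} (h : ∀ t < n, z t = z' t) :
    ∀ t < n, (gen i)⁻¹ z t = (gen i)⁻¹ z' t := by
  intro t ht
  by_cases hc : ∃ s < t, z s ≠ i.succ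
  · obtain ⟨s, hs, hs'⟩ := hc
    rw [gen_inv_of_ne hs hs', gen_inv_of_ne hs (by rwa [← h s (by omega)]), h t ht]
  · push Not at hc
    rw [gen_inv_of_forall hc, gen_inv_of_forall fun s hs => by rw [← h s (by omega), hc s hs],
      h t ht]

/-- A property of words which is preserved by a generator and its inverse is preserved by all its
powers. -/
theorem zpow_induction {i : Fin p} {Q : Word p → Prop} (h1 : ∀ z, Q z → Q (gen i z))
    (h2 : ∀ z, Q z → Q ((gen i)⁻¹ z)) (t : ℤ) : ∀ z, Q z → Q ((gen i ^ t) z) := by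
  induction t with
  | zero => exact fun z hz => hz
  | succ n ih =>
    intro z hz
    rw [add_comm, zpow_add, zpow_one]
    exact h1 _ (ih z hz)
  | pred n ih =>
    intro z hz
    rw [sub_eq_neg_add, zpow_add, zpow_neg_one]
    exact h2 _ (ih z hz)

theorem zpow_succ_apply (i : Fin p) (t : ℤ) (z : Word p) :
    (gen i ^ (t + 1)) z = gen i ((gen i ^ t) z) := by
  rw [add_comm, zpow_add, zpow_one]; rfl

theorem zpow_pred_apply (i : Fin p) (t : ℤ) (z : Word p) :
    (gen i ^ (t - 1)) z = (gen i)⁻¹ ((gen i ^ t) z) := by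
  rw [sub_eq_neg_add, zpow_add, zpow_neg_one]; rfl

theorem zpow_add_apply (i : Fin p) (s t : ℤ) (z : Word p) :
    (gen i ^ (s + t)) z = (gen i ^ s) ((gen i ^ t) z) := by
  rw [zpow_add]; rfl

theorem zpow_neg_zpow (i : Fin p) (t : ℤ) (z : Word p) : (gen i ^ (-t)) ((gen i ^ t) z) = z := by
  rw [← zpow_add_apply]; simp

theorem zpow_zpow_neg (i : Fin p) (t : ℤ) (z : Word p) : (gen i ^ t) ((gen i ^ (-t)) z) = z := by
  rw [← zpow_add_apply]; simp

theorem zpow_congr_lt {i : Fin p} {n : ℕ} (t : ℤ) : ∀ {z z' : Word p}, (∀ l < n, z l = z' l) →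
    ∀ l < n, (gen i ^ t) z l = (gen i ^ t) z' l := by
  induction t with
  | zero => exact fun h => h
  | succ m ih =>
    intro z z' h
    rw [zpow_succ_apply, zpow_succ_apply]
    exact gen_congr_lt (ih h)
  | pred m ih =>
    intro z z' h
    rw [zpow_pred_apply, zpow_pred_apply]
    exact gen_inv_congr_lt (ih h)

theorem swap_mem {i : Fin p} {x : Fin (p + 1)} (h : x = 0 ∨ x = i.succ) :
    Equiv.swap 0 i.succ x = 0 ∨ Equiv.swap 0 i.succ x = i.succ := by
  rcases h with rfl | rfl <;> simp

theorem gen_mem {i : Fin p} {z : Word p} {n : ℕ} (h : z n = 0 ∨ z n = i.succ) :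
    gen i z n = 0 ∨ gen i z n = i.succ := by
  rcases gen_dichotomy i z n with ⟨-, h'⟩ | ⟨-, h'⟩ <;> rw [h']
  exacts [h, swap_mem h]

theorem gen_other {i : Fin p} {z : Word p} {n : ℕ} (h0 : z n ≠ 0) (hi : z n ≠ i.succ) :
    gen i z n = z n := by
  rcases gen_dichotomy i z n with ⟨-, h'⟩ | ⟨-, h'⟩
  exacts [h', by rw [h', Equiv.swap_apply_of_ne_of_ne h0 hi]]

theorem gen_mem_iff {i : Fin p} {z : Word p} {n : ℕ} :
    (gen i z n = 0 ∨ gen i z n = i.succ) ↔ (z n = 0 ∨ z n = i.succ) := by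
  refine ⟨fun h => ?_, gen_mem⟩
  by_contra hc
  push Not at hc
  rw [gen_other hc.1 hc.2] at h
  tauto

theorem gen_inv_mem_iff {i : Fin p} {z : Word p} {n : ℕ} :
    ((gen i)⁻¹ z n = 0 ∨ (gen i)⁻¹ z n = i.succ) ↔ (z n = 0 ∨ z n = i.succ) := by
  rw [← gen_mem_iff (i := i) (z := (gen i)⁻¹ z)]; simp

theorem zpow_mem_iff {i : Fin p} (t : ℤ) {z : Word p} {n : ℕ} :
    ((gen i ^ t) z n = 0 ∨ (gen i ^ t) z n = i.succ) ↔ (z n = 0 ∨ z n = i.succ) :=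
  zpow_induction (Q := fun x => (x n = 0 ∨ x n = i.succ) ↔ (z n = 0 ∨ z n = i.succ))
    (fun _ h => gen_mem_iff.trans h) (fun _ h => gen_inv_mem_iff.trans h) t z Iff.rfl

/-- The action of the `i`-th generator stops at the first letter different from `0` and `i`. -/
theorem gen_tail {i : Fin p} {z : Word p} {n : ℕ} (h0 : z n ≠ 0) (hi : z n ≠ i.succ) :
    ∀ l ≥ n, gen i z l = z l := by
  intro l hl
  rcases hl.eq_or_lt with rfl | hl
  exacts [gen_other h0 hi, gen_of_ne hl h0]

theorem gen_inv_tail {i : Fin p} {z : Word p} {n : ℕ} (h0 : z n ≠ 0) (hi : z n ≠ i.succ) :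
    ∀ l ≥ n, (gen i)⁻¹ z l = z l := by
  intro l hl
  rcases hl.eq_or_lt with rfl | hl
  · by_cases h : ∃ t < n, z t ≠ i.succ
    · obtain ⟨t, ht, h⟩ := h
      exact gen_inv_of_ne ht h
    · push Not at h
      rw [gen_inv_of_forall h, Equiv.swap_apply_of_ne_of_ne h0 hi]
  · exact gen_inv_of_ne hl hi

theorem zpow_tail {i : Fin p} (t : ℤ) {z : Word p} {n : ℕ} (h0 : z n ≠ 0) (hi : z n ≠ i.succ) :
    ∀ l ≥ n, (gen i ^ t) z l = z l := by
  refine zpow_induction (Q := fun x => ∀ l ≥ n, x l = z l) ?_ ?_ t z fun _ _ => rfl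
  · intro x hx l hl
    rw [gen_tail (by rwa [hx n le_rfl]) (by rwa [hx n le_rfl]) l hl, hx l hl]
  · intro x hx l hl
    rw [gen_inv_tail (by rwa [hx n le_rfl]) (by rwa [hx n le_rfl]) l hl, hx l hl]

/-- The generators act transitively on the prefixes in the letters `0` and `i`. -/
theorem exists_zpow_zero (i : Fin p) (n : ℕ) : ∀ z : Word p, (∀ l < n, z l = 0 ∨ z l = i.succ) →
    ∃ t : ℤ, (∀ l < n, (gen i ^ t) z l = 0) ∧ ∀ l ≥ n, (gen i ^ t) z l = z l := by
  induction n with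
  | zero => exact fun z _ => ⟨0, by simp, by simp⟩
  | succ n ih =>
    intro z hz
    obtain ⟨t, ht1, ht2⟩ := ih z fun l hl => hz l (by omega)
    rcases hz n (by omega) with h0 | hi
    · refine ⟨t, fun l hl => ?_, fun l hl => ht2 l (by omega)⟩
      rcases Nat.lt_succ_iff_lt_or_eq.mp hl with hl | rfl
      exacts [ht1 l hl, (ht2 l le_rfl).trans h0]
    · set x := gen i ((gen i ^ t) z) with hx
      have hxn : x n = 0 := by
        rw [hx, gen_of_forall ht1, ht2 n le_rfl, hi]; simp
      have hxl : ∀ l > n, x l = z l := by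
        intro l hl
        rw [hx, gen_of_ne (t := n) hl (by rw [ht2 n le_rfl, hi]; exact Fin.succ_ne_zero i),
          ht2 l (by omega)]
      obtain ⟨s, hs1, hs2⟩ := ih x fun l hl => gen_mem (.inl (ht1 l hl))
      have key : (gen i ^ (s + (t + 1))) z = (gen i ^ s) x := by
        rw [zpow_add_apply, zpow_succ_apply]
      refine ⟨s + (t + 1), fun l hl => ?_, fun l hl => ?_⟩ <;> rw [key]
      · rcases Nat.lt_succ_iff_lt_or_eq.mp hl with hl | rfl
        exacts [hs1 l hl, (hs2 l le_rfl).trans hxn]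
      · rw [hs2 l (by omega), hxl l (by omega)]

/-! ### The odometer -/

/-- The word `z` without its first letter. -/
def tail (z : Word p) : Word p := fun n => z (n + 1)

/-- The word `c z`. -/
def cons (c : Fin (p + 1)) (z : Word p) : Word p := fun n => Nat.casesOn n c z

theorem cons_tail (z : Word p) : cons (z 0) (tail z) = z := by
  funext n; cases n <;> rfl

theorem gen_cons_zero (i : Fin p) (z : Word p) : gen i (cons 0 z) = cons i.succ (gen i z) := by
  funext n
  cases n with
  | zero => rw [gen_of_forall (by simp)]; simp [cons]
  | succ n =>
    change _ = gen i z n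
    rcases gen_dichotomy i z n with ⟨⟨t, ht, h⟩, h'⟩ | ⟨h, h'⟩ <;> rw [h']
    · exact gen_of_ne (t := t + 1) (by omega) h
    · rw [gen_of_forall]
      · rfl
      · intro t ht
        cases t with
        | zero => rfl
        | succ t => exact h t (by omega)

theorem gen_cons_succ (i : Fin p) (z : Word p) : gen i (cons i.succ z) = cons 0 z := by
  funext n
  cases n with
  | zero => rw [gen_of_forall (by simp)]; simp [cons]
  | succ n => exact gen_of_ne (t := 0) (by omega) (Fin.succ_ne_zero i)

theorem gen_fixed {i : Fin p} {z : Word p} (h0 : z 0 ≠ 0) (hi : z 0 ≠ i.succ) : gen i z = z :=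
  funext fun l => gen_tail h0 hi l (Nat.zero_le l)

theorem gen_two_mul {i : Fin p} (t : ℕ) : ∀ {z : Word p}, (z 0 = 0 ∨ z 0 = i.succ) →
    (gen i ^ (2 * t)) z = cons (z 0) ((gen i ^ t) (tail z)) := by
  induction t with
  | zero => exact fun _ => (cons_tail _).symm
  | succ t ih =>
    intro z hz
    have h2 : gen i (gen i z) = cons (z 0) (gen i (tail z)) := by
      rw [← cons_tail z]
      rcases hz with h | h <;> rw [h]
      · rw [gen_cons_zero, gen_cons_succ]; rfl
      · rw [gen_cons_succ, gen_cons_zero]; rfl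
    rw [mul_add, mul_one, pow_add, pow_two, Equiv.Perm.mul_apply, Equiv.Perm.mul_apply, h2,
      ih (by exact hz), pow_succ]
    rfl

theorem gen_apply_zero_ne {i : Fin p} {z : Word p} (h : z 0 = 0 ∨ z 0 = i.succ) :
    gen i z 0 ≠ z 0 := by
  rw [gen_of_forall (by simp)]
  rcases h with h | h <;> rw [h] <;> simp [Fin.succ_ne_zero, (Fin.succ_ne_zero i).symm]

/-- The `i`-th generator acts on `z` with period `2 ^ n`, where `n` is the length of the longest
prefix in the letters `0` and `i`. -/
theorem gen_two_pow_fixed {i : Fin p} (n : ℕ) : ∀ {z : Word p},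
    (gen i ^ (2 ^ n)) z = z ↔ ∃ l ≤ n, z l ≠ 0 ∧ z l ≠ i.succ := by
  induction n with
  | zero =>
    intro z
    constructor
    · intro h
      refine ⟨0, le_rfl, ?_⟩
      by_contra hc
      exact gen_apply_zero_ne (i := i) (z := z) (by tauto) (congrFun h 0)
    · rintro ⟨l, hl, h0, hi⟩
      obtain rfl : l = 0 := by omega
      exact gen_fixed h0 hi
  | succ n ih =>
    intro z
    by_cases hz : z 0 = 0 ∨ z 0 = i.succ
    · rw [pow_succ, mul_comm, gen_two_mul _ hz]
      constructor
      · intro h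
        obtain ⟨l, hl, h'⟩ := (ih (z := tail z)).mp (congrArg tail h)
        exact ⟨l + 1, by omega, h'⟩
      · rintro ⟨l, hl, h'⟩
        obtain ⟨l, rfl⟩ : ∃ l', l = l' + 1 :=
          Nat.exists_eq_succ_of_ne_zero (by rintro rfl; tauto)
        rw [(ih (z := tail z)).mpr ⟨l, by omega, h'⟩, cons_tail]
    · push Not at hz
      refine ⟨fun _ => ⟨0, by omega, hz⟩, fun _ => ?_⟩
      exact Function.IsFixedPt.perm_pow (e := gen i) (gen_fixed hz.1 hz.2) _

theorem pow_ne_of_full {i : Fin p} (t : ℕ) : ∀ {z : Word p}, (∀ l, z l = 0 ∨ z l = i.succ) →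
    t ≠ 0 → (gen i ^ t) z ≠ z := by
  induction t using Nat.strong_induction_on with
  | _ t ih =>
    intro z hz ht h
    rcases Nat.even_or_odd' t with ⟨s, rfl | rfl⟩
    · rw [gen_two_mul s (hz 0)] at h
      exact ih s (by omega) (z := tail z) (fun l => hz (l + 1)) (by omega) (congrArg tail h)
    · rw [pow_succ, Equiv.Perm.mul_apply, gen_two_mul s (gen_mem (hz 0))] at h
      exact gen_apply_zero_ne (hz 0) (congrFun h 0)

/-- On the words in the letters `0` and `i` the `i`-th generator acts freely. -/
theorem zpow_injective_of_full {i : Fin p} {z : Word p} (hz : ∀ l, z l = 0 ∨ z l = i.succ)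
    {s t : ℤ} (h : (gen i ^ s) z = (gen i ^ t) z) : s = t := by
  have key : ∀ (n : ℕ) (s : ℤ), (gen i ^ (s + n)) z = (gen i ^ s) z → n = 0 := by
    intro n s hn
    by_contra h0
    rw [zpow_add_apply] at hn
    exact pow_ne_of_full n hz h0 (by simpa using (gen i ^ s).injective hn)
  rcases le_total s t with hst | hst
  · obtain ⟨n, rfl⟩ := Int.le.dest hst
    have := key n s h.symm
    omega
  · obtain ⟨n, rfl⟩ := Int.le.dest hst
    have := key n t h
    omega

/-! ### Orbits -/

theorem gen_mem_starGroup (i : Fin p) : gen i ∈ starGroup p :=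
  Subgroup.subset_closure ⟨some i, rfl⟩

theorem mem_orb_self (w : Word p) : w ∈ orb w := MulAction.mem_orbit_self w

theorem mem_orb_of_mem {g : Equiv.Perm (Word p)} (hg : g ∈ starGroup p) {w z : Word p}
    (h : z ∈ orb w) : g z ∈ orb w := by
  obtain ⟨⟨a, ha⟩, rfl⟩ := h
  exact ⟨⟨g * a, mul_mem hg ha⟩, rfl⟩

theorem gen_mem_orb {w z : Word p} (i : Fin p) (h : z ∈ orb w) : gen i z ∈ orb w :=
  mem_orb_of_mem (gen_mem_starGroup i) h

theorem gen_inv_mem_orb {w z : Word p} (i : Fin p) (h : z ∈ orb w) : (gen i)⁻¹ z ∈ orb w :=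
  mem_orb_of_mem (inv_mem (gen_mem_starGroup i)) h

theorem zpow_mem_orb {w z : Word p} (i : Fin p) (t : ℤ) (h : z ∈ orb w) :
    (gen i ^ t) z ∈ orb w :=
  mem_orb_of_mem (zpow_mem (gen_mem_starGroup i) t) h

theorem orb_eq_of_mem {w z : Word p} (h : z ∈ orb w) : orb z = orb w :=
  MulAction.orbit_eq_iff.mpr h

/-- A property which is preserved by the generators and their inverses is constant on orbits. -/
theorem orb_induction {w : Word p} {Q : Word p → Prop} (h0 : Q w)
    (h1 : ∀ i z, z ∈ orb w → Q z → Q (gen i z))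
    (h2 : ∀ i z, z ∈ orb w → Q z → Q ((gen i)⁻¹ z)) {z : Word p} (hz : z ∈ orb w) : Q z := by
  obtain ⟨⟨g, hg⟩, rfl⟩ := hz
  suffices H : ∀ z ∈ orb w, Q z → Q (g z) from H w (mem_orb_self w) h0
  have hnone : (starAutomaton p).act none = 1 := by
    ext z n
    change ((starAutomaton p).out ((starAutomaton p).run none z n) (z n)).val = _
    rw [run_none]; rfl
  induction hg using Subgroup.closure_induction'' with
  | mem x hx =>
    obtain ⟨s, rfl⟩ := hx
    cases s with
    | none => rw [hnone]; exact fun z _ h => h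
    | some i => exact h1 i
  | inv_mem x hx =>
    obtain ⟨s, rfl⟩ := hx
    cases s with
    | none => rw [hnone, inv_one]; exact fun z _ h => h
    | some i => exact h2 i
  | one => exact fun z _ h => h
  | mul x y hx hy ihx ihy => exact fun z hz h => ihx _ (mem_orb_of_mem hy hz) (ihy z hz h)

theorem exists_mem_starGroup_zero (n : ℕ) : ∀ z : Word p, ∃ g ∈ starGroup p,
    (∀ l < n, g z l = 0) ∧ ∀ l ≥ n, g z l = z l := by
  induction n with
  | zero => exact fun z => ⟨1, one_mem _, by simp, by simp⟩
  | succ n ih =>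
    intro z
    obtain ⟨g, hg, hg1, hg2⟩ := ih z
    rcases Fin.eq_zero_or_eq_succ (z n) with h0 | ⟨i, hi⟩
    · refine ⟨g, hg, fun l hl => ?_, fun l hl => hg2 l (by omega)⟩
      rcases Nat.lt_succ_iff_lt_or_eq.mp hl with hl | rfl
      exacts [hg1 l hl, (hg2 l le_rfl).trans h0]
    · obtain ⟨t, ht1, ht2⟩ := exists_zpow_zero i (n + 1) (g z) (by
        intro l hl
        rcases Nat.lt_succ_iff_lt_or_eq.mp hl with hl | rfl
        exacts [.inl (hg1 l hl), .inr ((hg2 l le_rfl).trans hi)])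
      exact ⟨gen i ^ t * g, mul_mem (zpow_mem (gen_mem_starGroup i) t) hg, ht1,
        fun l hl => (ht2 l hl).trans (hg2 l (by omega))⟩

theorem Cofinal.refl (u : Word p) : Cofinal u u := ⟨0, fun _ _ => rfl⟩

theorem Cofinal.symm {u v : Word p} (h : Cofinal u v) : Cofinal v u :=
  let ⟨k, hk⟩ := h; ⟨k, fun n hn => (hk n hn).symm⟩

theorem Cofinal.trans {u v w : Word p} (h : Cofinal u v) (h' : Cofinal v w) : Cofinal u w :=
  let ⟨k, hk⟩ := h
  let ⟨l, hl⟩ := h'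
  ⟨max k l, fun n hn => (hk n (le_of_max_le_left hn)).trans (hl n (le_of_max_le_right hn))⟩

theorem mem_orb_of_cofinal {u v : Word p} (h : Cofinal u v) : u ∈ orb v := by
  obtain ⟨k, hk⟩ := h
  obtain ⟨g, hg, hg1, hg2⟩ := exists_mem_starGroup_zero k u
  obtain ⟨g', hg', hg1', hg2'⟩ := exists_mem_starGroup_zero k v
  have : g u = g' v := by
    funext l
    rcases lt_or_ge l k with hl | hl
    · rw [hg1 l hl, hg1' l hl]
    · rw [hg2 l hl, hg2' l hl, hk l hl]
  have h2 : u = g⁻¹ (g' v) := by rw [← this]; simp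
  rw [h2]
  exact mem_orb_of_mem (inv_mem hg) (mem_orb_of_mem hg' (mem_orb_self v))

theorem gen_cofinal {i : Fin p} {z : Word p} (h : ∃ n, z n ≠ 0) : Cofinal (gen i z) z :=
  let ⟨n, hn⟩ := h; ⟨n + 1, fun _ hl => gen_of_ne (t := n) (by omega) hn⟩

theorem gen_inv_cofinal {i : Fin p} {z : Word p} (h : ∃ n, z n ≠ i.succ) :
    Cofinal ((gen i)⁻¹ z) z :=
  let ⟨n, hn⟩ := h; ⟨n + 1, fun _ hl => gen_inv_of_ne (t := n) (by omega) hn⟩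

theorem cofinal_of_mem_orb {u v : Word p} (h0 : ¬ Cofinal v (fun _ => 0))
    (hi : ∀ i : Fin p, ¬ Cofinal v (fun _ => i.succ)) (h : u ∈ orb v) : Cofinal u v := by
  refine orb_induction (Q := fun z => Cofinal z v) (Cofinal.refl v) ?_ ?_ h
  · intro i z _ hz
    refine (gen_cofinal ?_).trans hz
    by_contra hc
    push Not at hc
    exact h0 (hz.symm.trans ⟨0, fun n _ => hc n⟩)
  · intro i z _ hz
    refine (gen_inv_cofinal ?_).trans hz
    by_contra hc
    push Not at hc
    exact hi i (hz.symm.trans ⟨0, fun n _ => hc n⟩)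

theorem const_mem_orb_zero (i : Fin p) : (fun _ => i.succ : Word p) ∈ orb (fun _ => 0) := by
  have : (fun _ => i.succ : Word p) = gen i (fun _ => 0) := by
    funext n; rw [gen_of_forall (by simp)]; simp
  rw [this]
  exact gen_mem_orb i (mem_orb_self _)

/-- Outside the orbit of `0 0 0 …`, the orbits are the cofinality classes. -/
theorem mem_orb_iff_cofinal {u v : Word p} (h0 : v ∉ orb (fun _ => 0)) :
    u ∈ orb v ↔ Cofinal u v := by
  refine ⟨cofinal_of_mem_orb (fun h => h0 (mem_orb_of_cofinal h)) fun i h => h0 ?_,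
    mem_orb_of_cofinal⟩
  rw [← orb_eq_of_mem (const_mem_orb_zero i)]
  exact mem_orb_of_cofinal h

/-! ### Branches of the cactus -/

/-- The first nonzero letter of `y` stands at the position `k`. -/
def Lead (y : Word p) (k : ℕ) : Prop := (∀ n < k, y n = 0) ∧ y k ≠ 0

theorem Lead.unique {y : Word p} {k l : ℕ} (hk : Lead y k) (hl : Lead y l) : k = l := by
  rcases lt_trichotomy k l with h | h | h
  exacts [(hk.2 (hl.1 k h)).elim, h, (hl.2 (hk.1 l h)).elim]

theorem exists_lead {y : Word p} (h : ∃ n, y n ≠ 0) : ∃ k, Lead y k := by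
  classical
  refine ⟨Nat.find h, fun n hn => ?_, Nat.find_spec h⟩
  simpa using Nat.find_min h hn

/-- The words which agree with `y` from the position `k` on and whose last nonzero letter before
the position `k` is `i + 1`. If the first nonzero letter of `y` stands at the position `k` and is
different from `i + 1`, these are the vertices which are separated from the rest of the graph by `y`
and are attached to `y` through the cycle of the `i`-th generator. -/
def branch (k : ℕ) (y : Word p) (i : Fin p) : Set (Word p) :=
  {z | (∀ n ≥ k, z n = y n) ∧ ∃ m < k, z m = i.succ ∧ ∀ l, m < l → l < k → z l = 0}

theorem gen_mem_branch {k : ℕ} {y z : Word p} {i j : Fin p} (hy : Lead y k)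
    (hz : z ∈ branch k y i) (hne : gen j z ≠ y) : gen j z ∈ branch k y i := by
  obtain ⟨ht, m, hmk, hm, hl⟩ := hz
  have hm0 : z m ≠ 0 := by rw [hm]; exact Fin.succ_ne_zero i
  have htail : ∀ n > m, gen j z n = z n := fun n hn => gen_of_ne hn hm0
  have ht' : ∀ n ≥ k, gen j z n = y n := fun n hn => by rw [htail n (by omega), ht n hn]
  have hl' : ∀ l, m < l → l < k → gen j z l = 0 := fun l h1 h2 => by rw [htail l h1, hl l h1 h2]
  rcases gen_dichotomy j z m with ⟨-, h⟩ | ⟨h, h'⟩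
  · exact ⟨ht', m, hmk, h.trans hm, hl'⟩
  by_cases hij : i = j
  · subst hij
    have hm' : gen i z m = 0 := by rw [h', hm]; simp
    cases m with
    | zero =>
      refine (hne (funext fun n => ?_)).elim
      rcases lt_or_ge n k with hn | hn
      · rw [hy.1 n hn]
        rcases Nat.eq_zero_or_pos n with rfl | h0
        exacts [hm', hl' n h0 hn]
      · exact ht' n hn
    | succ m =>
      refine ⟨ht', m, by omega, ?_, fun l h1 h2 => ?_⟩
      · rw [gen_of_forall fun t ht => h t (by omega), h m (by omega)]; simp
      · rcases Nat.lt_or_ge (m + 1) l with h3 | h3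
        · exact hl' l h3 h2
        · obtain rfl : l = m + 1 := by omega
          exact hm'
  · refine ⟨ht', m, hmk, ?_, hl'⟩
    rw [gen_other hm0 (by rw [hm]; simpa using hij), hm]

theorem mem_branch_of_gen {k : ℕ} {y z : Word p} {i j : Fin p} (hy : Lead y k)
    (hik : i.succ ≠ y k) (hz : gen j z ∈ branch k y i) (hne : z ≠ y) : z ∈ branch k y i := by
  obtain ⟨ht, m, hmk, hm, hl⟩ := hz
  by_cases h : ∃ t < m + 1, z t ≠ 0
  · obtain ⟨t, htm, h0⟩ := h
    have htail : ∀ n > m, gen j z n = z n := fun n hn => gen_of_ne (t := t) (by omega) h0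
    refine ⟨fun n hn => by rw [← htail n (by omega), ht n hn], m, hmk, ?_,
      fun l h1 h2 => by rw [← htail l h1, hl l h1 h2]⟩
    rcases gen_dichotomy j z m with ⟨-, h⟩ | ⟨h, h'⟩
    · rw [← h, hm]
    · obtain rfl : t = m := by
        by_contra hc
        exact h0 (h t (by omega))
      rw [h'] at hm
      by_cases hj : z t = j.succ
      · rw [hj, Equiv.swap_apply_right] at hm
        exact (Fin.succ_ne_zero i hm.symm).elim
      · rwa [Equiv.swap_apply_of_ne_of_ne h0 hj] at hm
  · push Not at h
    rw [gen_of_forall fun t ht => h t (by omega), h m (by omega), Equiv.swap_apply_left] at hm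
    obtain rfl : j = i := Fin.succ_injective p hm
    have h1 := gen_of_forall (i := j) (z := z) (n := m + 1) h
    rcases Nat.lt_or_ge (m + 1) k with hk | hk
    · rw [hl (m + 1) (by omega) hk] at h1
      have h2 : z (m + 1) = j.succ := by
        have := congrArg (Equiv.swap 0 j.succ) h1
        simpa using this.symm
      have htail : ∀ n > m + 1, gen j z n = z n :=
        fun n hn => gen_of_ne hn (by rw [h2]; exact Fin.succ_ne_zero j)
      exact ⟨fun n hn => by
          rcases hn.lt_or_eq with hn | rfl
          · rw [← htail n (by omega), ht n (by omega)]
          · rw [← htail k hk, ht k le_rfl], m + 1, hk, h2,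
        fun l h1 h2 => by rw [← htail l h1, hl l (by omega) h2]⟩
    · obtain rfl : k = m + 1 := by omega
      rw [ht _ le_rfl] at h1
      have h2 : z (m + 1) = y (m + 1) := by
        have := congrArg (Equiv.swap 0 j.succ) h1
        rw [Equiv.swap_apply_self, Equiv.swap_apply_of_ne_of_ne hy.2 hik.symm] at this
        exact this.symm
      refine (hne (funext fun n => ?_)).elim
      rcases Nat.lt_trichotomy n (m + 1) with hn | rfl | hn
      · rw [h n hn, hy.1 n hn]
      · exact h2
      · rw [← ht n hn.le, gen_of_ne hn (by rw [h2]; exact hy.2)]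

theorem gen_inv_mem_branch {k : ℕ} {y z : Word p} {i j : Fin p} (hy : Lead y k)
    (hik : i.succ ≠ y k) (hz : z ∈ branch k y i) (hne : (gen j)⁻¹ z ≠ y) :
    (gen j)⁻¹ z ∈ branch k y i :=
  mem_branch_of_gen (j := j) hy hik (by simpa using hz) hne

theorem gen_self_mem_branch {k : ℕ} {y : Word p} {i : Fin p} (hy : Lead y k)
    (hik : i.succ ≠ y k) (hne : gen i y ≠ y) : gen i y ∈ branch k y i := by
  cases k with
  | zero => exact (hne (gen_fixed hy.2 hik.symm)).elim
  | succ k =>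
    refine ⟨gen_tail hy.2 hik.symm, k, by omega, ?_, fun l _ _ => by omega⟩
    rw [gen_of_forall fun t ht => hy.1 t (by omega), hy.1 k (by omega), Equiv.swap_apply_left]

theorem gen_inv_self_mem_branch {k : ℕ} {y : Word p} {i : Fin p} (hy : Lead y k)
    (hik : i.succ ≠ y k) (hne : (gen i)⁻¹ y ≠ y) : (gen i)⁻¹ y ∈ branch k y i := by
  cases k with
  | zero => exact (hne (by rw [Equiv.Perm.inv_eq_iff_eq, gen_fixed hy.2 hik.symm])).elim
  | succ k =>
    -- the inverse generator changes only the first letter of `y`, from `0` to `i`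
    have hl : ∀ l > 0, (gen i)⁻¹ y l = y l := fun l hl =>
      gen_inv_of_ne hl (by rw [hy.1 0 (by omega)]; exact (Fin.succ_ne_zero i).symm)
    refine ⟨fun n hn => hl n (by omega), 0, by omega, ?_, fun l h1 h2 => ?_⟩
    · rw [gen_inv_of_forall (by simp), hy.1 0 (by omega), Equiv.swap_apply_left]
    · rw [hl l h1, hy.1 l h2]

/-- The vertex `y` together with all the branches at `y` except for the one which contains the
cycle of the first nonzero letter of `y`: a finite part of the graph which is attached to the rest
through `y` only. For `y = 0 0 0 …` every branch is infinite, and only the vertex `y` is left. -/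
def hang (y : Word p) : Set (Word p) :=
  {z | z = y ∨ ∃ k i, Lead y k ∧ i.succ ≠ y k ∧ z ∈ branch k y i}

theorem self_mem_hang (y : Word p) : y ∈ hang y := .inl rfl

theorem gen_mem_hang {y z : Word p} (j : Fin p) (hz : z ∈ hang y) (hne : z ≠ y) :
    gen j z ∈ hang y := by
  rcases hz with h | ⟨k, i, hk, hi, h⟩
  · exact (hne h).elim
  · by_cases hg : gen j z = y
    exacts [.inl hg, .inr ⟨k, i, hk, hi, gen_mem_branch hk h hg⟩]

theorem gen_inv_mem_hang {y z : Word p} (j : Fin p) (hz : z ∈ hang y) (hne : z ≠ y) :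
    (gen j)⁻¹ z ∈ hang y := by
  rcases hz with h | ⟨k, i, hk, hi, h⟩
  · exact (hne h).elim
  · by_cases hg : (gen j)⁻¹ z = y
    exacts [.inl hg, .inr ⟨k, i, hk, hi, gen_inv_mem_branch hk hi h hg⟩]

theorem gen_self_mem_hang {k : ℕ} {y : Word p} {j : Fin p} (hy : Lead y k) (hj : j.succ ≠ y k) :
    gen j y ∈ hang y := by
  by_cases hg : gen j y = y
  exacts [.inl hg, .inr ⟨k, j, hy, hj, gen_self_mem_branch hy hj hg⟩]

theorem gen_inv_self_mem_hang {k : ℕ} {y : Word p} {j : Fin p} (hy : Lead y k)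
    (hj : j.succ ≠ y k) : (gen j)⁻¹ y ∈ hang y := by
  by_cases hg : (gen j)⁻¹ y = y
  exacts [.inl hg, .inr ⟨k, j, hy, hj, gen_inv_self_mem_branch hy hj hg⟩]

theorem hang_zero {y : Word p} (hy : ∀ n, y n = 0) : hang y = {y} := by
  ext z
  refine ⟨fun h => ?_, fun h => .inl h⟩
  rcases h with h | ⟨k, i, hk, -⟩
  exacts [h, (hk.2 (hy k)).elim]

theorem tail_of_mem_hang {k : ℕ} {y z : Word p} (hy : Lead y k) (hz : z ∈ hang y) :
    ∀ n ≥ k, z n = y n := by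
  rcases hz with rfl | ⟨l, i, hl, -, h, -⟩
  · exact fun _ _ => rfl
  · rw [hy.unique hl]
    exact h

theorem eq_of_mem_hang {k : ℕ} {y z : Word p} {i : Fin p} (hy : Lead y k) (hi : y k = i.succ)
    (hz : z ∈ hang y) (hf : ∀ l < k, z l = 0 ∨ z l = i.succ) : z = y := by
  rcases hz with h | ⟨l, j, hl, hj, -, m, hml, hm, -⟩
  · exact h
  · obtain rfl := hy.unique hl
    rcases hf m hml with h | h
    · exact (Fin.succ_ne_zero j (hm.symm.trans h)).elim
    · exact (hj (hm.symm.trans (h.trans hi.symm))).elim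

theorem mem_hang_iff {k : ℕ} {y z : Word p} (hy : Lead y k) : z ∈ hang y ↔
    (∀ n ≥ k, z n = y n) ∧ ∀ m < k, (∀ l, m < l → l < k → z l = 0) → z m ≠ y k := by
  constructor
  · intro hz
    refine ⟨tail_of_mem_hang hy hz, fun m hm hl h => ?_⟩
    rcases hz with rfl | ⟨l, j, hl', hj, -, m', hml, hm', hl''⟩
    · exact hy.2 (h ▸ hy.1 m hm)
    · obtain rfl := hy.unique hl'
      rcases lt_trichotomy m m' with hlt | rfl | hlt
      · exact Fin.succ_ne_zero j (hm'.symm.trans (hl m' hlt hml))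
      · exact hj (hm'.symm.trans h)
      · exact hy.2 (h.symm.trans (hl'' m hlt hm))
  · rintro ⟨ht, h⟩
    by_cases hz : ∀ n < k, z n = 0
    · refine .inl (funext fun n => ?_)
      rcases lt_or_ge n k with hn | hn
      exacts [(hz n hn).trans (hy.1 n hn).symm, ht n hn]
    · push Not at hz
      obtain ⟨n, hn, hn0⟩ := hz
      classical
      set m := Nat.findGreatest (fun m => m < k ∧ z m ≠ 0) k with hm
      have hsp : m < k ∧ z m ≠ 0 :=
        Nat.findGreatest_spec (P := fun m => m < k ∧ z m ≠ 0) hn.le ⟨hn, hn0⟩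
      have hmax : ∀ l, m < l → l < k → z l = 0 := by
        intro l h1 h2
        by_contra hc
        exact Nat.findGreatest_is_greatest (P := fun m => m < k ∧ z m ≠ 0) h1 h2.le ⟨h2, hc⟩
      obtain ⟨i, hi⟩ := Fin.exists_succ_eq.mpr hsp.2
      exact .inr ⟨k, i, hy, fun hc => h m hsp.1 hmax (hi.symm.trans hc), ht, m, hsp.1, hi.symm,
        hmax⟩

theorem finite_of_tail {X : Type} [Finite X] (k : ℕ) (y : ℕ → X) :
    {z : ℕ → X | ∀ n ≥ k, z n = y n}.Finite := by
  refine Set.Finite.of_finite_image (f := fun z : ℕ → X => fun n : Fin k => z n)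
    (Set.toFinite _) ?_
  intro z hz z' hz' h
  funext n
  rcases lt_or_ge n k with hn | hn
  exacts [congrFun h ⟨n, hn⟩, (hz n hn).trans (hz' n hn).symm]

theorem hang_finite (y : Word p) : (hang y).Finite := by
  by_cases h : ∃ n, y n ≠ 0
  · obtain ⟨k, hk⟩ := exists_lead h
    exact (finite_of_tail k y).subset fun z hz => tail_of_mem_hang hk hz
  · push Not at h
    rw [hang_zero h]
    exact Set.finite_singleton y

/-! ### Counting the ends of a graph -/

section Ends

open Opposite

variable {V : Type} {G : SimpleGraph V}

/-- An injective ray converges to an end. -/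
theorem exists_end_of_ray {r : ℕ → V} (hinj : Function.Injective r)
    (hadj : ∀ t, G.Adj (r t) (r (t + 1))) :
    ∃ e ∈ G.end, ∀ K : Finset V, ∃ N, ∀ t ≥ N,
      r t ∈ SimpleGraph.ComponentCompl.supp (G := G) (K := (K : Set V)) (e (op K)) := by
  have hN : ∀ K : Finset V, ∃ N, ∀ t ≥ N, r t ∉ (K : Set V) := by
    intro K
    have hf : (r ⁻¹' (K : Set V)).Finite := K.finite_toSet.preimage hinj.injOn
    obtain ⟨N, hN⟩ := hf.bddAbove
    refine ⟨N + 1, fun t ht h => ?_⟩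
    have := hN (show t ∈ r ⁻¹' (K : Set V) from h)
    omega
  choose N hN using hN
  have key : ∀ (K : Finset V) (s : ℕ) (hs : ∀ t ≥ s, r t ∉ (K : Set V)) (t : ℕ) (ht : s ≤ t),
      G.componentComplMk (hs t ht) = G.componentComplMk (hs s le_rfl) := by
    intro K s hs t ht
    induction t, ht using Nat.le_induction with
    | base => rfl
    | succ t ht ih =>
      rw [← ih]
      exact (SimpleGraph.componentComplMk_eq_of_adj G _ _ (hadj t)).symm
  refine ⟨fun K => G.componentComplMk (hN K.unop _ le_rfl), ?_, fun K => ⟨N K, fun t ht => ?_⟩⟩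
  · intro K L f
    have hLK : (L.unop : Set V) ⊆ K.unop := CategoryTheory.le_of_op_hom f
    have hK : ∀ t ≥ N K.unop, r t ∉ (L.unop : Set V) := fun t ht h => hN K.unop t ht (hLK h)
    change G.componentComplMk (hK _ le_rfl) = G.componentComplMk (hN L.unop _ le_rfl)
    rw [← key L.unop _ hK (max (N K.unop) (N L.unop)) (le_max_left _ _),
      ← key L.unop _ (hN L.unop) (max (N K.unop) (N L.unop)) (le_max_right _ _)]
  · exact ⟨hN K t ht, key K _ (hN K) t ht⟩

theorem mem_of_mem_component {K : Set V} {S : Set V}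
    (hS : ∀ x y, x ∈ S → G.Adj x y → y ∉ K → y ∈ S) {C : G.ComponentCompl K} {x y : V}
    (hx : x ∈ C) (hy : y ∈ C) (hxS : x ∈ S) : y ∈ S := by
  obtain ⟨hxK, rfl⟩ := hx
  obtain ⟨hyK, h⟩ := hy
  have hr := (SimpleGraph.ConnectedComponent.eq.mp h).symm
  rw [SimpleGraph.reachable_iff_reflTransGen] at hr
  suffices H : ∀ b : (Kᶜ : Set V), Relation.ReflTransGen (G.induce Kᶜ).Adj ⟨x, hxK⟩ b → b.1 ∈ S from
    H _ hr
  intro b hb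
  induction hb with
  | refl => exact hxS
  | tail _ h ih => rename_i c hc; exact hS _ _ ih h c.property

/-- If the rays `r a` are separated by finite sets and if, for arbitrarily large finite sets `K`,
every component of the complement of `K` contains the tail of a ray, then the ends of the graph
correspond to the rays. -/
theorem end_encard_of_rays {ι : Type} [Finite ι] (r : ι → ℕ → V)
    (hinj : ∀ a, Function.Injective (r a)) (hadj : ∀ a t, G.Adj (r a t) (r a (t + 1)))
    (hsep : ∀ a b, a ≠ b → ∃ (K : Finset V) (S : Set V),
      (∀ x y, x ∈ S → G.Adj x y → y ∉ (K : Set V) → y ∈ S) ∧ (∀ t, r a t ∈ S) ∧ ∀ t, r b t ∉ S)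
    (hcov : ∀ K : Finset V, ∃ K' : Finset V, K ⊆ K' ∧ ∀ C : G.ComponentCompl K',
      ∃ a N, ∀ t ≥ N, r a t ∈ C) :
    G.end.encard = ENat.card ι := by
  choose e he hr using fun a => exists_end_of_ray (hinj a) (hadj a)
  have hinj' : Function.Injective e := by
    intro a b hab
    by_contra hne
    obtain ⟨K, S, hS, ha, hb⟩ := hsep a b hne
    obtain ⟨N, hN⟩ := hr a K
    obtain ⟨M, hM⟩ := hr b K
    rw [← hab] at hM
    exact hb _ (mem_of_mem_component hS (hN _ le_rfl) (hM _ le_rfl) (ha _))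
  have hrange : G.end = Set.range e := by
    apply Set.Subset.antisymm
    · intro s hs
      by_contra hc
      have hc' : ∀ a, ∃ K : Finset V, s (op K) ≠ e a (op K) := by
        intro a
        by_contra h
        push Not at h
        exact hc ⟨a, (funext fun K => h K.unop).symm⟩
      choose K hK using hc'
      classical
      have := Fintype.ofFinite ι
      obtain ⟨K', hKK', hK'⟩ := hcov (Finset.univ.biUnion K)
      obtain ⟨a, N, ha⟩ := hK' (s (op K'))
      have hle : K a ⊆ K' := (Finset.subset_biUnion_of_mem K (Finset.mem_univ a)).trans hKK'
      have hsK := hs (CategoryTheory.opHomOfLE hle)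
      obtain ⟨M, hM⟩ := hr a (K a)
      refine hK a ?_
      rw [← hsK]
      have h1 : r a (max N M) ∈ SimpleGraph.ComponentCompl.supp (G := G) (K := (K a : Set V))
          (G.componentComplFunctor.map (CategoryTheory.opHomOfLE hle) (s (op K'))) :=
        SimpleGraph.ComponentCompl.subset_hom (K := (K a : Set V)) (L := (K' : Set V))
          (s (op K')) hle (ha _ (le_max_left _ _))
      have h2 := hM (max N M) (le_max_right _ _)
      obtain ⟨_, h1⟩ := h1
      obtain ⟨_, h2⟩ := h2
      exact h1.symm.trans h2
    · rintro _ ⟨a, rfl⟩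
      exact he a
  rw [hrange, ← Set.image_univ, hinj'.encard_image, Set.encard_univ]

/-- A connected locally finite graph has one end if the complements of arbitrarily large finite sets
are nonempty and connected. -/
theorem end_encard_eq_one (hG : G.Preconnected) (hfin : ∀ v, (G.neighborSet v).Finite)
    (h : ∀ K : Finset V, ∃ K' : Finset V, K ⊆ K' ∧ (∃ x, x ∉ K') ∧
      Subsingleton (G.ComponentCompl K')) : G.end.encard = 1 := by
  have hinf : Infinite V := by
    by_contra hc
    have := not_infinite_iff_finite.mp hc
    have := Fintype.ofFinite V
    obtain ⟨K', hK', ⟨x, hx⟩, -⟩ := h Finset.univ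
    exact hx (hK' (Finset.mem_univ x))
  have hlf : G.LocallyFinite := fun v => (hfin v).fintype
  have hfact : Fact G.Preconnected := ⟨hG⟩
  obtain ⟨e, he⟩ := SimpleGraph.nonempty_ends_of_infinite G
  rw [Set.encard_eq_one]
  refine ⟨e, Set.eq_singleton_iff_unique_mem.mpr ⟨he, fun s hs => funext fun K => ?_⟩⟩
  obtain ⟨K', hKK', -, hsub⟩ := h K.unop
  rw [← hs (CategoryTheory.opHomOfLE hKK' : op K' ⟶ K), ← he (CategoryTheory.opHomOfLE hKK' : op K' ⟶ K)]
  exact congrArg _ (hsub.elim _ _)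

end Ends

/-! ### The ends of the Schreier graphs -/

theorem mult_ne_zero_iff {w : Word p} {a b : orb w} : (schreier w).mult a b ≠ 0 ↔
    ∃ i : Fin p, gen i a.1 = b.1 ∨ (gen i)⁻¹ a.1 = b.1 := by
  have h : ∀ Q : Fin p → Prop, Nat.card {i : Fin p // Q i} ≠ 0 ↔ ∃ i, Q i := fun Q => by
    rw [Nat.card_ne_zero]
    exact ⟨fun ⟨⟨i⟩, _⟩ => ⟨i.1, i.2⟩, fun ⟨i, hi⟩ => ⟨⟨i, hi⟩, inferInstance⟩⟩
  have hadd : ∀ x y : ℕ, x + y ≠ 0 ↔ x ≠ 0 ∨ y ≠ 0 := by omega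
  change _ + _ ≠ 0 ↔ _
  rw [hadd, h, h, ← exists_or]

theorem adj_iff {w : Word p} {a b : orb w} : (schreier w).toSimple.Adj a b ↔
    a ≠ b ∧ ∃ i : Fin p, gen i a.1 = b.1 ∨ (gen i)⁻¹ a.1 = b.1 :=
  and_congr_right fun _ => mult_ne_zero_iff

theorem schreier_preconnected (w : Word p) : (schreier w).toSimple.Preconnected := by
  suffices H : ∀ z (hz : z ∈ orb w),
      (schreier w).toSimple.Reachable ⟨w, mem_orb_self w⟩ ⟨z, hz⟩ from
    fun a b => (H a.1 a.2).symm.trans (H b.1 b.2)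
  have step : ∀ (z z' : Word p) (hz : z ∈ orb w) (hz' : z' ∈ orb w),
      (∃ i : Fin p, gen i z = z' ∨ (gen i)⁻¹ z = z') →
      (schreier w).toSimple.Reachable ⟨z, hz⟩ ⟨z', hz'⟩ := by
    intro z z' hz hz' h
    by_cases he : z = z'
    · subst he; rfl
    · exact SimpleGraph.Adj.reachable (adj_iff.mpr ⟨fun hc => he (congrArg Subtype.val hc), h⟩)
  intro z hz
  refine orb_induction (Q := fun z => ∀ hz : z ∈ orb w,
      (schreier w).toSimple.Reachable ⟨w, mem_orb_self w⟩ ⟨z, hz⟩) (fun _ => by rfl) ?_ ?_ hz hz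
  · intro i z hz h hz'
    exact (h hz).trans (step _ _ hz hz' ⟨i, .inl rfl⟩)
  · intro i z hz h hz'
    exact (h hz).trans (step _ _ hz hz' ⟨i, .inr rfl⟩)

theorem neighborSet_finite {w : Word p} (a : orb w) :
    ((schreier w).toSimple.neighborSet a).Finite := by
  refine Set.Finite.subset (Set.finite_range fun x : Fin p × Bool =>
    if x.2 then (⟨gen x.1 a.1, gen_mem_orb x.1 a.2⟩ : orb w)
    else ⟨(gen x.1)⁻¹ a.1, gen_inv_mem_orb x.1 a.2⟩) ?_
  intro b hb
  obtain ⟨-, i, h | h⟩ := adj_iff.mp hb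
  exacts [⟨(i, true), Subtype.ext h⟩, ⟨(i, false), Subtype.ext h⟩]

/-- The base point `y` of a system of lines: the words `gen i ^ t y`, for `i ∈ I` and `t` an integer,
form lines in the Schreier graph which meet at most in `y`, and no other branch of the graph is
infinite. -/
structure LineSystem (y : Word p) (I : Finset (Fin p)) : Prop where
  full : ∀ i ∈ I, ∀ n, y n = 0 ∨ y n = i.succ
  ne_zero : ∀ i ∈ I, ∀ t : ℤ, t ≠ 0 → ∃ n, (gen i ^ t) y n ≠ 0
  univ : (∀ n, y n = 0) → ∀ i, i ∈ I
  nonempty : I.Nonempty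

namespace LineSystem

variable {y : Word p} {I : Finset (Fin p)} (h : LineSystem y I)

include h

theorem full_zpow {i : Fin p} (hi : i ∈ I) (t : ℤ) (n : ℕ) :
    (gen i ^ t) y n = 0 ∨ (gen i ^ t) y n = i.succ :=
  (zpow_mem_iff t).mpr (h.full i hi n)

theorem lead {i : Fin p} (hi : i ∈ I) {t : ℤ} {k : ℕ} (hk : Lead ((gen i ^ t) y) k) :
    (gen i ^ t) y k = i.succ :=
  (h.full_zpow hi t k).resolve_left hk.2

theorem eq_of_mem_hang {i j : Fin p} (hi : i ∈ I) (hj : j ∈ I) {s t : ℤ}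
    (hm : (gen i ^ t) y ∈ hang ((gen j ^ s) y)) : (i = j ∧ t = s) ∨ (t = 0 ∧ s = 0) := by
  by_cases hs : ∃ n, (gen j ^ s) y n ≠ 0
  · obtain ⟨k, hk⟩ := exists_lead hs
    have hkj := h.lead hj hk
    by_cases hij : i = j
    · subst hij
      exact .inl ⟨rfl, zpow_injective_of_full (h.full i hi)
        (StarAut.eq_of_mem_hang hk hkj hm fun l _ => h.full_zpow hi t l)⟩
    · have h1 := tail_of_mem_hang hk hm k le_rfl
      rw [hkj] at h1
      rcases h.full_zpow hi t k with h2 | h2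
      · exact (Fin.succ_ne_zero j (h1.symm.trans h2)).elim
      · exact (hij (Fin.succ_injective p (h2.symm.trans h1))).elim
  · push Not at hs
    have hs0 : s = 0 := by
      by_contra hc
      obtain ⟨n, hn⟩ := h.ne_zero j hj s hc
      exact hn (hs n)
    rw [hang_zero hs] at hm
    refine .inr ⟨?_, hs0⟩
    by_contra hc
    obtain ⟨n, hn⟩ := h.ne_zero i hi t hc
    exact hn (by rw [hm, hs n])

/-- The part of the graph hanging at a vertex of a line can be left only along a line. -/
theorem step {i j : Fin p} (hi : i ∈ I) {t : ℤ} {z z' : Word p} (hz : z ∈ hang ((gen i ^ t) y))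
    (hz' : gen j z = z' ∨ (gen j)⁻¹ z = z') : z' ∈ hang ((gen i ^ t) y) ∨
      (z = (gen i ^ t) y ∧ ∃ i' ∈ I, ∃ t' : ℤ, (i' = i ∨ t = 0) ∧ (t' = t + 1 ∨ t' = t - 1) ∧
        z' = (gen i' ^ t') y) := by
  by_cases hne : z = (gen i ^ t) y
  swap
  · rcases hz' with rfl | rfl
    exacts [.inl (gen_mem_hang j hz hne), .inl (gen_inv_mem_hang j hz hne)]
  have key : ∀ i' ∈ I, (i' = i ∨ t = 0) → j = i' → z' ∈ hang ((gen i ^ t) y) ∨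
      (z = (gen i ^ t) y ∧ ∃ i' ∈ I, ∃ t' : ℤ, (i' = i ∨ t = 0) ∧ (t' = t + 1 ∨ t' = t - 1) ∧
        z' = (gen i' ^ t') y) := by
    rintro i' hi' hor rfl
    have hz1 : z = (gen j ^ t) y := by
      rcases hor with rfl | rfl
      exacts [hne, hne]
    rcases hz' with rfl | rfl
    · exact .inr ⟨hne, j, hi', t + 1, hor, .inl rfl, by rw [zpow_succ_apply, hz1]⟩
    · exact .inr ⟨hne, j, hi', t - 1, hor, .inr rfl, by rw [zpow_pred_apply, hz1]⟩
  by_cases hs : ∃ n, (gen i ^ t) y n ≠ 0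
  · obtain ⟨k, hk⟩ := exists_lead hs
    have hki := h.lead hi hk
    by_cases hij : j = i
    · exact key i hi (.inl rfl) hij
    · have hj : j.succ ≠ (gen i ^ t) y k := by rw [hki]; simpa using hij
      rw [hne] at hz'
      rcases hz' with rfl | rfl
      exacts [.inl (gen_self_mem_hang hk hj), .inl (gen_inv_self_mem_hang hk hj)]
  · push Not at hs
    have ht : t = 0 := by
      by_contra hc
      obtain ⟨n, hn⟩ := h.ne_zero i hi t hc
      exact hn (hs n)
    exact key j (h.univ (fun n => by simpa [ht] using hs n) j) (.inr ht) rfl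

theorem exists_mem_hang {z : Word p} (hz : z ∈ orb y) :
    ∃ i ∈ I, ∃ t : ℤ, z ∈ hang ((gen i ^ t) y) := by
  have hstep : ∀ (j : Fin p) (z z' : Word p), (gen j z = z' ∨ (gen j)⁻¹ z = z') →
      (∃ i ∈ I, ∃ t : ℤ, z ∈ hang ((gen i ^ t) y)) →
      ∃ i ∈ I, ∃ t : ℤ, z' ∈ hang ((gen i ^ t) y) := by
    rintro j z z' hz' ⟨i, hi, t, ht⟩
    rcases h.step hi ht hz' with h' | ⟨-, i', hi', t', -, -, rfl⟩
    exacts [⟨i, hi, t, h'⟩, ⟨i', hi', t', self_mem_hang _⟩]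
  refine orb_induction (Q := fun z => ∃ i ∈ I, ∃ t : ℤ, z ∈ hang ((gen i ^ t) y)) ?_
    (fun i z _ => hstep i z _ (.inl rfl)) (fun i z _ => hstep i z _ (.inr rfl)) hz
  obtain ⟨i, hi⟩ := h.nonempty
  exact ⟨i, hi, 0, self_mem_hang _⟩

end LineSystem

/-- The direction `1` or `-1` in which a line is traversed. -/
def dir (ε : Bool) : ℤ := if ε then 1 else -1

theorem dir_cases (ε : Bool) : dir ε = 1 ∨ dir ε = -1 := by cases ε <;> simp [dir]

/-- The half-line starting next to `y` in one of the two directions of the `i`-th generator. -/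
def ray (y : Word p) {I : Finset (Fin p)} (a : I × Bool) (t : ℕ) : orb y :=
  ⟨(gen a.1.1 ^ (dir a.2 * (t + 1))) y, zpow_mem_orb _ _ (mem_orb_self y)⟩

namespace LineSystem

variable {y : Word p} {I : Finset (Fin p)}

theorem ray_injective (h : LineSystem y I) (a : I × Bool) :
    Function.Injective (ray y a) := by
  intro s t hst
  have := zpow_injective_of_full (h.full a.1.1 a.1.2) (congrArg Subtype.val hst)
  rcases dir_cases a.2 with hd | hd <;> rw [hd] at this <;> omega

theorem ray_adj (h : LineSystem y I) (a : I × Bool) (t : ℕ) :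
    (schreier y).toSimple.Adj (ray y a t) (ray y a (t + 1)) := by
  refine adj_iff.mpr ⟨fun hc => ?_, a.1.1, ?_⟩
  · have := h.ray_injective a hc
    omega
  · simp only [ray]
    rcases dir_cases a.2 with hd | hd <;> rw [hd]
    · left
      rw [← zpow_succ_apply]
      congr 2
    · right
      rw [← zpow_pred_apply]
      congr 2

theorem ray_separated (h : LineSystem y I) {a b : I × Bool} (hab : a ≠ b) :
    ∃ S : Set (orb y), (∀ x z, x ∈ S → (schreier y).toSimple.Adj x z →
      z.1 ≠ y → z ∈ S) ∧ (∀ t, ray y a t ∈ S) ∧ ∀ t, ray y b t ∉ S := by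
  refine ⟨{z | ∃ t : ℤ, 0 < t ∧ z.1 ∈ hang ((gen a.1.1 ^ (dir a.2 * t)) y)}, ?_, ?_, ?_⟩
  · rintro x z ⟨t, ht, hx⟩ hadj hz
    obtain ⟨-, j, hj⟩ := adj_iff.mp hadj
    rcases h.step a.1.2 hx hj with h' | ⟨-, i', hi', t', hor, ht', he⟩
    · exact ⟨t, ht, h'⟩
    · have hdt : dir a.2 * t ≠ 0 := by
        rcases dir_cases a.2 with hd | hd <;> rw [hd] <;> omega
      obtain rfl : i' = a.1.1 := hor.resolve_right hdt
      have ht0 : t' ≠ 0 := by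
        rintro rfl
        exact hz he
      refine ⟨dir a.2 * t', ?_, ?_⟩
      · rcases dir_cases a.2 with hd | hd <;> rw [hd] at ht' hdt ⊢ <;> omega
      · have : dir a.2 * (dir a.2 * t') = t' := by
          rcases dir_cases a.2 with hd | hd <;> rw [hd] <;> ring
        rw [this, he]
        exact self_mem_hang _
  · exact fun t => ⟨t + 1, by omega, self_mem_hang _⟩
  · rintro s ⟨t, ht, hm⟩
    rcases h.eq_of_mem_hang b.1.2 a.1.2 hm with ⟨h1, h2⟩ | ⟨-, h2⟩
    · refine hab (Prod.ext (Subtype.ext h1.symm) ?_)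
      by_contra hc
      have : dir a.2 = - dir b.2 := by
        rcases a with ⟨_, _ | _⟩ <;> rcases b with ⟨_, _ | _⟩ <;> simp_all [dir]
      rw [this] at h2
      rcases dir_cases b.2 with hd | hd <;> rw [hd] at h2 <;> omega
    · rcases dir_cases a.2 with hd | hd <;> rw [hd] at h2 <;> omega

/-- The Schreier graph has two ends for every line. -/
theorem end_encard (h : LineSystem y I) :
    (schreier y).toSimple.end.encard = ((2 * I.card : ℕ) : ℕ∞) := by
  rw [end_encard_of_rays (ι := I × Bool) (ray y) h.ray_injective h.ray_adj]
  · rw [ENat.card_eq_coe_fintype_card, Fintype.card_prod, Fintype.card_coe, Fintype.card_bool,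
      mul_comm]
  · intro a b hab
    obtain ⟨S, hS, ha, hb⟩ := h.ray_separated hab
    refine ⟨{⟨y, mem_orb_self y⟩}, S, fun x z hx hadj hz => hS x z hx hadj fun hc => hz ?_, ha, hb⟩
    simpa using Subtype.ext hc
  · intro K
    classical
    choose i hi t ht using fun z : orb y => h.exists_mem_hang z.2
    set n := K.sup fun z => (t z).natAbs with hn
    have hfin : {z : orb y | ∃ i ∈ I, ∃ t : ℤ, t.natAbs ≤ n ∧
        z.1 ∈ hang ((gen i ^ t) y)}.Finite := by
      have hf : (⋃ i ∈ I, ⋃ t ∈ Finset.Icc (-(n : ℤ)) n, hang ((gen i ^ t) y)).Finite :=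
        Set.Finite.biUnion I.finite_toSet fun i _ =>
          Set.Finite.biUnion (Finset.finite_toSet _) fun t _ => hang_finite _
      refine (hf.preimage (f := (Subtype.val : orb y → Word p))
        Subtype.val_injective.injOn).subset ?_
      rintro z ⟨i, hi, t, htn, hz⟩
      simp only [Set.mem_preimage, Set.mem_iUnion]
      exact ⟨i, hi, t, by rw [Finset.mem_Icc]; omega, hz⟩
    have hK' : ∀ z : orb y, z ∈ (hfin.toFinset : Set (orb y)) ↔ ∃ i ∈ I, ∃ t : ℤ,
        t.natAbs ≤ n ∧ z.1 ∈ hang ((gen i ^ t) y) := by simp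
    refine ⟨hfin.toFinset, fun z hz => ?_, fun C => ?_⟩
    · exact (hK' z).mpr ⟨i z, hi z, t z, Finset.le_sup (f := fun z => (t z).natAbs) hz, ht z⟩
    obtain ⟨i₀, hi₀⟩ := h.nonempty
    obtain ⟨⟨x, x'⟩, hx, hx', hadj⟩ := C.exists_adj_boundary_pair (schreier_preconnected y)
      ⟨⟨y, mem_orb_self y⟩, (hK' _).mpr ⟨i₀, hi₀, 0, by simp, self_mem_hang _⟩⟩
    have hxK := SimpleGraph.ComponentCompl.notMem_of_mem hx
    rw [hK'] at hxK hx'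
    obtain ⟨i, hi, t, htn, hm⟩ := hx'
    obtain ⟨-, j, hj⟩ := adj_iff.mp hadj.symm
    rcases h.step hi hm hj with h' | ⟨-, i', hi', t', -, ht', he⟩
    · exact (hxK ⟨i, hi, t, htn, h'⟩).elim
    have htn' : ¬ t'.natAbs ≤ n := fun hc => hxK ⟨i', hi', t', hc, he ▸ self_mem_hang _⟩
    obtain ⟨ε, hε⟩ : ∃ ε, t' = dir ε * (n + 1) := by
      rcases le_total 0 t' with h0 | h0
      · exact ⟨true, by simp only [dir, if_true]; omega⟩
      · exact ⟨false, by simp only [dir]; grind⟩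
    refine ⟨(⟨i', hi'⟩, ε), n, fun s hs => ?_⟩
    induction s, hs using Nat.le_induction with
    | base =>
      have : x = ray y (⟨⟨i', hi'⟩, ε⟩ : I × Bool) n := Subtype.ext (he.trans (by rw [hε]; rfl))
      exact this ▸ hx
    | succ s hs ih =>
      refine SimpleGraph.ComponentCompl.mem_of_adj _ _ ih ?_ (h.ray_adj _ s)
      rw [hK']
      rintro ⟨j, hj, t, ht, hm⟩
      rcases h.eq_of_mem_hang hi' hj hm with ⟨-, h2⟩ | ⟨h2, -⟩ <;>
      rcases dir_cases ε with hd | hd <;> simp only [hd] at h2 <;> omega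

end LineSystem

/-- The `i`-th generator has a finite cycle through `y`: its least period on `y`. -/
theorem exists_period {i : Fin p} {y : Word p} (h : ∃ n, y n ≠ 0 ∧ y n ≠ i.succ) :
    ∃ T : ℕ, 0 < T ∧ (gen i ^ T) y = y ∧ ∀ s : ℕ, 0 < s → s < T → (gen i ^ s) y ≠ y := by
  classical
  obtain ⟨n, hn⟩ := h
  have hex : ∃ T : ℕ, 0 < T ∧ (gen i ^ T) y = y :=
    ⟨2 ^ n, by positivity, (gen_two_pow_fixed n).mpr ⟨n, le_rfl, hn⟩⟩
  refine ⟨Nat.find hex, (Nat.find_spec hex).1, (Nat.find_spec hex).2, fun s h0 hs hc => ?_⟩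
  exact Nat.find_min hex hs ⟨h0, hc⟩

theorem gen_pow_pred {i : Fin p} {y : Word p} {T : ℕ} (hT : 0 < T) (h : (gen i ^ T) y = y) :
    (gen i ^ (T - 1)) y = (gen i)⁻¹ y := by
  rw [Equiv.Perm.eq_inv_iff_eq, ← Equiv.Perm.mul_apply, ← pow_succ', Nat.sub_add_cancel hT, h]

/-- A Schreier graph without lines has one end. -/
theorem end_encard_eq_one_of_forall {y : Word p}
    (hy : ∀ i : Fin p, ∀ N, ∃ n ≥ N, y n ≠ 0 ∧ y n ≠ i.succ) (hp : 0 < p) :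
    (schreier y).toSimple.end.encard = 1 := by
  refine end_encard_eq_one (schreier_preconnected y) neighborSet_finite fun K => ?_
  classical
  have hcof : ∀ z : orb y, ∃ N, ∀ n ≥ N, z.1 n = y n := by
    intro z
    refine cofinal_of_mem_orb ?_ (fun i => ?_) z.2
    · rintro ⟨N, hN⟩
      obtain ⟨n, hn, h0, -⟩ := hy ⟨0, hp⟩ N
      exact h0 (hN n hn)
    · rintro ⟨N, hN⟩
      obtain ⟨n, hn, -, h0⟩ := hy i N
      exact h0 (hN n hn)
  choose N hN using hcof
  -- after a nonzero letter `c` at the position `k₁`, the next letter `a` different from `0` and `c`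
  -- determines the vertex through which all of `K` hangs
  obtain ⟨k₁, hk₁, hc0, -⟩ := hy ⟨0, hp⟩ (K.sup N)
  obtain ⟨c, hc⟩ := Fin.exists_succ_eq.mpr hc0
  have hex : ∃ k, k₁ ≤ k ∧ y k ≠ 0 ∧ y k ≠ c.succ := hy c k₁
  set k := Nat.find hex with hkdef
  obtain ⟨hk₁k, hka0, hkac⟩ := Nat.find_spec hex
  have hmin : ∀ m, k₁ ≤ m → m < k → y m = 0 ∨ y m = c.succ := by
    intro m h1 h2
    have := Nat.find_min hex h2
    tauto
  set ρ : Word p := fun n => if n < k then 0 else y n with hρ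
  have hρy : ∀ n ≥ k, ρ n = y n := fun n hn => by simp [hρ, not_lt.mpr hn]
  have hlead : Lead ρ k := ⟨fun n hn => by simp [hρ, hn], by rw [hρy k le_rfl]; exact hka0⟩
  obtain ⟨a, ha⟩ := Fin.exists_succ_eq.mpr hka0
  have hρk : ρ k = a.succ := by rw [hρy k le_rfl, ha]
  have hρorb : ρ ∈ orb y := mem_orb_of_cofinal ⟨k, hρy⟩
  have hfin : {z : orb y | z.1 ∈ hang ρ}.Finite :=
    (hang_finite ρ).preimage Subtype.val_injective.injOn
  have hmem : ∀ z : orb y, z ∈ (hfin.toFinset : Set (orb y)) ↔ z.1 ∈ hang ρ := by simp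
  have hper : ∃ n, ρ n ≠ 0 ∧ ρ n ≠ a.succ := by
    obtain ⟨n, hn, h⟩ := hy a k
    exact ⟨n, by rwa [hρy n hn]⟩
  obtain ⟨T, hT0, hT, hTmin⟩ := exists_period hper
  have hblock : ∀ l ≤ k, ρ l = 0 ∨ ρ l = a.succ := by
    intro l hl
    rcases hl.lt_or_eq with hl | rfl
    exacts [.inl (hlead.1 l hl), .inr hρk]
  have hcycle : ∀ s : ℕ, (gen a ^ s) ρ ∈ hang ρ → (gen a ^ s) ρ = ρ := fun s hs =>
    eq_of_mem_hang hlead hρk hs fun l hl => (zpow_mem_iff (s : ℤ)).mpr (hblock l hl.le)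
  have hout : ∀ s : ℕ, 0 < s → s < T → (gen a ^ s) ρ ∉ hang ρ :=
    fun s h0 hs hc => hTmin s h0 hs (hcycle s hc)
  have hgen : gen a ρ ≠ ρ := by
    have h1 := (gen_two_pow_fixed (i := a) 0 (z := ρ)).not.mpr (by
      rintro ⟨l, hl, h0, ha⟩
      exact (hblock l (by omega)).elim h0 ha)
    simpa using h1
  have hT1 : 1 < T := by
    by_contra hc
    obtain rfl : T = 1 := by omega
    exact hgen (by simpa using hT)
  set v : ℕ → orb y := fun s => ⟨(gen a ^ s) ρ, zpow_mem_orb a (s : ℤ) hρorb⟩ with hv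
  have hmk : ∀ s (h0 : 0 < s) (hs : s < T),
      (schreier y).toSimple.componentComplMk (K := (hfin.toFinset : Set (orb y))) (v := v s)
        ((hmem _).not.mpr (hout s h0 hs)) =
      (schreier y).toSimple.componentComplMk (v := v 1)
        ((hmem _).not.mpr (hout 1 one_pos hT1)) := by
    intro s h0
    induction s, h0 using Nat.le_induction with
    | base => exact fun _ => rfl
    | succ s h0 ih =>
      intro hs
      rw [← ih (by omega)]
      refine (SimpleGraph.componentComplMk_eq_of_adj _ _ _ ?_).symm
      have hgs : gen a ((gen a ^ s) ρ) = (gen a ^ (s + 1)) ρ := by rw [pow_succ']; rfl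
      refine adj_iff.mpr ⟨fun hc => ?_, a, .inl hgs⟩
      have h2 : (gen a ^ s) ρ = (gen a ^ s) (gen a ρ) := by
        have := congrArg Subtype.val hc
        rw [← Equiv.Perm.mul_apply, ← pow_succ]
        exact this
      exact hgen ((gen a ^ s).injective h2).symm
  refine ⟨hfin.toFinset, fun z hz => ?_, ⟨v 1, ?_⟩, ⟨?_⟩⟩
  · rw [Set.Finite.mem_toFinset]
    have hNz : N z ≤ k₁ := le_trans (Finset.le_sup hz) hk₁
    refine (mem_hang_iff hlead).mpr
      ⟨fun n hn => by rw [hN z n (by omega), hρy n hn], fun m hm hl h => ?_⟩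
    rw [hρy k le_rfl] at h
    rcases lt_or_ge m k₁ with hlt | hge
    · have hk : k₁ < k := by
        rcases hk₁k.lt_or_eq with h' | h'
        · exact h'
        · exact (hkac (h' ▸ hc.symm)).elim
      exact hc0 ((hN z k₁ hNz).symm.trans (hl k₁ hlt hk))
    · rw [hN z m (by omega)] at h
      rcases hmin m hge hm with h' | h'
      · exact hka0 (h ▸ h')
      · exact hkac (h ▸ h')
  · rw [Set.Finite.mem_toFinset]
    exact hout 1 one_pos hT1
  · suffices H : ∀ C : (schreier y).toSimple.ComponentCompl (hfin.toFinset : Set (orb y)),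
        C = (schreier y).toSimple.componentComplMk (v := v 1)
          ((hmem _).not.mpr (hout 1 one_pos hT1)) from fun C D => (H C).trans (H D).symm
    intro C
    obtain ⟨⟨x, x'⟩, hx, hx', hadj⟩ := C.exists_adj_boundary_pair (schreier_preconnected y)
      ⟨⟨ρ, hρorb⟩, (hmem _).mpr (self_mem_hang ρ)⟩
    have hxK := SimpleGraph.ComponentCompl.notMem_of_mem hx
    rw [hmem] at hxK hx'
    obtain ⟨-, j, hj⟩ := adj_iff.mp hadj.symm
    have hx'ρ : x'.1 = ρ := by
      by_contra hc
      rcases hj with hj | hj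
      · exact hxK (hj ▸ gen_mem_hang j hx' hc)
      · exact hxK (hj ▸ gen_inv_mem_hang j hx' hc)
    rw [hx'ρ] at hj
    obtain rfl : j = a := by
      by_contra hc
      have hjk : j.succ ≠ ρ k := by rw [hρk]; simpa using hc
      rcases hj with hj | hj
      · exact hxK (hj ▸ gen_self_mem_hang hlead hjk)
      · exact hxK (hj ▸ gen_inv_self_mem_hang hlead hjk)
    obtain ⟨s, h0, hs, hxs⟩ : ∃ s, ∃ (h0 : 0 < s) (hs : s < T), x = v s := by
      rcases hj with hj | hj
      · exact ⟨1, one_pos, hT1, Subtype.ext (hj.symm.trans (by simp [hv]))⟩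
      · exact ⟨T - 1, by omega, by omega, Subtype.ext (hj.symm.trans (gen_pow_pred hT0 hT).symm)⟩
    obtain ⟨hxn, rfl⟩ := hx
    subst hxs
    exact hmk s h0 hs

/-! ### The three types of words -/

/-- The Schreier graph on an orbit; the graph `schreier w` depends only on the orbit of `w`. -/
noncomputable def schreierOn (O : Set (Word p)) : Multigraph O where
  mult u v := Nat.card {i : Fin p // gen i u.1 = v.1} + Nat.card {i : Fin p // (gen i)⁻¹ u.1 = v.1}
  symm u v := by
    have h : ∀ (i : Fin p) (a b : Word p), (gen i)⁻¹ a = b ↔ gen i b = a := fun i a b =>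
      Equiv.Perm.inv_eq_iff_eq.trans eq_comm
    simp only [h]
    exact add_comm _ _

theorem schreier_eq (w : Word p) : schreier w = schreierOn (orb w) := rfl

theorem Isomorphic.refl {V : Type} (G : Multigraph V) : G.Isomorphic G :=
  ⟨Equiv.refl V, fun _ _ => rfl⟩

theorem Isomorphic.trans {U V W : Type} {G : Multigraph U} {H : Multigraph V} {K : Multigraph W}
    (h : G.Isomorphic H) (h' : H.Isomorphic K) : G.Isomorphic K :=
  let ⟨f, hf⟩ := h
  let ⟨g, hg⟩ := h'
  ⟨f.trans g, fun u v => (hg _ _).trans (hf u v)⟩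

theorem Isomorphic.symm {V W : Type} {G : Multigraph V} {H : Multigraph W}
    (h : G.Isomorphic H) : H.Isomorphic G :=
  let ⟨f, hf⟩ := h
  ⟨f.symm, fun u v => by rw [← hf]; simp⟩

theorem isomorphic_of_mem_orb {u v : Word p} (h : u ∈ orb v) :
    (schreier u).Isomorphic (schreier v) := by
  rw [schreier_eq, schreier_eq, orb_eq_of_mem h]
  exact Isomorphic.refl _

theorem end_encard_of_mem_orb {u v : Word p} (h : u ∈ orb v) :
    (schreier u).toSimple.end.encard = (schreier v).toSimple.end.encard := by
  rw [schreier_eq, schreier_eq, orb_eq_of_mem h]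

/-- The word in the letters `0` and `i + 1` with a given binary expansion. -/
def lineWord (i : Fin p) (β : ℕ → Bool) : Word p := fun n => if β n then i.succ else 0

/-- A binary sequence which is not eventually constant. -/
def Balanced (β : ℕ → Bool) : Prop := ∀ c : Bool, ∀ N, ∃ n ≥ N, β n = c

/-- From no position on does the word use only the letter `0` and one other letter. -/
def Mixed (u : Word p) : Prop := ∀ i : Fin p, ∀ N, ∃ n ≥ N, u n ≠ 0 ∧ u n ≠ i.succ

theorem trichotomy (u : Word p) : u ∈ orb (fun _ => 0) ∨
    (∃ i β, Balanced β ∧ Cofinal u (lineWord i β)) ∨ Mixed u := by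
  by_cases hm : Mixed u
  · exact .inr (.inr hm)
  simp only [Mixed, not_forall] at hm
  obtain ⟨i, N, hN⟩ := hm
  have hN' : ∀ n ≥ N, u n = 0 ∨ u n = i.succ := by
    intro n hn
    by_contra hc
    exact hN ⟨n, hn, not_or.mp hc⟩
  have hcof : Cofinal u (lineWord i fun n => decide (u n ≠ 0)) := by
    refine ⟨N, fun n hn => ?_⟩
    rcases hN' n hn with h | h <;> simp [lineWord, h, Fin.succ_ne_zero]
  by_cases hb : Balanced fun n => decide (u n ≠ 0)
  · exact .inr (.inl ⟨i, _, hb, hcof⟩)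
  left
  simp only [Balanced, not_forall] at hb
  obtain ⟨c, M, hM⟩ := hb
  push Not at hM
  cases c with
  | true =>
    refine mem_orb_of_cofinal ⟨M, fun n hn => ?_⟩
    simpa using hM n hn
  | false =>
    rw [← orb_eq_of_mem (const_mem_orb_zero i)]
    refine mem_orb_of_cofinal ⟨max M N, fun n hn => ?_⟩
    have := hM n (le_of_max_le_left hn)
    exact (hN' n (le_of_max_le_right hn)).resolve_left (by simpa using this)

theorem eventually_const_of_mem_orb_zero {u : Word p} (hu : u ∈ orb (fun _ => 0)) :
    ∃ c : Fin (p + 1), Cofinal u (fun _ => c) := by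
  refine orb_induction (Q := fun z => ∃ c : Fin (p + 1), Cofinal z (fun _ => c))
    ⟨0, Cofinal.refl _⟩ ?_ ?_ hu
  · rintro i z - ⟨c, hc⟩
    by_cases h : ∃ n, z n ≠ 0
    · exact ⟨c, (gen_cofinal h).trans hc⟩
    · push Not at h
      exact ⟨i.succ, 0, fun n _ => by rw [gen_of_forall fun t _ => h t, h n]; simp⟩
  · rintro i z - ⟨c, hc⟩
    by_cases h : ∃ n, z n ≠ i.succ
    · exact ⟨c, (gen_inv_cofinal h).trans hc⟩
    · push Not at h
      exact ⟨0, 0, fun n _ => by rw [gen_inv_of_forall fun t _ => h t, h n]; simp⟩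

theorem Balanced.lineWord_notMem {β : ℕ → Bool} (hβ : Balanced β) {u : Word p} {i : Fin p}
    (hu : Cofinal u (lineWord i β)) : u ∉ orb (fun _ => 0) := by
  intro h
  obtain ⟨c, hc⟩ := eventually_const_of_mem_orb_zero h
  obtain ⟨N, hN⟩ := hu.symm.trans hc
  obtain ⟨n, hn, h1⟩ := hβ true N
  obtain ⟨m, hm, h2⟩ := hβ false N
  have h3 := (hN n hn).trans (hN m hm).symm
  simp [lineWord, h1, h2, Fin.succ_ne_zero] at h3

theorem Mixed.notMem {u : Word p} (hu : Mixed u) (hp : 0 < p) : u ∉ orb (fun _ => 0) := by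
  intro h
  obtain ⟨c, N, hN⟩ := eventually_const_of_mem_orb_zero h
  rcases Fin.eq_zero_or_eq_succ c with rfl | ⟨i, rfl⟩
  · obtain ⟨n, hn, h0, -⟩ := hu ⟨0, hp⟩ N
    exact h0 (hN n hn)
  · obtain ⟨n, hn, -, h0⟩ := hu i N
    exact h0 (hN n hn)

theorem lineWord_full (i : Fin p) (β : ℕ → Bool) (n : ℕ) :
    lineWord i β n = 0 ∨ lineWord i β n = i.succ := by
  cases h : β n <;> simp [lineWord, h]

theorem lineSystem_zero (hp : 0 < p) : LineSystem (fun _ => 0 : Word p) Finset.univ where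
  full _ _ _ := .inl rfl
  ne_zero i _ t ht := by
    by_contra hc
    push Not at hc
    exact ht (zpow_injective_of_full (i := i) (fun _ => .inl rfl) (s := t) (t := 0)
      (funext fun n => hc n))
  univ _ := Finset.mem_univ
  nonempty := ⟨⟨0, hp⟩, Finset.mem_univ _⟩

theorem end_encard_zero (hp : 0 < p) {u : Word p} (hu : u ∈ orb (fun _ => 0)) :
    (schreier u).toSimple.end.encard = ((2 * p : ℕ) : ℕ∞) := by
  rw [end_encard_of_mem_orb hu, (lineSystem_zero hp).end_encard, Finset.card_univ,
    Fintype.card_fin]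

theorem end_encard_line {u : Word p} {i : Fin p} {β : ℕ → Bool} (hβ : Balanced β)
    (hu : Cofinal u (lineWord i β)) : (schreier u).toSimple.end.encard = 2 := by
  rw [end_encard_of_mem_orb (mem_orb_of_cofinal hu)]
  have hnot := hβ.lineWord_notMem (Cofinal.refl (lineWord i β))
  have hne : ∀ z ∈ orb (lineWord i β), ∃ n, z n ≠ 0 := by
    intro z hz
    by_contra hc
    push Not at hc
    obtain rfl : z = fun _ => 0 := funext hc
    exact hnot (orb_eq_of_mem hz ▸ mem_orb_self _)
  have h : LineSystem (lineWord i β) {i} :=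
    { full := fun j hj => by
        obtain rfl := Finset.mem_singleton.mp hj
        exact lineWord_full j β
      ne_zero := fun j _ t _ => hne _ (zpow_mem_orb j t (mem_orb_self _))
      univ := fun hc => by
        obtain ⟨n, hn⟩ := hne _ (mem_orb_self _)
        exact (hn (hc n)).elim
      nonempty := ⟨i, Finset.mem_singleton_self i⟩ }
  rw [h.end_encard]
  simp

theorem end_encard_mixed (hp : 0 < p) {u : Word p} (hu : Mixed u) :
    (schreier u).toSimple.end.encard = 1 :=
  end_encard_eq_one_of_forall hu hp

theorem mem_ended_two_mul (hp : 2 ≤ p) {u : Word p} :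
    u ∈ ended p (2 * p) ↔ u ∈ orb (fun _ => 0) := by
  refine ⟨fun h => ?_, fun h => end_encard_zero (by omega) h⟩
  have h' : (schreier u).toSimple.end.encard = ((2 * p : ℕ) : ℕ∞) := h
  rcases trichotomy u with h1 | ⟨i, β, hβ, h1⟩ | h1
  · exact h1
  · rw [end_encard_line hβ h1] at h'
    have : 2 = 2 * p := by exact_mod_cast h'
    omega
  · rw [end_encard_mixed (by omega) h1] at h'
    have : 1 = 2 * p := by exact_mod_cast h'
    omega

theorem mem_ended_two (hp : 2 ≤ p) {u : Word p} :
    u ∈ ended p 2 ↔ ∃ i β, Balanced β ∧ Cofinal u (lineWord i β) := by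
  refine ⟨fun h => ?_, fun ⟨i, β, hβ, h⟩ => end_encard_line hβ h⟩
  have h' : (schreier u).toSimple.end.encard = ((2 : ℕ) : ℕ∞) := h
  rcases trichotomy u with h1 | h1 | h1
  · rw [end_encard_zero (by omega) h1] at h'
    have : 2 * p = 2 := by exact_mod_cast h'
    omega
  · exact h1
  · rw [end_encard_mixed (by omega) h1] at h'
    have : 1 = 2 := by exact_mod_cast h'
    omega

theorem mem_ended_one (hp : 2 ≤ p) {u : Word p} : u ∈ ended p 1 ↔ Mixed u := by
  refine ⟨fun h => ?_, fun h => end_encard_mixed (by omega) h⟩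
  have h' : (schreier u).toSimple.end.encard = ((1 : ℕ) : ℕ∞) := h
  rcases trichotomy u with h1 | ⟨i, β, hβ, h1⟩ | h1
  · rw [end_encard_zero (by omega) h1] at h'
    have : 2 * p = 1 := by exact_mod_cast h'
    omega
  · rw [end_encard_line hβ h1] at h'
    have : 2 = 1 := by exact_mod_cast h'
    omega
  · exact h1

/-! ### Relabelling letters -/

/-- The permutation of the letters `0, …, p` which fixes `0` and permutes the others by `π`. -/
def relabel (π : Equiv.Perm (Fin p)) (x : Fin (p + 1)) : Fin (p + 1) :=
  Fin.cases 0 (fun i => (π i).succ) x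

@[simp] theorem relabel_zero (π : Equiv.Perm (Fin p)) : relabel π 0 = 0 := rfl

@[simp] theorem relabel_succ (π : Equiv.Perm (Fin p)) (i : Fin p) :
    relabel π i.succ = (π i).succ := rfl

theorem relabel_inv_relabel (π : Equiv.Perm (Fin p)) (x : Fin (p + 1)) :
    relabel π⁻¹ (relabel π x) = x := by
  rcases Fin.eq_zero_or_eq_succ x with rfl | ⟨i, rfl⟩ <;> simp

theorem relabel_relabel_inv (π : Equiv.Perm (Fin p)) (x : Fin (p + 1)) :
    relabel π (relabel π⁻¹ x) = x := by
  rcases Fin.eq_zero_or_eq_succ x with rfl | ⟨i, rfl⟩ <;> simp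

theorem relabel_injective (π : Equiv.Perm (Fin p)) : Function.Injective (relabel π) :=
  Function.LeftInverse.injective (relabel_inv_relabel π)

theorem relabel_eq_zero {π : Equiv.Perm (Fin p)} {x : Fin (p + 1)} : relabel π x = 0 ↔ x = 0 :=
  (relabel_injective π).eq_iff' rfl

theorem relabel_eq_succ {π : Equiv.Perm (Fin p)} {x : Fin (p + 1)} {i : Fin p} :
    relabel π x = (π i).succ ↔ x = i.succ :=
  (relabel_injective π).eq_iff' rfl

theorem relabel_swap (π : Equiv.Perm (Fin p)) (i : Fin p) (x : Fin (p + 1)) :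
    relabel π (Equiv.swap 0 i.succ x) = Equiv.swap 0 (π i).succ (relabel π x) :=
  (relabel_injective π).map_swap _ _ _

/-- The letterwise action of a permutation of the nonzero letters on words. -/
def relabelWord (π : Equiv.Perm (Fin p)) (z : Word p) : Word p := fun n => relabel π (z n)

theorem gen_relabelWord (π : Equiv.Perm (Fin p)) (j : Fin p) (z : Word p) :
    gen (π j) (relabelWord π z) = relabelWord π (gen j z) := by
  funext n
  rcases gen_dichotomy j z n with ⟨⟨t, ht, h0⟩, h⟩ | ⟨h0, h⟩
  · rw [gen_of_ne ht (by rwa [relabelWord, ne_eq, relabel_eq_zero])]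
    simp only [relabelWord, h]
  · rw [gen_of_forall fun t ht => by rw [relabelWord, relabel_eq_zero, h0 t ht]]
    simp only [relabelWord, h, relabel_swap]

theorem zpow_relabelWord (π : Equiv.Perm (Fin p)) (j : Fin p) (t : ℤ) : ∀ z : Word p,
    (gen (π j) ^ t) (relabelWord π z) = relabelWord π ((gen j ^ t) z) := by
  induction t with
  | zero => exact fun z => rfl
  | succ n ih => intro z; rw [zpow_succ_apply, zpow_succ_apply, ih, gen_relabelWord]
  | pred n ih =>
    intro z
    rw [zpow_pred_apply, zpow_pred_apply, ih, Equiv.Perm.inv_eq_iff_eq, gen_relabelWord]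
    simp

/-! ### Reflecting a cycle or a line -/

/-- From the position `l` on, the first `N` letters of `z` form a word in `0` and `i` which starts
with `i`. -/
def BlockFrom (i : Fin p) (N : ℕ∞) (z : Word p) (l : ℕ) : Prop :=
  z l = i.succ ∧ ∀ t ≥ l, (t : ℕ∞) < N → z t = 0 ∨ z t = i.succ

/-- The letter at the position `n` is exchanged by the reflection `reflect i N`. -/
def Flips (i : Fin p) (N : ℕ∞) (z : Word p) (n : ℕ) : Prop :=
  (n : ℕ∞) < N ∧ ∃ l < n, BlockFrom i N z l

open Classical in
/-- The reflection of the cycle (or the line, for `N = ⊤`) of the `i`-th generator through the words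
which agree with `z` from the position `N` on, together with everything attached to it: if the first
`N` letters of `z` end with `i w`, where `i w` is the longest such word in `0` and `i`, then `0` and `i`
are exchanged in `w`. With `0` and `i` as binary digits this is the negation `x ↦ -x`. -/
noncomputable def reflect (i : Fin p) (N : ℕ∞) (z : Word p) : Word p := fun n =>
  if Flips i N z n then Equiv.swap 0 i.succ (z n) else z n

theorem reflect_of_flips {i : Fin p} {N : ℕ∞} {z : Word p} {n : ℕ} (h : Flips i N z n) :
    reflect i N z n = Equiv.swap 0 i.succ (z n) := if_pos h

theorem reflect_of_not {i : Fin p} {N : ℕ∞} {z : Word p} {n : ℕ} (h : ¬ Flips i N z n) :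
    reflect i N z n = z n := if_neg h

theorem reflect_of_le {i : Fin p} {N : ℕ∞} {z : Word p} {n : ℕ} (h : N ≤ n) :
    reflect i N z n = z n := reflect_of_not fun h' => absurd h'.1 (not_lt.mpr h)

theorem not_flips_of_zero {i : Fin p} {N : ℕ∞} {z : Word p} {n : ℕ} (h : ∀ t < n, z t = 0) :
    ¬ Flips i N z n := fun ⟨_, l, hl, hl', _⟩ => Fin.succ_ne_zero i (hl'.symm.trans (h l hl))

theorem reflect_of_zero {i : Fin p} {N : ℕ∞} {z : Word p} {n : ℕ} (h : ∀ t < n, z t = 0) :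
    reflect i N z n = z n := reflect_of_not (not_flips_of_zero h)

theorem reflect_mem_iff {i : Fin p} {N : ℕ∞} {z : Word p} {n : ℕ} :
    (reflect i N z n = 0 ∨ reflect i N z n = i.succ) ↔ (z n = 0 ∨ z n = i.succ) := by
  by_cases h : Flips i N z n
  · rw [reflect_of_flips h]
    refine ⟨fun h => ?_, swap_mem⟩
    simpa using swap_mem h
  · rw [reflect_of_not h]

theorem exists_ne_of_not_forall {z : Word p} {n : ℕ} (h : ¬ ∀ t < n, z t = 0) :
    ∃ m < n, (∀ t < m, z t = 0) ∧ z m ≠ 0 := by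
  push Not at h
  obtain ⟨m, hm, hm0⟩ := h
  obtain ⟨k, hk⟩ := exists_lead ⟨m, hm0⟩
  refine ⟨k, ?_, hk⟩
  by_contra hc
  exact hm0 (hk.1 m (by omega))

theorem reflect_forall_zero_iff {i : Fin p} {N : ℕ∞} {z : Word p} {n : ℕ} :
    (∀ t < n, reflect i N z t = 0) ↔ ∀ t < n, z t = 0 := by
  refine ⟨fun h => ?_, fun h t ht => ?_⟩
  · by_contra hc
    obtain ⟨m, hm, h0, hm0⟩ := exists_ne_of_not_forall hc
    exact hm0 ((reflect_of_zero h0).symm.trans (h m hm))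
  · rw [reflect_of_zero fun s hs => h s (by omega), h t ht]

/-- The leftmost start of the reflected block is itself not changed. -/
theorem exists_first_block {i : Fin p} {N : ℕ∞} {z : Word p} {l : ℕ} (h : BlockFrom i N z l) :
    ∃ k ≤ l, BlockFrom i N z k ∧ ¬ Flips i N z k := by
  classical
  have hex : ∃ l, BlockFrom i N z l := ⟨l, h⟩
  exact ⟨Nat.find hex, Nat.find_min' hex h, Nat.find_spec hex,
    fun ⟨_, m, hm, hm'⟩ => Nat.find_min hex hm hm'⟩

theorem flips_reflect_iff {i : Fin p} {N : ℕ∞} {z : Word p} {n : ℕ} :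
    Flips i N (reflect i N z) n ↔ Flips i N z n := by
  refine and_congr_right fun _ => ⟨?_, ?_⟩
  · rintro ⟨l, hl, h1, h2⟩
    have h2' : ∀ t ≥ l, (t : ℕ∞) < N → z t = 0 ∨ z t = i.succ := fun t ht htN =>
      reflect_mem_iff.mp (h2 t ht htN)
    by_cases hf : Flips i N z l
    · obtain ⟨-, m, hm, hm'⟩ := hf
      exact ⟨m, by omega, hm'⟩
    · exact ⟨l, hl, by rw [← reflect_of_not hf, h1], h2'⟩
  · rintro ⟨l, hl, h⟩
    obtain ⟨k, hk, ⟨hk1, hk2⟩, hkf⟩ := exists_first_block h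
    exact ⟨k, by omega, by rw [reflect_of_not hkf, hk1],
      fun t ht htN => reflect_mem_iff.mpr (hk2 t ht htN)⟩

theorem reflect_reflect (i : Fin p) (N : ℕ∞) (z : Word p) : reflect i N (reflect i N z) = z := by
  funext n
  by_cases h : Flips i N z n
  · rw [reflect_of_flips (flips_reflect_iff.mpr h), reflect_of_flips h, Equiv.swap_apply_self]
  · rw [reflect_of_not (flips_reflect_iff.not.mpr h), reflect_of_not h]

theorem reflect_congr_lt {i : Fin p} {N : ℕ} {z z' : Word p} (h : ∀ t < N, z t = z' t) :
    ∀ n < N, reflect i N z n = reflect i N z' n := by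
  intro n hn
  have hf : Flips i N z n ↔ Flips i N z' n := by
    refine and_congr_right fun _ => exists_congr fun l => and_congr_right fun hl =>
      and_congr (by rw [h l (by omega)]) (forall_congr' fun t => imp_congr_right fun _ =>
        imp_congr_right fun htN => by rw [h t (by exact_mod_cast htN)])
  by_cases hc : Flips i N z n
  · rw [reflect_of_flips hc, reflect_of_flips (hf.mp hc), h n hn]
  · rw [reflect_of_not hc, reflect_of_not (hf.not.mp hc), h n hn]

theorem reflect_relabelWord (π : Equiv.Perm (Fin p)) (i : Fin p) (N : ℕ∞) (z : Word p) :
    reflect (π i) N (relabelWord π z) = relabelWord π (reflect i N z) := by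
  have hf : ∀ n, Flips (π i) N (relabelWord π z) n ↔ Flips i N z n := fun n => by
    simp only [Flips, BlockFrom, relabelWord, relabel_eq_zero, relabel_eq_succ]
  funext n
  by_cases hc : Flips i N z n
  · rw [reflect_of_flips ((hf n).mpr hc), relabelWord, relabelWord, reflect_of_flips hc,
      relabel_swap]
  · rw [reflect_of_not ((hf n).not.mpr hc), relabelWord, relabelWord, reflect_of_not hc]

/-- Outside the reflected cycle, the reflection commutes with the generators. -/
theorem reflect_gen {i j : Fin p} {N : ℕ∞} {z : Word p}
    (h : j ≠ i ∨ ∃ t : ℕ, (t : ℕ∞) < N ∧ z t ≠ 0 ∧ z t ≠ i.succ) :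
    reflect i N (gen j z) = gen j (reflect i N z) := by
  have hb : ∀ l : ℕ, BlockFrom i N (gen j z) l ↔ BlockFrom i N z l := by
    intro l
    by_cases hl : ∃ t < l, z t ≠ 0
    · obtain ⟨t, ht, h0⟩ := hl
      have heq : ∀ s ≥ l, gen j z s = z s := fun s hs => gen_of_ne (t := t) (by omega) h0
      refine and_congr (by rw [heq l le_rfl]) (forall_congr' fun s => imp_congr_right fun hs => ?_)
      rw [heq s hs]
    push Not at hl
    by_cases hij : j = i
    · subst hij
      obtain ⟨t, htN, ht0, hti⟩ := h.resolve_left (by simp)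
      have htl : l ≤ t := by
        by_contra hc
        exact ht0 (hl t (by omega))
      exact ⟨fun hc => ((gen_mem_iff.mp (hc.2 t htl htN)).elim ht0 hti).elim,
        fun hc => ((hc.2 t htl htN).elim ht0 hti).elim⟩
    · have h1 : gen j z l = i.succ ↔ z l = i.succ := by
        have hne : i.succ ≠ j.succ := fun hc => hij (Fin.succ_injective p hc).symm
        rw [gen_of_forall hl, Equiv.swap_apply_eq_iff,
          Equiv.swap_apply_of_ne_of_ne (Fin.succ_ne_zero i) hne]
      constructor <;> intro hc
      · have hl0 : z l ≠ 0 := by rw [h1.mp hc.1]; exact Fin.succ_ne_zero i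
        refine ⟨h1.mp hc.1, fun s hs hsN => ?_⟩
        rcases hs.lt_or_eq with hs' | rfl
        · rw [← gen_of_ne (i := j) hs' hl0]
          exact hc.2 s hs hsN
        · exact .inr (h1.mp hc.1)
      · have hl0 : z l ≠ 0 := by rw [hc.1]; exact Fin.succ_ne_zero i
        refine ⟨h1.mpr hc.1, fun s hs hsN => ?_⟩
        rcases hs.lt_or_eq with hs' | rfl
        · rw [gen_of_ne hs' hl0]
          exact hc.2 s hs hsN
        · exact .inr (h1.mpr hc.1)
  have hf : ∀ n, Flips i N (gen j z) n ↔ Flips i N z n := fun n => by simp only [Flips, hb]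
  funext n
  rcases gen_dichotomy j z n with ⟨hex, he⟩ | ⟨h0, he⟩
  · have hex' : ∃ t < n, reflect i N z t ≠ 0 := by
      by_contra hc
      push Not at hc
      obtain ⟨t, ht, h0⟩ := hex
      exact h0 (reflect_forall_zero_iff.mp hc t ht)
    obtain ⟨t, ht, h0⟩ := hex'
    rw [gen_of_ne ht h0]
    by_cases hc : Flips i N z n
    · rw [reflect_of_flips ((hf n).mpr hc), reflect_of_flips hc, he]
    · rw [reflect_of_not ((hf n).not.mpr hc), reflect_of_not hc, he]
  · rw [gen_of_forall (reflect_forall_zero_iff.mpr h0), reflect_of_zero h0,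
      reflect_of_not ((hf n).not.mpr (not_flips_of_zero h0)), he]

/-- On the reflected cycle, the reflection inverts the generator. -/
theorem gen_reflect_gen {i : Fin p} {N : ℕ∞} {z : Word p}
    (hz : ∀ t : ℕ, (t : ℕ∞) < N → z t = 0 ∨ z t = i.succ)
    (hN : ∀ n : ℕ, N = n → z n ≠ 0 ∧ z n ≠ i.succ) :
    gen i (reflect i N (gen i z)) = reflect i N z := by
  have hflip : ∀ x : Word p, (∀ t : ℕ, (t : ℕ∞) < N → x t = 0 ∨ x t = i.succ) →
      ∀ n : ℕ, (n : ℕ∞) < N → ∀ l < n, x l ≠ 0 → Flips i N x n := fun x hx n hn l hl h0 =>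
    ⟨hn, l, hl, (hx l ((Nat.cast_lt.mpr hl).trans hn)).resolve_left h0, fun t _ ht => hx t ht⟩
  have hz' : ∀ t : ℕ, (t : ℕ∞) < N → gen i z t = 0 ∨ gen i z t = i.succ := fun t ht =>
    gen_mem (hz t ht)
  have h0i : (0 : Fin (p + 1)) ≠ i.succ := (Fin.succ_ne_zero i).symm
  funext n
  rcases le_or_gt N n with hNn | hn
  · obtain ⟨k, rfl⟩ : ∃ k : ℕ, N = k := by
      cases N with
      | top => simp at hNn
      | coe k => exact ⟨k, rfl⟩
    obtain ⟨hk0, hki⟩ := hN k rfl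
    have hkn : k ≤ n := by exact_mod_cast hNn
    have h1 : reflect i k (gen i z) k = z k := by
      rw [reflect_of_le le_rfl, gen_other hk0 hki]
    rw [gen_tail (by rwa [h1]) (by rwa [h1]) n hkn, reflect_of_le hNn, reflect_of_le hNn,
      gen_tail hk0 hki n hkn]
  by_cases hall : ∀ t < n, z t = 0
  · rw [reflect_of_zero hall]
    have hgn : gen i z n = Equiv.swap 0 i.succ (z n) := gen_of_forall hall
    rcases Nat.eq_zero_or_pos n with rfl | hpos
    · rw [gen_of_forall (by simp), reflect_of_zero (by simp), hgn, Equiv.swap_apply_self]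
    · have hg0 : gen i z 0 = i.succ := by
        rw [gen_of_forall (by simp), hall 0 hpos, Equiv.swap_apply_left]
      have hx0 : reflect i N (gen i z) 0 ≠ 0 := by
        rw [reflect_of_zero (by simp), hg0]; exact h0i.symm
      rw [gen_of_ne hpos hx0, reflect_of_flips (hflip _ hz' n hn 0 hpos (by rw [hg0]; exact h0i.symm)),
        hgn, Equiv.swap_apply_self]
  · obtain ⟨m, hm, hm0, hmne⟩ := exists_ne_of_not_forall hall
    have hlater : ∀ l > m, gen i z l = z l := fun l hl => gen_of_ne hl hmne
    rw [reflect_of_flips (hflip z hz n hn m hm hmne)]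
    rcases Nat.eq_zero_or_pos m with rfl | hpos
    · by_cases hg : ∀ t < n, gen i z t = 0
      · rw [gen_of_forall (reflect_forall_zero_iff.mpr hg), reflect_of_zero hg, hlater n hm]
      · obtain ⟨l, hl, hl0, hlne⟩ := exists_ne_of_not_forall hg
        rw [gen_of_ne hl (by rwa [reflect_of_zero hl0]),
          reflect_of_flips (hflip _ hz' n hn l hl hlne), hlater n hm]
    · have hg0 : gen i z 0 = i.succ := by
        rw [gen_of_forall (by simp), hm0 0 hpos, Equiv.swap_apply_left]
      have hx0 : reflect i N (gen i z) 0 ≠ 0 := by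
        rw [reflect_of_zero (by simp), hg0]; exact h0i.symm
      rw [gen_of_ne (by omega) hx0,
        reflect_of_flips (hflip _ hz' n hn 0 (by omega) (by rw [hg0]; exact h0i.symm)),
        hlater n hm]

/-- On the reflected cycle, the reflection inverts the powers of the generator. -/
theorem reflect_zpow {i : Fin p} {N : ℕ∞} (t : ℤ) : ∀ {z : Word p},
    (∀ t : ℕ, (t : ℕ∞) < N → z t = 0 ∨ z t = i.succ) →
    (∀ n : ℕ, N = n → z n ≠ 0 ∧ z n ≠ i.succ) →
    reflect i N ((gen i ^ t) z) = (gen i ^ (-t)) (reflect i N z) := by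
  have hpres : ∀ (t : ℤ) (z : Word p), (∀ t : ℕ, (t : ℕ∞) < N → z t = 0 ∨ z t = i.succ) →
      (∀ n : ℕ, N = n → z n ≠ 0 ∧ z n ≠ i.succ) →
      (∀ s : ℕ, (s : ℕ∞) < N → (gen i ^ t) z s = 0 ∨ (gen i ^ t) z s = i.succ) ∧
      (∀ n : ℕ, N = n → (gen i ^ t) z n ≠ 0 ∧ (gen i ^ t) z n ≠ i.succ) := by
    intro t z h1 h2
    refine ⟨fun s hs => (zpow_mem_iff t).mpr (h1 s hs), fun n hn => ?_⟩
    rw [zpow_tail t (h2 n hn).1 (h2 n hn).2 n le_rfl]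
    exact h2 n hn
  induction t with
  | zero => exact fun _ _ => rfl
  | succ n ih =>
    intro z h1 h2
    obtain ⟨h3, h4⟩ := hpres n z h1 h2
    rw [neg_add, ← sub_eq_add_neg, zpow_pred_apply, ← ih h1 h2, zpow_succ_apply,
      Equiv.Perm.eq_inv_iff_eq, gen_reflect_gen h3 h4]
  | pred n ih =>
    intro z h1 h2
    obtain ⟨h3, h4⟩ := hpres (-n - 1) z h1 h2
    rw [neg_sub, sub_neg_eq_add, add_comm, zpow_succ_apply]
    rw [neg_neg] at ih
    rw [← ih h1 h2, ← gen_reflect_gen h3 h4, ← zpow_succ_apply, sub_add_cancel]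

/-! ### Building isomorphisms -/

/-- The map `F` sends edges of the Schreier graph of `u` to edges: the labels of the edges between
two given vertices are permuted, and their directions may be reversed. -/
def MapsEdges (u : Word p) (F : Word p → Word p) : Prop :=
  ∀ z ∈ orb u, ∀ z' ∈ orb u, ∃ π : Equiv.Perm (Fin p), ∀ j,
    ((gen j z = z' → gen (π j) (F z) = F z') ∧ (gen j z' = z → gen (π j) (F z') = F z)) ∨
    ((gen j z = z' → gen (π j) (F z') = F z) ∧ (gen j z' = z → gen (π j) (F z) = F z'))

open Classical in
theorem mult_eq_sum {w : Word p} (a b : orb w) : (schreier w).mult a b =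
    ∑ j : Fin p, ((if gen j a.1 = b.1 then 1 else 0) + if gen j b.1 = a.1 then 1 else 0) := by
  have h : ∀ Q : Fin p → Prop, Nat.card {i : Fin p // Q i} = ∑ j, if Q j then 1 else 0 := fun Q => by
    rw [Nat.card_eq_fintype_card, Fintype.card_subtype, Finset.card_filter]
  change _ + _ = _
  rw [h, h, ← Finset.sum_add_distrib]
  refine Finset.sum_congr rfl fun j _ => ?_
  have hinv : (gen j)⁻¹ a.1 = b.1 ↔ gen j b.1 = a.1 := Equiv.Perm.inv_eq_iff_eq.trans eq_comm
  simp only [hinv]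

theorem MapsEdges.mem_orb {u v : Word p} {F : Word p → Word p} (hF : MapsEdges u F)
    (huv : F u ∈ orb v) {z : Word p} (hz : z ∈ orb u) : F z ∈ orb v := by
  have step : ∀ j, ∀ z ∈ orb u, ∀ z' ∈ orb u, gen j z = z' →
      (F z ∈ orb v ↔ F z' ∈ orb v) := by
    intro j z hz z' hz' h
    have key : ∀ (k : Fin p) (x x' : Word p), gen k x = x' → (x ∈ orb v ↔ x' ∈ orb v) := by
      rintro k x _ rfl
      exact ⟨gen_mem_orb k, fun h => by simpa using gen_inv_mem_orb k h⟩
    obtain ⟨π, hπ⟩ := hF z hz z' hz'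
    rcases hπ j with h' | h'
    · exact key _ _ _ (h'.1 h)
    · exact (key _ _ _ (h'.1 h)).symm
  refine orb_induction (Q := fun z => F z ∈ orb v) huv ?_ ?_ hz
  · exact fun i z hz h => (step i z hz _ (gen_mem_orb i hz) rfl).mp h
  · exact fun i z hz h => (step i _ (gen_inv_mem_orb i hz) z hz (by simp)).mpr h

theorem MapsEdges.mult_le {u v : Word p} {F : Word p → Word p} (hF : MapsEdges u F) {a b : orb u}
    {a' b' : orb v} (ha : F a.1 = a'.1) (hb : F b.1 = b'.1) :
    (schreier u).mult a b ≤ (schreier v).mult a' b' := by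
  classical
  obtain ⟨π, hπ⟩ := hF a.1 a.2 b.1 b.2
  have ind : ∀ {A B : Prop}, (A → B) → (if A then 1 else 0) ≤ if B then 1 else 0 := by
    intro A B h
    by_cases hA : A
    · simp [hA, h hA]
    · simp [hA]
  rw [mult_eq_sum, mult_eq_sum]
  refine le_trans (Finset.sum_le_sum fun j _ => ?_) (Equiv.sum_comp π _).le
  rw [← ha, ← hb]
  rcases hπ j with ⟨h1, h2⟩ | ⟨h1, h2⟩
  · exact add_le_add (ind h1) (ind h2)
  · exact (add_le_add (ind h1) (ind h2)).trans (add_comm _ _).le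

theorem isomorphic_of_mapsEdges {u v : Word p} {F G : Word p → Word p} (hF : MapsEdges u F)
    (hG : MapsEdges v G) (hFu : F u ∈ orb v) (hGv : G v ∈ orb u)
    (hGF : ∀ z ∈ orb u, G (F z) = z) (hFG : ∀ z ∈ orb v, F (G z) = z) :
    (schreier u).Isomorphic (schreier v) := by
  let f : orb u ≃ orb v :=
    { toFun := fun z => ⟨F z.1, hF.mem_orb hFu z.2⟩
      invFun := fun z => ⟨G z.1, hG.mem_orb hGv z.2⟩
      left_inv := fun z => Subtype.ext (hGF z.1 z.2)
      right_inv := fun z => Subtype.ext (hFG z.1 z.2) }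
  exact ⟨f, fun a b => le_antisymm (hG.mult_le (hGF a.1 a.2) (hGF b.1 b.2)) (hF.mult_le rfl rfl)⟩

theorem isomorphic_relabelWord (π : Equiv.Perm (Fin p)) (u : Word p) :
    (schreier u).Isomorphic (schreier (relabelWord π u)) := by
  have hinv : ∀ z, relabelWord π⁻¹ (relabelWord π z) = z := fun z =>
    funext fun n => relabel_inv_relabel π (z n)
  have hmap : ∀ (π : Equiv.Perm (Fin p)) (u : Word p), MapsEdges u (relabelWord π) := by
    intro π u z _ z' _
    refine ⟨π, fun j => .inl ⟨?_, ?_⟩⟩ <;> rintro rfl <;> exact gen_relabelWord π j _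
  refine isomorphic_of_mapsEdges (hmap π u) (hmap π⁻¹ _) (mem_orb_self _)
    (by rw [hinv]; exact mem_orb_self u) (fun z _ => hinv z) fun z _ => ?_
  exact funext fun n => relabel_relabel_inv π (z n)

theorem isomorphic_reflect (i : Fin p) (u : Word p) :
    (schreier u).Isomorphic (schreier (reflect i ⊤ u)) := by
  have hmap : ∀ u : Word p, MapsEdges u (reflect i ⊤) := by
    intro u z _ z' _
    refine ⟨1, fun j => ?_⟩
    by_cases hc : j = i ∧ ∀ t, z t = 0 ∨ z t = i.succ
    · obtain ⟨rfl, hz⟩ := hc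
      refine .inr ⟨?_, ?_⟩
      · rintro rfl
        exact gen_reflect_gen (fun t _ => hz t) (by simp)
      · rintro rfl
        exact gen_reflect_gen (fun t _ => gen_mem_iff.mp (hz t)) (by simp)
    · refine .inl ⟨?_, ?_⟩
      · rintro rfl
        refine (reflect_gen ?_).symm
        by_contra hcc
        push Not at hcc
        exact hc ⟨hcc.1, fun t => by
          by_cases h0 : z t = 0
          exacts [.inl h0, .inr (hcc.2 t (ENat.natCast_lt_top t) h0)]⟩
      · rintro rfl
        refine (reflect_gen ?_).symm
        by_contra hcc
        push Not at hcc
        exact hc ⟨hcc.1, fun t => by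
          obtain rfl : j = i := hcc.1
          rw [gen_mem_iff]
          by_cases h0 : z' t = 0
          exacts [.inl h0, .inr (hcc.2 t (ENat.natCast_lt_top t) h0)]⟩
  exact isomorphic_of_mapsEdges (hmap u) (hmap _) (mem_orb_self _)
    (by rw [reflect_reflect]; exact mem_orb_self u) (fun z _ => reflect_reflect i ⊤ z)
    fun z _ => reflect_reflect i ⊤ z

/-! ### Isomorphisms between one-ended graphs -/

/-- The word `u` is the concatenation of `0 … 0` (of length `P 0`) and of blocks which start at the
positions `P m`, each of them with a nonzero letter `α m + 1` followed by letters `0` and `α m + 1`,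
such that the letters of adjacent blocks differ. -/
structure Blocks (u : Word p) (P : ℕ → ℕ) (α : ℕ → Fin p) : Prop where
  mono : StrictMono P
  zeros : ∀ n < P 0, u n = 0
  start : ∀ m, u (P m) = (α m).succ
  inner : ∀ m n, P m < n → n < P (m + 1) → u n = 0 ∨ u n = (α m).succ
  ne_succ : ∀ m, α m ≠ α (m + 1)

theorem Blocks.mixed {u : Word p} {P : ℕ → ℕ} {α : ℕ → Fin p} (h : Blocks u P α) : Mixed u := by
  intro i N
  by_cases hi : α N = i
  · refine ⟨P (N + 1), (Nat.le_succ N).trans (h.mono.id_le _), ?_⟩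
    rw [h.start]
    refine ⟨Fin.succ_ne_zero _, fun hc => h.ne_succ N ?_⟩
    rw [hi, Fin.succ_injective p hc]
  · refine ⟨P N, h.mono.id_le _, ?_⟩
    rw [h.start]
    exact ⟨Fin.succ_ne_zero _, fun hc => hi (Fin.succ_injective p hc)⟩

theorem Blocks.mem_block {u : Word p} {P : ℕ → ℕ} {α : ℕ → Fin p} (h : Blocks u P α) {m n : ℕ}
    (h1 : P m ≤ n) (h2 : n < P (m + 1)) : u n = 0 ∨ u n = (α m).succ := by
  rcases h1.lt_or_eq with h1 | rfl
  exacts [h.inner m n h1 h2, .inr (h.start m)]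

/-- The word `u` with its first `k` letters replaced by `0`. -/
def zeroed (k : ℕ) (u : Word p) : Word p := fun n => if n < k then 0 else u n

theorem zeroed_of_lt {k n : ℕ} (u : Word p) (h : n < k) : zeroed k u n = 0 := if_pos h

theorem zeroed_of_le {k n : ℕ} (u : Word p) (h : k ≤ n) : zeroed k u n = u n :=
  if_neg (not_lt.mpr h)

theorem lead_zeroed {k : ℕ} {u : Word p} (h : u k ≠ 0) : Lead (zeroed k u) k :=
  ⟨fun _ hn => zeroed_of_lt u hn, by rwa [zeroed_of_le u le_rfl]⟩

/-- The part of the graph which hangs at `zeroed k u`, described by the last letters before the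
position `k`; see `region_eq_hang`. -/
def region (k : ℕ) (u : Word p) : Set (Word p) :=
  {z | (∀ n ≥ k, z n = u n) ∧ ∀ q < k, z q = u k → ∃ l, q < l ∧ l < k ∧ z l ≠ 0 ∧ z l ≠ u k}

theorem region_eq_hang {k : ℕ} {u : Word p} (h : u k ≠ 0) : region k u = hang (zeroed k u) := by
  ext z
  rw [mem_hang_iff (lead_zeroed h), zeroed_of_le u le_rfl]
  refine and_congr (forall₂_congr fun n hn => by rw [zeroed_of_le u hn]) ⟨?_, ?_⟩
  · intro hr m hm hl hc
    obtain ⟨l, h1, h2, h3, -⟩ := hr m hm hc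
    exact h3 (hl l h1 h2)
  · intro hr
    suffices H : ∀ d q, k - q = d → q < k → z q = u k →
        ∃ l, q < l ∧ l < k ∧ z l ≠ 0 ∧ z l ≠ u k from fun q => H _ q rfl
    intro d
    induction d using Nat.strong_induction_on with
    | _ d ih =>
      intro q hd hq hzq
      obtain ⟨l, h1, h2, h3⟩ : ∃ l, q < l ∧ l < k ∧ z l ≠ 0 := by
        by_contra hc
        push Not at hc
        exact hr q hq hc hzq
      by_cases hl : z l = u k
      · obtain ⟨l', h1', h2', h3'⟩ := ih (k - l) (by omega) l rfl h2 hl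
        exact ⟨l', by omega, h2', h3'⟩
      · exact ⟨l, h1, h2, h3, hl⟩

theorem eq_zeroed_of_gen {k : ℕ} {u z : Word p} {j : Fin p} (h : u k ≠ 0) (hz : z ∈ region k u)
    (hz' : gen j z ∉ region k u) : z = zeroed k u := by
  by_contra hc
  rw [region_eq_hang h] at hz hz'
  exact hz' (gen_mem_hang j hz hc)

theorem gen_eq_zeroed {k : ℕ} {u z : Word p} {j : Fin p} (h : u k ≠ 0) (hz : z ∉ region k u)
    (hz' : gen j z ∈ region k u) : gen j z = zeroed k u := by
  by_contra hc
  rw [region_eq_hang h] at hz hz'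
  exact hz (by simpa using gen_inv_mem_hang j hz' hc)

theorem zeroed_mem_region {k : ℕ} {u : Word p} (h : u k ≠ 0) : zeroed k u ∈ region k u := by
  rw [region_eq_hang h]
  exact self_mem_hang _

namespace Blocks

variable {u : Word p} {P : ℕ → ℕ} {α : ℕ → Fin p}

theorem ne_zero (h : Blocks u P α) (m : ℕ) : u (P m) ≠ 0 := by
  rw [h.start]
  exact Fin.succ_ne_zero _

theorem mem_region_succ (h : Blocks u P α) {m : ℕ} {z : Word p} (hz : ∀ n ≥ P m, z n = u n) :
    z ∈ region (P (m + 1)) u := by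
  have hlt : P m < P (m + 1) := h.mono (Nat.lt_succ_self m)
  have hne : ∀ m, (α m).succ ≠ (α (m + 1)).succ := fun m hc =>
    h.ne_succ m (Fin.succ_injective p hc)
  refine ⟨fun n hn => hz n (by omega), fun q hq hzq => ?_⟩
  rw [h.start] at hzq ⊢
  rcases lt_or_ge q (P m) with hqm | hqm
  · refine ⟨P m, hqm, hlt, ?_⟩
    rw [hz _ le_rfl, h.start]
    exact ⟨Fin.succ_ne_zero _, hne m⟩
  · rw [hz q hqm] at hzq
    rcases h.mem_block hqm hq with h' | h'
    · exact (Fin.succ_ne_zero _ (hzq.symm.trans h')).elim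
    · exact (hne m (h'.symm.trans hzq)).elim

theorem region_mono (h : Blocks u P α) : Monotone fun m => region (P m) u :=
  monotone_nat_of_le_succ fun _ _ hz => h.mem_region_succ hz.1

theorem self_mem_region (h : Blocks u P α) : u ∈ region (P 0) u :=
  ⟨fun _ _ => rfl, fun q hq hc => (h.ne_zero 0 (hc.symm.trans (h.zeros q hq))).elim⟩

theorem exists_mem_region (h : Blocks u P α) (hp : 0 < p) {z : Word p} (hz : z ∈ orb u) :
    ∃ m, z ∈ region (P (m + 1)) u := by
  obtain ⟨N, hN⟩ := (mem_orb_iff_cofinal (h.mixed.notMem hp)).mp hz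
  exact ⟨N, h.mem_region_succ fun n hn => hN n (le_trans (h.mono.id_le N) hn)⟩

end Blocks

open Classical in
/-- The reflection `reflect i N` if `ε` holds, and the identity otherwise. -/
noncomputable def reflectIf (ε : Prop) (i : Fin p) (N : ℕ∞) (z : Word p) : Word p :=
  if ε then reflect i N z else z

theorem reflectIf_of_le {ε : Prop} {i : Fin p} {N : ℕ∞} {z : Word p} {n : ℕ} (h : N ≤ n) :
    reflectIf ε i N z n = z n := by
  unfold reflectIf
  split_ifs
  exacts [reflect_of_le h, rfl]

theorem reflectIf_reflectIf (ε : Prop) (i : Fin p) (N : ℕ∞) (z : Word p) :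
    reflectIf ε i N (reflectIf ε i N z) = z := by
  unfold reflectIf
  split_ifs
  exacts [reflect_reflect i N z, rfl]

theorem reflectIf_congr_lt {ε : Prop} {i : Fin p} {N : ℕ} {z z' : Word p}
    (h : ∀ t < N, z t = z' t) : ∀ n < N, reflectIf ε i N z n = reflectIf ε i N z' n := by
  unfold reflectIf
  split_ifs
  exacts [reflect_congr_lt h, h]

theorem reflectIf_relabelWord (ε : Prop) (π : Equiv.Perm (Fin p)) (i : Fin p) (N : ℕ∞)
    (z : Word p) : reflectIf ε (π i) N (relabelWord π z) = relabelWord π (reflectIf ε i N z) := by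
  unfold reflectIf
  split_ifs
  exacts [reflect_relabelWord π i N z, rfl]

open Classical in
/-- The words `u` and `v` have blocks of the same lengths, and the inner part of the `m`-th block of
`v` arises from that of `u` by the relabelling `π m`, followed by the exchange of `0` and the letter
of the block if `ε m` holds. The relabelling `π m` is required to be correct for the letter of the
next block too: the two letters are those of the two cycles which meet at the end of the `m`-th
block. -/
structure Similar (u v : Word p) (P : ℕ → ℕ) (α β : ℕ → Fin p) (π : ℕ → Equiv.Perm (Fin p))
    (ε : ℕ → Prop) : Prop where
  left : Blocks u P α
  right : Blocks v P β
  map : ∀ m, π m (α m) = β m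
  map_succ : ∀ m, π m (α (m + 1)) = β (m + 1)
  inner : ∀ m n, P m < n → n < P (m + 1) →
    v n = relabel (π m) (if ε m then Equiv.swap 0 (α m).succ (u n) else u n)

/-- The isomorphism on the part of the graph which hangs at the end of the `m`-th block. -/
noncomputable def transfer (v : Word p) (P : ℕ → ℕ) (α : ℕ → Fin p) (π : ℕ → Equiv.Perm (Fin p))
    (ε : ℕ → Prop) (m : ℕ) (z : Word p) : Word p := fun n =>
  if n < P (m + 1) then relabel (π m) (reflectIf (ε m) (α m) (P (m + 1)) z n) else v n

namespace Similar

variable {u v : Word p} {P : ℕ → ℕ} {α β : ℕ → Fin p} {π : ℕ → Equiv.Perm (Fin p)}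
  {ε : ℕ → Prop} (h : Similar u v P α β π ε)

include h

theorem symm : Similar v u P β α (fun m => (π m)⁻¹) ε where
  left := h.right
  right := h.left
  map m := by rw [← h.map]; simp
  map_succ m := by rw [← h.map_succ]; simp
  inner m n h1 h2 := by
    rw [h.inner m n h1 h2, ← h.map m]
    split_ifs
    · rw [← relabel_swap, relabel_inv_relabel, Equiv.swap_apply_self]
    · rw [relabel_inv_relabel]

omit h in
theorem transfer_of_le {m n : ℕ} (z : Word p) (hn : P (m + 1) ≤ n) :
    transfer v P α π ε m z n = v n := if_neg (not_lt.mpr hn)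

omit h in
theorem transfer_of_lt {m n : ℕ} (z : Word p) (hn : n < P (m + 1)) :
    transfer v P α π ε m z n = relabel (π m) (reflectIf (ε m) (α m) (P (m + 1)) z n) := if_pos hn

theorem transfer_transfer {m : ℕ} {z : Word p} (hz : ∀ n ≥ P (m + 1), z n = u n) :
    transfer u P β (fun m => (π m)⁻¹) ε m (transfer v P α π ε m z) = z := by
  funext n
  rcases lt_or_ge n (P (m + 1)) with hn | hn
  · have h1 : ∀ t < P (m + 1), transfer v P α π ε m z t =
        relabelWord (π m) (reflectIf (ε m) (α m) (P (m + 1)) z) t := fun t ht =>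
      transfer_of_lt z ht
    rw [transfer_of_lt _ hn, reflectIf_congr_lt h1 n hn, ← h.map, reflectIf_relabelWord,
      reflectIf_reflectIf, relabelWord, relabel_inv_relabel]
  · rw [transfer_of_le _ hn, hz n hn]

/-- Words of the preceding part are changed by the relabelling only, apart from the block of `u`
itself, which becomes that of `v`. -/
theorem transfer_of_mem {m : ℕ} {z : Word p} (hz : z ∈ region (P m) u) :
    (∀ n ≥ P m, transfer v P α π ε m z n = v n) ∧
      ∀ n < P m, transfer v P α π ε m z n = relabel (π m) (z n) := by
  have hlt : P m < P (m + 1) := h.left.mono (Nat.lt_succ_self m)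
  have hnot : ∀ l < P m, ¬ BlockFrom (α m) (P (m + 1)) z l := by
    rintro l hl ⟨h1, h2⟩
    obtain ⟨t, ht1, ht2, ht3, ht4⟩ := hz.2 l hl (by rw [h1, h.left.start])
    rw [h.left.start] at ht4
    exact (h2 t ht1.le (by exact_mod_cast ht2.trans hlt)).elim ht3 ht4
  have hle : ∀ n ≤ P m, reflectIf (ε m) (α m) (P (m + 1)) z n = z n := by
    intro n hn
    unfold reflectIf
    split_ifs
    · exact reflect_of_not fun ⟨_, l, hl, hl'⟩ => hnot l (by omega) hl'
    · rfl
  have hgt : ∀ n, P m < n → n < P (m + 1) → reflectIf (ε m) (α m) (P (m + 1)) z n =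
      open Classical in if ε m then Equiv.swap 0 (α m).succ (u n) else u n := by
    intro n h1 h2
    unfold reflectIf
    split_ifs
    · rw [reflect_of_flips, hz.1 n h1.le]
      refine ⟨by exact_mod_cast h2, P m, h1, by rw [hz.1 _ le_rfl, h.left.start], fun t ht ht' => ?_⟩
      rw [hz.1 t ht]
      exact h.left.mem_block ht (by exact_mod_cast ht')
    · exact hz.1 n h1.le
  refine ⟨fun n hn => ?_, fun n hn => ?_⟩
  · rcases lt_or_ge n (P (m + 1)) with hn' | hn'
    · rw [transfer_of_lt z hn']
      rcases hn.lt_or_eq with hn | rfl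
      · rw [hgt n hn hn', ← h.inner m n hn hn']
      · rw [hle _ le_rfl, hz.1 _ le_rfl, h.left.start, h.right.start, relabel_succ, h.map]
    · exact transfer_of_le z hn'
  · rw [transfer_of_lt z (by omega), hle n hn.le]

theorem transfer_mem_of_mem {m : ℕ} {z : Word p} (hz : z ∈ region (P m) u) :
    transfer v P α π ε m z ∈ region (P m) v := by
  obtain ⟨h1, h2⟩ := h.transfer_of_mem hz
  refine ⟨h1, fun q hq hc => ?_⟩
  rw [h2 q hq, h.right.start, ← h.map, relabel_eq_succ, ← h.left.start] at hc
  obtain ⟨l, hl1, hl2, hl3, hl4⟩ := hz.2 q hq hc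
  refine ⟨l, hl1, hl2, ?_, ?_⟩
  · rwa [h2 l hl2, ne_eq, relabel_eq_zero]
  · rwa [h2 l hl2, h.right.start, ← h.map, ne_eq, relabel_eq_succ, ← h.left.start]

theorem transfer_mem {m : ℕ} {z : Word p} (hz : z ∈ region (P (m + 1)) u) :
    transfer v P α π ε m z ∈ region (P (m + 1)) v := by
  have hαne : (α (m + 1)).succ ≠ (α m).succ := fun hc =>
    h.left.ne_succ m (Fin.succ_injective p hc).symm
  refine ⟨fun n hn => transfer_of_le z hn, fun q hq hc => ?_⟩
  suffices H : ∃ l, q < l ∧ l < P (m + 1) ∧ reflectIf (ε m) (α m) (P (m + 1)) z l ≠ 0 ∧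
      reflectIf (ε m) (α m) (P (m + 1)) z l ≠ (α (m + 1)).succ by
    obtain ⟨l, h1, h2, h3, h4⟩ := H
    refine ⟨l, h1, h2, ?_⟩
    rw [transfer_of_lt z h2, h.right.start, ← h.map_succ, ne_eq, ne_eq, relabel_eq_zero,
      relabel_eq_succ]
    exact ⟨h3, h4⟩
  rw [transfer_of_lt z hq, h.right.start, ← h.map_succ, relabel_eq_succ] at hc
  have hreg : z q = (α (m + 1)).succ → ∃ l, q < l ∧ l < P (m + 1) ∧ z l ≠ 0 ∧
      z l ≠ (α (m + 1)).succ := by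
    have := hz.2 q hq
    rwa [h.left.start] at this
  unfold reflectIf at hc ⊢
  split_ifs at hc ⊢ with hε
  swap
  · exact hreg hc
  have hzq : z q = (α (m + 1)).succ := by
    by_cases hf : Flips (α m) (P (m + 1)) z q
    · rw [reflect_of_flips hf, Equiv.swap_apply_eq_iff,
        Equiv.swap_apply_of_ne_of_ne (Fin.succ_ne_zero _) hαne] at hc
      exact hc
    · rwa [reflect_of_not hf] at hc
  obtain ⟨l, h1, h2, h3, h4⟩ := hreg hzq
  by_cases hf : Flips (α m) (P (m + 1)) z l
  · obtain ⟨-, t, htl, ht⟩ := hf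
    obtain ⟨s, hst, hs, hsf⟩ := exists_first_block ht
    refine ⟨s, ?_, by omega, ?_⟩
    · by_contra hsq
      rcases hs.2 q (by omega) (by exact_mod_cast hq) with h' | h'
      · exact Fin.succ_ne_zero _ (hzq.symm.trans h')
      · exact hαne (hzq.symm.trans h')
    · rw [reflect_of_not hsf, hs.1]
      exact ⟨Fin.succ_ne_zero _, hαne.symm⟩
  · exact ⟨l, h1, h2, by rwa [reflect_of_not hf], by rwa [reflect_of_not hf]⟩

theorem mem_of_transfer_mem {m : ℕ} {z : Word p} (hz : ∀ n ≥ P (m + 1), z n = u n)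
    (h' : transfer v P α π ε m z ∈ region (P m) v) : z ∈ region (P m) u := by
  rw [← h.transfer_transfer hz]
  exact h.symm.transfer_mem_of_mem h'

omit h in
theorem transfer_zeroed (m : ℕ) : transfer v P α π ε m (zeroed (P (m + 1)) u) =
    zeroed (P (m + 1)) v := by
  funext n
  rcases lt_or_ge n (P (m + 1)) with hn | hn
  · have h0 : ∀ t < P (m + 1), zeroed (P (m + 1)) u t = 0 := fun t ht => zeroed_of_lt u ht
    rw [transfer_of_lt _ hn, zeroed_of_lt v hn]
    unfold reflectIf
    split_ifs
    · rw [reflect_of_zero fun t ht => h0 t (by omega), h0 n hn]; rfl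
    · rw [h0 n hn]; rfl
  · rw [transfer_of_le _ hn, zeroed_of_le v hn]

/-- At the vertex which separates two parts, the isomorphisms on these parts agree. -/
theorem transfer_succ_zeroed (m : ℕ) : transfer v P α π ε (m + 1) (zeroed (P (m + 1)) u) =
    zeroed (P (m + 1)) v := by
  obtain ⟨h1, h2⟩ := h.transfer_of_mem (zeroed_mem_region (h.left.ne_zero (m + 1)))
  funext n
  rcases lt_or_ge n (P (m + 1)) with hn | hn
  · rw [h2 n hn, zeroed_of_lt u hn, zeroed_of_lt v hn]; rfl
  · rw [h1 n hn, zeroed_of_le v hn]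

theorem gen_replace_tail {m : ℕ} {j : Fin p} {x : Word p} (hx : ∀ n ≥ P (m + 1), x n = u n)
    (hx' : ∀ n ≥ P (m + 1), gen j x n = u n) :
    gen (π m j) (fun n => if n < P (m + 1) then relabel (π m) (x n) else v n) =
      fun n => if n < P (m + 1) then relabel (π m) (gen j x n) else v n := by
  set T : Word p := fun n => if n < P (m + 1) then relabel (π m) (x n) else v n with hT
  funext n
  rcases lt_or_ge n (P (m + 1)) with hn | hn
  · rw [if_pos hn]
    have h1 : ∀ t < P (m + 1), T t = relabelWord (π m) x t := fun t ht => by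
      simp [hT, ht, relabelWord]
    rw [gen_congr_lt h1 n hn, gen_relabelWord]; rfl
  · have hTn : ∀ n ≥ P (m + 1), T n = v n := fun n hn => by simp [hT, not_lt.mpr hn]
    rw [if_neg (not_lt.mpr hn)]
    rcases gen_dichotomy (π m j) T n with ⟨-, h'⟩ | ⟨h0, h'⟩
    · rw [h', hTn n hn]
    · have hnk : n = P (m + 1) := by
        by_contra hc
        have := h0 (P (m + 1)) (by omega)
        rw [hTn _ le_rfl] at this
        exact h.right.ne_zero _ this
      subst hnk
      have hx0 : ∀ t < P (m + 1), x t = 0 := fun t ht => by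
        have := h0 t ht
        simpa [hT, ht, relabel_eq_zero] using this
      have h1 := hx' _ le_rfl
      rw [gen_of_forall hx0, hx _ le_rfl, h.left.start] at h1
      have hj : j ≠ α (m + 1) := by
        rintro rfl
        rw [Equiv.swap_apply_right] at h1
        exact Fin.succ_ne_zero _ h1.symm
      rw [h', hTn _ le_rfl, h.right.start, ← h.map_succ]
      refine Equiv.swap_apply_of_ne_of_ne (Fin.succ_ne_zero _) fun hc => hj ?_
      exact ((π m).injective (Fin.succ_injective p hc)).symm

theorem gen_transfer {m : ℕ} {j : Fin p} {z : Word p} (hz : ∀ n ≥ P (m + 1), z n = u n)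
    (hz' : ∀ n ≥ P (m + 1), gen j z n = u n)
    (hj : ¬ (ε m ∧ j = α m ∧ ∀ t < P (m + 1), z t = 0 ∨ z t = (α m).succ)) :
    gen (π m j) (transfer v P α π ε m z) = transfer v P α π ε m (gen j z) := by
  have hcomm : reflectIf (ε m) (α m) (P (m + 1)) (gen j z) =
      gen j (reflectIf (ε m) (α m) (P (m + 1)) z) := by
    unfold reflectIf
    split_ifs with hε
    · refine reflect_gen ?_
      by_contra hc
      push Not at hc
      exact hj ⟨hε, hc.1, fun t ht => by
        by_cases h0 : z t = 0
        exacts [.inl h0, .inr (hc.2 t (by exact_mod_cast ht) h0)]⟩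
    · rfl
  refine (h.gen_replace_tail (x := reflectIf (ε m) (α m) (P (m + 1)) z) (fun n hn => ?_)
    fun n hn => ?_).trans ?_
  · rw [reflectIf_of_le (by exact_mod_cast hn), hz n hn]
  · rw [← hcomm, reflectIf_of_le (by exact_mod_cast hn), hz' n hn]
  · rw [← hcomm]; rfl

theorem gen_transfer_gen {m : ℕ} {z : Word p} (hz : ∀ n ≥ P (m + 1), z n = u n)
    (hz' : ∀ n ≥ P (m + 1), gen (α m) z n = u n) (hε : ε m)
    (hj : ∀ t < P (m + 1), z t = 0 ∨ z t = (α m).succ) :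
    gen (π m (α m)) (transfer v P α π ε m (gen (α m) z)) = transfer v P α π ε m z := by
  have hinv : gen (α m) (reflectIf (ε m) (α m) (P (m + 1)) (gen (α m) z)) =
      reflectIf (ε m) (α m) (P (m + 1)) z := by
    unfold reflectIf
    rw [if_pos hε, if_pos hε]
    refine gen_reflect_gen (fun t ht => hj t (by exact_mod_cast ht)) fun n hn => ?_
    obtain rfl : P (m + 1) = n := by exact_mod_cast hn
    rw [hz _ le_rfl, h.left.start]
    exact ⟨Fin.succ_ne_zero _, fun hc => h.left.ne_succ m (Fin.succ_injective p hc).symm⟩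
  refine (h.gen_replace_tail (x := reflectIf (ε m) (α m) (P (m + 1)) (gen (α m) z))
    (fun n hn => ?_) fun n hn => ?_).trans ?_
  · rw [reflectIf_of_le (by exact_mod_cast hn), hz' n hn]
  · rw [hinv, reflectIf_of_le (by exact_mod_cast hn), hz n hn]
  · rw [hinv]; rfl

end Similar

open Classical in
/-- The isomorphism of Schreier graphs defined by similar words: `transfer` on the parts which
exhaust the graph of `u`, where every vertex belongs to the first part which contains it. -/
noncomputable def glue (u v : Word p) (P : ℕ → ℕ) (α : ℕ → Fin p) (π : ℕ → Equiv.Perm (Fin p))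
    (ε : ℕ → Prop) (z : Word p) : Word p :=
  if h : ∃ m, z ∈ region (P (m + 1)) u then transfer v P α π ε (Nat.find h) z else z

theorem glue_eq {u v : Word p} {P : ℕ → ℕ} {α : ℕ → Fin p} {π : ℕ → Equiv.Perm (Fin p)}
    {ε : ℕ → Prop} {z : Word p} {m : ℕ} (hz : z ∈ region (P (m + 1)) u)
    (hmin : ∀ l < m, z ∉ region (P (l + 1)) u) :
    glue u v P α π ε z = transfer v P α π ε m z := by
  classical
  have hex : ∃ m, z ∈ region (P (m + 1)) u := ⟨m, hz⟩
  have : Nat.find hex = m := (Nat.find_eq_iff hex).mpr ⟨hz, hmin⟩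
  rw [glue, dif_pos hex, this]

namespace Similar

variable {u v : Word p} {P : ℕ → ℕ} {α β : ℕ → Fin p} {π : ℕ → Equiv.Perm (Fin p)}
  {ε : ℕ → Prop} (h : Similar u v P α β π ε)

include h

theorem exists_first_region (hp : 0 < p) {z : Word p} (hz : z ∈ orb u) :
    ∃ m, z ∈ region (P (m + 1)) u ∧ ∀ l < m, z ∉ region (P (l + 1)) u := by
  classical
  have hex := h.left.exists_mem_region hp hz
  exact ⟨Nat.find hex, Nat.find_spec hex, fun l hl => Nat.find_min hex hl⟩

theorem glue_glue (hp : 0 < p) {z : Word p} (hz : z ∈ orb u) :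
    glue v u P β (fun m => (π m)⁻¹) ε (glue u v P α π ε z) = z := by
  obtain ⟨m, hm, hmin⟩ := h.exists_first_region hp hz
  rw [glue_eq hm hmin, glue_eq (h.transfer_mem hm), h.transfer_transfer hm.1]
  intro l hl hc
  obtain ⟨k, rfl⟩ : ∃ k, m = k + 1 := ⟨m - 1, by omega⟩
  exact hmin k (by omega) (h.mem_of_transfer_mem hm.1
    (h.right.region_mono (show l + 1 ≤ k + 1 by omega) hc))

theorem glue_self : glue u v P α π ε u = v := by
  rw [glue_eq (m := 0) (h.left.region_mono (Nat.zero_le 1) h.left.self_mem_region) (by simp)]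
  obtain ⟨h1, h2⟩ := h.transfer_of_mem h.left.self_mem_region
  funext n
  rcases lt_or_ge n (P 0) with hn | hn
  · rw [h2 n hn, h.left.zeros n hn, h.right.zeros n hn]; rfl
  · exact h1 n hn

/-- Two adjacent vertices are both mapped by the isomorphism on one of the parts. -/
theorem exists_common_transfer (hp : 0 < p) {z : Word p} {j : Fin p} (hz : z ∈ orb u) :
    ∃ m, z ∈ region (P (m + 1)) u ∧ gen j z ∈ region (P (m + 1)) u ∧
      glue u v P α π ε z = transfer v P α π ε m z ∧
      glue u v P α π ε (gen j z) = transfer v P α π ε m (gen j z) := by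
  obtain ⟨m, hm, hmin⟩ := h.exists_first_region hp hz
  obtain ⟨m', hm', hmin'⟩ := h.exists_first_region hp (gen_mem_orb j hz)
  have hne : ∀ m, zeroed (P (m + 1)) u ≠ zeroed (P (m + 1 + 1)) u := fun m hc => by
    have h1 := congrFun hc (P (m + 1))
    rw [zeroed_of_le u le_rfl, zeroed_of_lt u (h.left.mono (Nat.lt_succ_self _))] at h1
    exact h.left.ne_zero _ h1
  have hroot : ∀ m, zeroed (P (m + 1)) u ∈ region (P (m + 1 + 1)) u := fun m =>
    h.left.region_mono (Nat.le_succ _) (zeroed_mem_region (h.left.ne_zero _))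
  rcases lt_trichotomy m m' with hlt | rfl | hlt
  · have hz0 := eq_zeroed_of_gen (h.left.ne_zero _) hm (hmin' m hlt)
    have hnext : gen j z ∈ region (P (m + 1 + 1)) u := by
      by_contra hc
      exact hne m (hz0.symm.trans (eq_zeroed_of_gen (h.left.ne_zero _) (hz0 ▸ hroot m) hc))
    obtain rfl : m' = m + 1 := by
      by_contra hc
      exact hmin' (m + 1) (by omega) hnext
    refine ⟨m + 1, hz0 ▸ hroot m, hnext, ?_, glue_eq hm' hmin'⟩
    rw [glue_eq hm hmin, hz0, transfer_zeroed, h.transfer_succ_zeroed]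
  · exact ⟨m, hm, hm', glue_eq hm hmin, glue_eq hm' hmin'⟩
  · have hz0 := gen_eq_zeroed (h.left.ne_zero _) (hmin m' hlt) hm'
    have hnext : z ∈ region (P (m' + 1 + 1)) u := by
      by_contra hc
      exact hne m' (hz0.symm.trans (gen_eq_zeroed (h.left.ne_zero _) hc (hz0 ▸ hroot m')))
    obtain rfl : m = m' + 1 := by
      by_contra hc
      exact hmin (m' + 1) (by omega) hnext
    refine ⟨m' + 1, hnext, hz0 ▸ hroot m', glue_eq hm hmin, ?_⟩
    rw [glue_eq hm' hmin', hz0, transfer_zeroed, h.transfer_succ_zeroed]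

theorem mapsEdges_glue (hp : 0 < p) : MapsEdges u (glue u v P α π ε) := by
  have key : ∀ z ∈ orb u, ∀ z' ∈ orb u, ∀ j, gen j z = z' → ∃ m, z ∈ region (P (m + 1)) u ∧
      z' ∈ region (P (m + 1)) u ∧ glue u v P α π ε z = transfer v P α π ε m z ∧
      glue u v P α π ε z' = transfer v P α π ε m z' := by
    rintro z hz _ - j rfl
    exact h.exists_common_transfer hp hz
  intro z hz z' hz'
  by_cases hadj : ∃ j, gen j z = z' ∨ gen j z' = z
  swap
  · push Not at hadj
    exact ⟨1, fun j => .inl ⟨fun hc => ((hadj j).1 hc).elim, fun hc => ((hadj j).2 hc).elim⟩⟩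
  obtain ⟨m, hm, hm', he, he'⟩ : ∃ m, z ∈ region (P (m + 1)) u ∧
      z' ∈ region (P (m + 1)) u ∧ glue u v P α π ε z = transfer v P α π ε m z ∧
      glue u v P α π ε z' = transfer v P α π ε m z' := by
    obtain ⟨j, hj | hj⟩ := hadj
    · exact key z hz z' hz' j hj
    · obtain ⟨m, h1, h2, h3, h4⟩ := key z' hz' z hz j hj
      exact ⟨m, h2, h1, h4, h3⟩
  rw [he, he']
  refine ⟨π m, fun j => ?_⟩
  by_cases hc : ε m ∧ j = α m ∧ ∀ t < P (m + 1), z t = 0 ∨ z t = (α m).succ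
  · obtain ⟨hε, rfl, hfull⟩ := hc
    refine .inr ⟨?_, ?_⟩
    · rintro rfl
      exact h.gen_transfer_gen hm.1 hm'.1 hε hfull
    · rintro rfl
      exact h.gen_transfer_gen hm'.1 hm.1 hε fun t ht => gen_mem_iff.mp (hfull t ht)
  · refine .inl ⟨?_, ?_⟩
    · rintro rfl
      exact h.gen_transfer hm.1 hm'.1 hc
    · rintro rfl
      refine h.gen_transfer hm'.1 hm.1 ?_
      rintro ⟨hε, rfl, hfull⟩
      exact hc ⟨hε, rfl, fun t ht => gen_mem (hfull t ht)⟩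

/-- Similar words have isomorphic Schreier graphs. -/
theorem isomorphic (hp : 0 < p) : (schreier u).Isomorphic (schreier v) :=
  isomorphic_of_mapsEdges (h.mapsEdges_glue hp) (h.symm.mapsEdges_glue hp)
    (by rw [h.glue_self]; exact mem_orb_self v) (by rw [h.symm.glue_self]; exact mem_orb_self u)
    (fun _ hz => h.glue_glue hp hz) fun _ hz => by simpa using h.symm.glue_glue hp hz

end Similar

/-! ### Cut vertices -/

/-- There is a path from `a` to `b` which, except possibly for its start, avoids `y`. -/
def ConnOff {V : Type} (G : Multigraph V) (y : V) : V → V → Prop :=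
  Relation.ReflTransGen fun a b => b ≠ y ∧ G.mult a b ≠ 0

theorem ConnOff.map {V W : Type} {G : Multigraph V} {H : Multigraph W} (f : V ≃ W)
    (hf : ∀ u v, H.mult (f u) (f v) = G.mult u v) {y a b : V} (h : ConnOff G y a b) :
    ConnOff H (f y) (f a) (f b) :=
  Relation.ReflTransGen.lift (p := fun a b => b ≠ f y ∧ H.mult a b ≠ 0) f
    (fun _ _ h => ⟨fun hc => h.1 (f.injective hc), by rw [hf]; exact h.2⟩) _ _ h

theorem ConnOff.symm {V : Type} {G : Multigraph V} {y a b : V} (h : ConnOff G y a b)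
    (ha : a ≠ y) : ConnOff G y b a := by
  suffices H : ConnOff G y b a ∧ b ≠ y from H.1
  induction h with
  | refl => exact ⟨Relation.ReflTransGen.refl, ha⟩
  | tail _ h ih =>
    exact ⟨Relation.ReflTransGen.head ⟨ih.2, by rw [G.symm]; exact h.2⟩ ih.1, h.1⟩

/-- The vertex obtained from `a` by the power `t` of the `i`-th generator. -/
def move {w : Word p} (i : Fin p) (t : ℤ) (a : orb w) : orb w :=
  ⟨(gen i ^ t) a.1, zpow_mem_orb i t a.2⟩

theorem move_move {w : Word p} (i : Fin p) (s t : ℤ) (a : orb w) :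
    move i s (move i t a) = move i (s + t) a :=
  Subtype.ext (zpow_add_apply i s t a.1).symm

@[simp] theorem move_zero {w : Word p} (i : Fin p) (a : orb w) : move i 0 a = a := rfl

theorem move_injective {w : Word p} (i : Fin p) (t : ℤ) :
    Function.Injective (move i t : orb w → orb w) := fun a b h => by
  have := congrArg (move i (-t)) h
  simpa [move_move] using this

theorem move_eq_self_of_one {w : Word p} {i : Fin p} {a : orb w} (h : move i 1 a = a) (t : ℤ) :
    move i t a = a := by
  have h' : gen i a.1 = a.1 := congrArg Subtype.val h
  exact Subtype.ext (Function.IsFixedPt.perm_zpow (e := gen i) h' t)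

theorem move_dir_ne {w : Word p} {i : Fin p} {a : orb w} {ε : Bool} (h : move i (dir ε) a ≠ a)
    (ε' : Bool) : move i (dir ε') a ≠ a := by
  intro hc
  have h1 : move i 1 a = a := by
    cases ε' with
    | true => exact hc
    | false =>
      have := congrArg (move i 1) hc
      rw [move_move] at this
      exact this.symm
  exact h (move_eq_self_of_one h1 _)

@[simp] theorem dir_not (ε : Bool) : dir (!ε) = -dir ε := by cases ε <;> rfl

theorem mult_ne_zero_iff_move {w : Word p} {a b : orb w} :
    (schreier w).mult a b ≠ 0 ↔ ∃ i ε, b = move i (dir ε) a := by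
  rw [mult_ne_zero_iff]
  constructor
  · rintro ⟨i, h | h⟩
    exacts [⟨i, true, Subtype.ext h.symm⟩, ⟨i, false, Subtype.ext h.symm⟩]
  · rintro ⟨i, ε, rfl⟩
    cases ε
    exacts [⟨i, .inr rfl⟩, ⟨i, .inl rfl⟩]

theorem eq_of_zpow_eq_zpow {i j : Fin p} (hij : i ≠ j) {y : Word p} {s t : ℤ}
    (h : (gen i ^ s) y = (gen j ^ t) y) : (gen i ^ s) y = y := by
  funext l
  by_cases hi : y l = 0 ∨ y l = i.succ
  · by_cases hj : y l = 0 ∨ y l = j.succ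
    · have h1 := (zpow_mem_iff s).mpr hi
      have h2 := (zpow_mem_iff t).mpr hj
      rw [← h] at h2
      have key : ∀ x : Fin (p + 1), (x = 0 ∨ x = i.succ) → (x = 0 ∨ x = j.succ) → x = 0 := by
        intro x hx hx'
        rcases hx with hx | hx
        · exact hx
        · exact hx'.resolve_right fun hc => hij (Fin.succ_injective p (hx.symm.trans hc))
      rw [key _ h1 h2, key _ hi hj]
    · push Not at hj
      rw [h]
      exact zpow_tail t hj.1 hj.2 l le_rfl
  · push Not at hi
    exact zpow_tail s hi.1 hi.2 l le_rfl

theorem move_eq_move {w : Word p} {a : orb w} {i j : Fin p} {s t : ℤ}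
    (h : move i s a = move j t a) (hne : move i s a ≠ a) : i = j := by
  by_contra hij
  exact hne (Subtype.ext (eq_of_zpow_eq_zpow hij (congrArg Subtype.val h)))

/-- A double edge between two vertices is a cycle of length two. -/
theorem mult_eq_two_iff {w : Word p} {a : orb w} {i : Fin p} {ε : Bool}
    (hne : move i (dir ε) a ≠ a) :
    (schreier w).mult a (move i (dir ε) a) = 2 ↔ move i (dir (!ε)) a = move i (dir ε) a := by
  classical
  set b := move i (dir ε) a with hb
  have hgen : ∀ j, gen j a.1 = b.1 ↔ move j (dir true) a = b := fun j =>
    ⟨fun h => Subtype.ext h, fun h => congrArg Subtype.val h⟩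
  have hgen' : ∀ j, gen j b.1 = a.1 ↔ move j (dir false) a = b := fun j => by
    rw [eq_comm, ← Equiv.Perm.inv_eq_iff_eq]
    exact ⟨fun h => Subtype.ext h, fun h => congrArg Subtype.val h⟩
  rw [mult_eq_sum, Finset.sum_eq_single i]
  · rw [if_congr (hgen i) rfl rfl, if_congr (hgen' i) rfl rfl]
    cases ε with
    | true =>
      rw [if_pos hb.symm]
      by_cases h : move i (dir false) a = b <;> simp [h]
    | false =>
      rw [if_pos hb.symm]
      by_cases h : move i (dir true) a = b <;> simp [h]
  · intro j _ hj
    have h1 : ¬ gen j a.1 = b.1 := by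
      rw [hgen]
      exact fun h => hj (move_eq_move (h.trans hb) (h ▸ hne))
    have h2 : ¬ gen j b.1 = a.1 := by
      rw [hgen']
      exact fun h => hj (move_eq_move (h.trans hb) (h ▸ hne))
    rw [if_neg h1, if_neg h2]; rfl
  · simp

/-- Neighbours of a vertex along different generators are separated by this vertex. -/
theorem not_connOff {w : Word p} {a : orb w} (ha : ∃ n, a.1 n ≠ 0) {i j : Fin p} (hij : i ≠ j)
    {ε δ : Bool} (hi : move i (dir ε) a ≠ a) (hj : move j (dir δ) a ≠ a) :
    ¬ ConnOff (schreier w) a (move i (dir ε) a) (move j (dir δ) a) := by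
  obtain ⟨k, hk⟩ := exists_lead ha
  have main : ∀ (i j : Fin p) (ε δ : Bool), i ≠ j → i.succ ≠ a.1 k → move i (dir ε) a ≠ a →
      ¬ ConnOff (schreier w) a (move i (dir ε) a) (move j (dir δ) a) := by
    intro i j ε δ hij hik hne hc
    have hstart : (move i (dir ε) a).1 ∈ branch k a.1 i := by
      cases ε with
      | true => exact gen_self_mem_branch hk hik fun h => hne (Subtype.ext h)
      | false => exact gen_inv_self_mem_branch hk hik fun h => hne (Subtype.ext h)
    have hend : (move j (dir δ) a).1 ∈ branch k a.1 i := by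
      refine Relation.ReflTransGen.rec (motive := fun b _ => b.1 ∈ branch k a.1 i) hstart ?_ hc
      rintro b c - ⟨hca, hmult⟩ hb
      have hca' : c.1 ≠ a.1 := fun h => hca (Subtype.ext h)
      obtain ⟨l, h | h⟩ := mult_ne_zero_iff.mp hmult
      · rw [← h] at hca' ⊢
        exact gen_mem_branch hk hb hca'
      · rw [← h] at hca' ⊢
        exact gen_inv_mem_branch hk hik hb hca'
    obtain ⟨-, m, hm, hmi, -⟩ := hend
    have := (zpow_mem_iff (dir δ) (i := j)).mpr (.inl (hk.1 m hm))
    rcases this with h | h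
    · exact Fin.succ_ne_zero i (hmi.symm.trans h)
    · exact hij (Fin.succ_injective p (hmi.symm.trans h))
  intro hc
  by_cases hik : i.succ = a.1 k
  · have hjk : j.succ ≠ a.1 k := fun h => hij (Fin.succ_injective p (hik.trans h.symm))
    exact main j i δ ε hij.symm hjk hj (hc.symm hi)
  · exact main i j ε δ hij hik hi hc

/-- The two neighbours of a vertex on a finite cycle are not separated by this vertex. -/
theorem connOff_of_finite {w : Word p} {a : orb w} {i : Fin p}
    (ha : ∃ n, a.1 n ≠ 0 ∧ a.1 n ≠ i.succ) {ε : Bool} (hne : move i (dir ε) a ≠ a) :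
    ConnOff (schreier w) a (move i (dir ε) a) (move i (dir (!ε)) a) := by
  suffices H : ConnOff (schreier w) a (move i (dir true) a) (move i (dir false) a) by
    cases ε with
    | true => exact H
    | false => exact H.symm (move_dir_ne hne true)
  obtain ⟨T, hT0, hT, hmin⟩ := exists_period ha
  have hT1 : T ≠ 1 := by
    rintro rfl
    exact move_dir_ne hne true (Subtype.ext hT)
  have key : ∀ s : ℕ, 1 ≤ s → s < T →
      ConnOff (schreier w) a (move i (dir true) a) (move i s a) := by
    intro s hs
    induction s, hs using Nat.le_induction with
    | base => exact fun _ => Relation.ReflTransGen.refl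
    | succ s hs ih =>
      intro hsT
      refine Relation.ReflTransGen.tail (ih (by omega)) ⟨fun hc => ?_, ?_⟩
      · exact hmin (s + 1) (by omega) hsT (congrArg Subtype.val hc)
      · refine mult_ne_zero_iff_move.mpr ⟨i, true, ?_⟩
        rw [move_move, add_comm]; rfl
  have hlast : move i ((T - 1 : ℕ) : ℤ) a = move i (dir false) a :=
    Subtype.ext (gen_pow_pred hT0 hT)
  rw [← hlast]
  exact key (T - 1) (by omega) (by omega)

/-! ### Rigidity: isomorphisms preserve cycles -/

theorem exists_ne_zero_of_notMem {w : Word p} (hw : w ∉ orb (fun _ => 0)) (a : orb w) :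
    ∃ n, a.1 n ≠ 0 := by
  by_contra hc
  push Not at hc
  have ha : a.1 = fun _ => 0 := funext hc
  have h := orb_eq_of_mem a.2
  rw [ha] at h
  exact hw (h ▸ mem_orb_self w)

section Rigidity

variable {u v : Word p} {f : orb u ≃ orb v}
  (hf : ∀ a b, (schreier v).mult (f a) (f b) = (schreier u).mult a b)

include hf

theorem symm_mult (a b : orb v) :
    (schreier u).mult (f.symm a) (f.symm b) = (schreier v).mult a b := by
  rw [← hf]; simp

/-- The two neighbours of `f a` on a finite cycle are connected off `f a`, so their preimages are
connected off `a` and hence lie on the same cycle through `a`. -/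
theorem map_opposite_of_finite (hu : u ∉ orb (fun _ => 0)) {a : orb u} {i j : Fin p}
    {ε δ : Bool} (hne : move i (dir ε) a ≠ a)
    (hx : f (move i (dir ε) a) = move j (dir δ) (f a))
    (hxz : move i (dir ε) a ≠ move i (dir (!ε)) a)
    (hfin : ∃ n, (f a).1 n ≠ 0 ∧ (f a).1 n ≠ j.succ) :
    f (move i (dir (!ε)) a) = move j (dir (!δ)) (f a) := by
  have hne' : move j (dir δ) (f a) ≠ f a := by
    rw [← hx]
    exact fun h => hne (f.injective h)
  have hq : move j (dir (!δ)) (f a) ≠ f (move i (dir ε) a) := by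
    intro h
    rw [hx] at h
    have h2 := (mult_eq_two_iff hne').mpr h
    rw [← hx, hf] at h2
    exact hxz ((mult_eq_two_iff hne).mp h2).symm
  have hconn := ConnOff.map f.symm (symm_mult hf) (connOff_of_finite hfin hne')
  rw [← hx, f.symm_apply_apply, f.symm_apply_apply] at hconn
  obtain ⟨l, η, hl⟩ : ∃ l η, f.symm (move j (dir (!δ)) (f a)) = move l (dir η) a := by
    rw [← mult_ne_zero_iff_move, ← hf, f.apply_symm_apply, mult_ne_zero_iff_move]
    exact ⟨j, !δ, rfl⟩
  have hlne : move l (dir η) a ≠ a := by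
    rw [← hl]
    intro h
    exact move_dir_ne hne' (!δ) ((Equiv.symm_apply_eq f).mp h)
  rw [hl] at hconn
  obtain rfl : i = l := by
    by_contra hil
    exact not_connOff (exists_ne_zero_of_notMem hu a) hil hne hlne hconn
  have hη : η = !ε := by
    by_contra hc
    have : η = ε := by cases η <;> cases ε <;> simp_all
    subst this
    exact hq (by rw [← hl, f.apply_symm_apply])
  rw [hη] at hl
  rw [← hl, f.apply_symm_apply]

/-- If an isomorphism maps one neighbour of `a` on a cycle to a neighbour of `f a`, then it maps the
other one to the opposite neighbour of `f a` on the same cycle. -/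
theorem map_opposite (hu : u ∉ orb (fun _ => 0)) (hv : v ∉ orb (fun _ => 0)) {a : orb u}
    {i j : Fin p} {ε δ : Bool} (hne : move i (dir ε) a ≠ a)
    (hx : f (move i (dir ε) a) = move j (dir δ) (f a)) :
    f (move i (dir (!ε)) a) = move j (dir (!δ)) (f a) := by
  have hne' : move j (dir δ) (f a) ≠ f a := by
    rw [← hx]
    exact fun h => hne (f.injective h)
  by_cases hxz : move i (dir ε) a = move i (dir (!ε)) a
  · have h2 := (mult_eq_two_iff hne).mpr hxz.symm
    rw [← hf, hx] at h2
    rw [← hxz, hx, (mult_eq_two_iff hne').mp h2]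
  by_cases hfin : ∃ n, (f a).1 n ≠ 0 ∧ (f a).1 n ≠ j.succ
  · exact map_opposite_of_finite hf hu hne hx hxz hfin
  -- the cycle through `f a` is a line, so every other cycle through `f a` is finite
  obtain ⟨j', δ', hz⟩ : ∃ j' δ', f (move i (dir (!ε)) a) = move j' (dir δ') (f a) := by
    rw [← mult_ne_zero_iff_move, hf, mult_ne_zero_iff_move]
    exact ⟨i, !ε, rfl⟩
  have hjj : j' = j := by
    by_contra hjj
    have hfin' : ∃ n, (f a).1 n ≠ 0 ∧ (f a).1 n ≠ j'.succ := by
      obtain ⟨n, hn⟩ := exists_ne_zero_of_notMem hv (f a)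
      refine ⟨n, hn, fun hc => hfin ⟨n, hn, fun hc' => hjj ?_⟩⟩
      exact Fin.succ_injective p (hc.symm.trans hc')
    have h1 := map_opposite_of_finite hf hu (move_dir_ne hne (!ε)) hz
      (by rw [Bool.not_not]; exact Ne.symm hxz) hfin'
    rw [Bool.not_not, hx] at h1
    exact hjj (move_eq_move h1 hne').symm
  subst hjj
  have : δ' = !δ := by
    by_contra hc
    have : δ' = δ := by cases δ' <;> cases δ <;> simp_all
    subst this
    exact hxz (f.injective (hx.trans hz.symm))
  rw [hz, this]

/-- An isomorphism maps the cycles (and lines) of the generators to such cycles. -/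
theorem exists_map_move (hu : u ∉ orb (fun _ => 0)) (hv : v ∉ orb (fun _ => 0)) (a : orb u)
    (i : Fin p) : ∃ j δ, ∀ t : ℤ, f (move i t a) = move j (dir δ * t) (f a) := by
  by_cases hloop : move i 1 a = a
  · have h1 : (schreier v).mult (f a) (f a) ≠ 0 := by
      rw [hf, mult_ne_zero_iff_move]
      exact ⟨i, true, hloop.symm⟩
    obtain ⟨j, δ, hj⟩ := mult_ne_zero_iff_move.mp h1
    refine ⟨j, true, fun t => ?_⟩
    rw [move_eq_self_of_one hloop, move_eq_self_of_one]
    by_contra hc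
    exact move_dir_ne (ε := true) hc δ hj.symm
  obtain ⟨j, δ, hj⟩ : ∃ j δ, f (move i (dir true) a) = move j (dir δ) (f a) := by
    rw [← mult_ne_zero_iff_move, hf, mult_ne_zero_iff_move]
    exact ⟨i, true, rfl⟩
  have hne : ∀ t : ℤ, ∀ ε, move i (dir ε) (move i t a) ≠ move i t a := by
    intro t ε
    refine move_dir_ne (ε := true) (fun hc => hloop ?_) ε
    rw [move_move, add_comm, ← move_move] at hc
    exact move_injective i t hc
  refine ⟨j, δ, fun t => ?_⟩
  suffices H : f (move i t a) = move j (dir δ * t) (f a) ∧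
      f (move i (t + 1) a) = move j (dir δ * (t + 1)) (f a) from H.1
  induction t with
  | zero =>
    refine ⟨by simp, ?_⟩
    rw [zero_add, mul_one]
    exact hj
  | succ n ih =>
    obtain ⟨h1, h2⟩ := ih
    refine ⟨h2, ?_⟩
    have h3 : f (move i (dir false) (move i (n + 1) a)) =
        move j (dir (!δ)) (f (move i (n + 1) a)) := by
      rw [move_move, h2, move_move]
      have e1 : dir false + ((n : ℤ) + 1) = n := by simp [dir]
      have e2 : dir (!δ) + dir δ * ((n : ℤ) + 1) = dir δ * n := by rw [dir_not]; ring
      rw [e1, e2, h1]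
    have h4 := map_opposite hf hu hv (hne _ _) h3
    rw [move_move, h2, move_move, Bool.not_not, Bool.not_false] at h4
    have e1 : dir true + ((n : ℤ) + 1) = n + 1 + 1 := by simp [dir]; ring
    have e2 : dir δ + dir δ * ((n : ℤ) + 1) = dir δ * (n + 1 + 1) := by ring
    rwa [e1, e2] at h4
  | pred n ih =>
    obtain ⟨h1, h2⟩ := ih
    rw [sub_add_cancel]
    refine ⟨?_, h1⟩
    have h3 : f (move i (dir true) (move i (-n) a)) = move j (dir δ) (f (move i (-n) a)) := by
      rw [move_move, h1, move_move]
      have e1 : dir true + (-(n : ℤ)) = -n + 1 := by simp [dir]; ring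
      have e2 : dir δ + dir δ * (-(n : ℤ)) = dir δ * (-n + 1) := by ring
      rw [e1, e2, h2]
    have h4 := map_opposite hf hu hv (hne _ _) h3
    rw [move_move, h1, move_move, Bool.not_true, dir_not] at h4
    have e1 : dir false + (-(n : ℤ)) = -n - 1 := by simp [dir]; ring
    have e2 : -dir δ + dir δ * (-(n : ℤ)) = dir δ * (-n - 1) := by ring
    rwa [e1, e2] at h4

omit hf in
/-- Corresponding cycles have the same length, hence are defined by prefixes of the same length. -/
theorem prefix_iff {a : orb u} {i j : Fin p} {δ : Bool}
    (h : ∀ t : ℤ, f (move i t a) = move j (dir δ * t) (f a)) (n : ℕ) :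
    (∀ l ≤ n, a.1 l = 0 ∨ a.1 l = i.succ) ↔ ∀ l ≤ n, (f a).1 l = 0 ∨ (f a).1 l = j.succ := by
  have key : ∀ {w : Word p} (b : orb w) (i : Fin p),
      (∀ l ≤ n, b.1 l = 0 ∨ b.1 l = i.succ) ↔ move i ((2 ^ n : ℕ) : ℤ) b ≠ b := by
    intro w b i
    have h1 := (gen_two_pow_fixed (i := i) n (z := b.1)).not
    push Not at h1
    have h2 : move i ((2 ^ n : ℕ) : ℤ) b = b ↔ (gen i ^ (2 ^ n)) b.1 = b.1 :=
      ⟨fun h => congrArg Subtype.val h, fun h => Subtype.ext h⟩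
    rw [ne_eq, h2, ← ne_eq, h1]
    exact forall₂_congr fun l _ => by tauto
  rw [key, key, not_iff_not, ← f.apply_eq_iff_eq, h]
  rcases dir_cases δ with hd | hd <;> rw [hd]
  · rw [one_mul]
  · rw [neg_one_mul]
    have hm : ∀ (t : ℤ) (b : orb v), move j (-t) b = b ↔ move j t b = b := by
      intro t b
      rw [← (move_injective j t).eq_iff, move_move, add_neg_cancel, move_zero, eq_comm]
    exact hm _ _

/-- For a letter other than the first nonzero one, the maximal prefix in `0` and this letter ends with
the leading zeros; for every letter it is at least as long as these. As the lengths of these prefixes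
are preserved, the number of leading zeros cannot increase. -/
theorem lead_le (hp : 2 ≤ p) (hu : u ∉ orb (fun _ => 0)) (hv : v ∉ orb (fun _ => 0)) {a : orb u}
    {k k' : ℕ} (hk : Lead a.1 k) (hk' : Lead (f a).1 k') : k' ≤ k := by
  obtain ⟨i, hi⟩ : ∃ i : Fin p, i.succ ≠ a.1 k := by
    by_contra hc
    push Not at hc
    have h := (hc ⟨0, by omega⟩).trans (hc ⟨1, by omega⟩).symm
    simpa using congrArg Fin.val (Fin.succ_injective p h)
  obtain ⟨j, δ, h⟩ := exists_map_move hf hu hv a i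
  have h1 := (prefix_iff h k).not.mp fun hc => (hc k le_rfl).elim hk.2 hi.symm
  push Not at h1
  obtain ⟨l, hl, hl0, -⟩ := h1
  by_contra hc
  exact hl0 (hk'.1 l (by omega))

/-- Isomorphisms preserve the number of leading zeros. -/
theorem lead_map (hp : 2 ≤ p) (hu : u ∉ orb (fun _ => 0)) (hv : v ∉ orb (fun _ => 0)) {a : orb u}
    {k : ℕ} (hk : Lead a.1 k) : Lead (f a).1 k := by
  obtain ⟨k', hk'⟩ := exists_lead (exists_ne_zero_of_notMem hv (f a))
  have h1 := lead_le hf hp hu hv hk hk'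
  have h2 := lead_le (f := f.symm) (symm_mult hf) hp hv hu hk'
    (by rw [f.symm_apply_apply]; exact hk)
  obtain rfl : k = k' := by omega
  exact hk'

theorem zeros_map (hp : 2 ≤ p) (hu : u ∉ orb (fun _ => 0)) (hv : v ∉ orb (fun _ => 0)) {a : orb u}
    {n : ℕ} (hn : ∀ l < n, a.1 l = 0) : ∀ l < n, (f a).1 l = 0 := by
  obtain ⟨k, hk⟩ := exists_lead (exists_ne_zero_of_notMem hu a)
  have hnk : n ≤ k := by
    by_contra hc
    exact hk.2 (hn k (by omega))
  exact fun l hl => (lead_map hf hp hu hv hk).1 l (by omega)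

end Rigidity

/-- The branches at `0 0 0 …` are pairwise separated by this vertex, whereas every vertex of another
graph lies on a finite cycle; hence the graph of `0 0 0 …` is not isomorphic to another graph. -/
theorem mem_orb_zero_of_isomorphic (hp : 2 ≤ p) {u v : Word p} (hu : u ∈ orb (fun _ => 0))
    (h : (schreier u).Isomorphic (schreier v)) : v ∈ orb (fun _ => 0) := by
  by_contra hv
  obtain ⟨f, hf⟩ := Isomorphic.trans (Isomorphic.symm (isomorphic_of_mem_orb hu)) h
  have hls := lineSystem_zero (p := p) (by omega)
  set o : orb (fun _ => 0 : Word p) := ⟨_, mem_orb_self _⟩ with ho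
  have hray : ∀ i ε, move i (dir ε) o = ray (fun _ => 0) (⟨⟨i, Finset.mem_univ i⟩, ε⟩ :
      ↥(Finset.univ : Finset (Fin p)) × Bool) 0 := fun i ε => by
    simp [move, ray, ho]
  have hne : ∀ i ε, move i (dir ε) o ≠ o := by
    intro i ε hc
    have h1 := zpow_injective_of_full (i := i) (z := fun _ => 0) (s := dir ε) (t := 0)
      (fun _ => .inl rfl) (congrArg Subtype.val hc)
    rcases dir_cases ε with hd | hd <;> omega
  obtain ⟨k, hk⟩ := exists_lead (exists_ne_zero_of_notMem hv (f o))
  obtain ⟨i, hi⟩ : ∃ i : Fin p, i.succ ≠ (f o).1 k := by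
    by_contra hc
    push Not at hc
    have h := (hc ⟨0, by omega⟩).trans (hc ⟨1, by omega⟩).symm
    simpa using congrArg Fin.val (Fin.succ_injective p h)
  have hine : move i (dir true) (f o) ≠ f o := by
    intro hc
    have h1 : (schreier v).mult (f o) (f o) ≠ 0 := mult_ne_zero_iff_move.mpr ⟨i, true, hc.symm⟩
    rw [hf] at h1
    obtain ⟨j, ε, hj⟩ := mult_ne_zero_iff_move.mp h1
    exact hne j ε hj.symm
  have hpre : ∀ ε, ∃ j η, f (move j (dir η) o) = move i (dir ε) (f o) := by
    intro ε
    have h1 : (schreier v).mult (f o) (f (f.symm (move i (dir ε) (f o)))) ≠ 0 := by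
      rw [f.apply_symm_apply]
      exact mult_ne_zero_iff_move.mpr ⟨i, ε, rfl⟩
    rw [hf] at h1
    obtain ⟨j, η, hj⟩ := mult_ne_zero_iff_move.mp h1
    exact ⟨j, η, by rw [← hj, f.apply_symm_apply]⟩
  obtain ⟨j, η, hj⟩ := hpre true
  obtain ⟨j', η', hj'⟩ := hpre false
  have hconn := ConnOff.map f.symm (symm_mult hf)
    (connOff_of_finite ⟨k, hk.2, hi.symm⟩ hine)
  rw [Bool.not_true, ← hj, ← hj', f.symm_apply_apply, f.symm_apply_apply, f.symm_apply_apply,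
    hray, hray] at hconn
  by_cases hab : (⟨⟨j, Finset.mem_univ j⟩, η⟩ : ↥(Finset.univ : Finset (Fin p)) × Bool) =
      ⟨⟨j', Finset.mem_univ j'⟩, η'⟩
  · have hjj : j = j' := congrArg (fun x => x.1.1) hab
    have hηη : η = η' := congrArg Prod.snd hab
    subst hjj hηη
    have h2 := (mult_eq_two_iff hine).mpr (hj'.symm.trans hj)
    rw [← hj, hf, mult_eq_two_iff (hne j η)] at h2
    have h3 := zpow_injective_of_full (i := j) (z := fun _ => 0) (fun _ => .inl rfl)
      (congrArg Subtype.val h2)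
    rw [dir_not] at h3
    rcases dir_cases η with hd | hd <;> omega
  · obtain ⟨S, hS, ha, hb⟩ := hls.ray_separated hab
    refine hb 0 (Relation.ReflTransGen.rec (motive := fun b _ => b ∈ S) (ha 0) ?_ hconn)
    rintro b c - ⟨hco, hmult⟩ hbS
    by_cases hbc : b = c
    · exact hbc ▸ hbS
    · exact hS b c hbS ⟨hbc, hmult⟩ fun hc => hco (Subtype.ext hc)

/-! ### Isomorphisms between two-ended graphs -/

theorem relabelWord_lineWord (π : Equiv.Perm (Fin p)) (i : Fin p) (β : ℕ → Bool) :
    relabelWord π (lineWord i β) = lineWord (π i) β := by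
  funext n
  cases h : β n <;> simp [relabelWord, lineWord, h]

theorem reflect_lineWord_cofinal {β : ℕ → Bool} (hβ : Balanced β) (j : Fin p) :
    Cofinal (reflect j ⊤ (lineWord j β)) (lineWord j fun n => !β n) := by
  obtain ⟨l, -, hl⟩ := hβ true 0
  refine ⟨l + 1, fun n hn => ?_⟩
  rw [reflect_of_flips ⟨ENat.natCast_lt_top n, l, hn, by simp [lineWord, hl],
    fun t _ _ => lineWord_full j β t⟩]
  cases h : β n <;> simp [lineWord, h]

theorem Balanced.not {β : ℕ → Bool} (hβ : Balanced β) : Balanced fun n => !β n := by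
  intro c N
  obtain ⟨n, hn, h⟩ := hβ (!c) N
  exact ⟨n, hn, by simp [h]⟩

/-- Two words are equal if powers of the same generator bring both of them close to `0 0 0 …`. -/
theorem eq_of_forall_exists_zpow {i : Fin p} {x y : Word p}
    (h : ∀ n, ∃ t : ℤ, (∀ l < n, (gen i ^ t) x l = 0) ∧ ∀ l < n, (gen i ^ t) y l = 0) : x = y := by
  funext n
  obtain ⟨t, hx, hy⟩ := h (n + 1)
  have := zpow_congr_lt (i := i) (-t) (fun l hl => (hx l hl).trans (hy l hl).symm) n
    (Nat.lt_succ_self n)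
  rwa [zpow_neg_zpow, zpow_neg_zpow] at this

theorem cofinal_of_isomorphic (hp : 2 ≤ p) {u v : Word p} {i : Fin p} {β : ℕ → Bool}
    (hβ : Balanced β) (hu : Cofinal u (lineWord i β)) (h : (schreier u).Isomorphic (schreier v)) :
    ∃ j, Cofinal v (lineWord j β) ∨ Cofinal v (lineWord j fun n => !β n) := by
  have hu0 : lineWord i β ∉ orb (fun _ => 0) := hβ.lineWord_notMem (Cofinal.refl _)
  obtain ⟨f, hf⟩ := Isomorphic.trans (isomorphic_of_mem_orb (mem_orb_of_cofinal hu.symm)) h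
  have hv0 : v ∉ orb (fun _ => 0) := fun hc =>
    hu0 (mem_orb_zero_of_isomorphic hp hc (Isomorphic.symm ⟨f, hf⟩))
  set a : orb (lineWord i β) := ⟨_, mem_orb_self _⟩ with ha
  have hcof : Cofinal v (f a).1 := ((mem_orb_iff_cofinal hv0).mp (f a).2).symm
  obtain ⟨j, δ, hδ⟩ := exists_map_move hf hu0 hv0 a i
  set π := Equiv.swap i j with hπ
  have hπi : π i = j := Equiv.swap_apply_left i j
  have hfull : ∀ n, (f a).1 n = 0 ∨ (f a).1 n = j.succ := fun n =>
    (prefix_iff hδ n).mp (fun l _ => lineWord_full i β l) n le_rfl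
  have hzero : ∀ n, ∃ t : ℤ, (∀ l < n, (gen j ^ t) (lineWord j β) l = 0) ∧
      ∀ l < n, (gen j ^ (dir δ * t)) (f a).1 l = 0 := by
    intro n
    obtain ⟨t, ht, -⟩ := exists_zpow_zero i n (lineWord i β) fun l _ => lineWord_full i β l
    refine ⟨t, fun l hl => ?_, ?_⟩
    · rw [← hπi, ← relabelWord_lineWord, zpow_relabelWord, relabelWord, ht l hl, relabel_zero]
    · have := zeros_map hf hp hu0 hv0 (a := move i t a) ht
      rwa [hδ] at this
  refine ⟨j, ?_⟩
  rcases dir_cases δ with hd | hd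
  · left
    have : (f a).1 = lineWord j β := eq_of_forall_exists_zpow (i := j) fun n => by
      obtain ⟨t, h1, h2⟩ := hzero n
      exact ⟨t, by simpa [hd] using h2, h1⟩
    exact this ▸ hcof
  · right
    have : (f a).1 = reflect j ⊤ (lineWord j β) := eq_of_forall_exists_zpow (i := j) fun n => by
      obtain ⟨t, h1, h2⟩ := hzero n
      refine ⟨-t, by simpa [hd] using h2, ?_⟩
      rw [← reflect_zpow t (fun s _ => lineWord_full j β s) (by simp)]
      exact reflect_forall_zero_iff.mpr h1
    exact (this ▸ hcof).trans (reflect_lineWord_cofinal hβ j)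

theorem isomorphic_of_cofinal {u v : Word p} {i j : Fin p} {β : ℕ → Bool}
    (hβ : Balanced β) (hu : Cofinal u (lineWord i β))
    (hv : Cofinal v (lineWord j β) ∨ Cofinal v (lineWord j fun n => !β n)) :
    (schreier u).Isomorphic (schreier v) := by
  have h1 := isomorphic_of_mem_orb (mem_orb_of_cofinal hu)
  have h2 := isomorphic_relabelWord (Equiv.swap i j) (lineWord i β)
  rw [relabelWord_lineWord, Equiv.swap_apply_left] at h2
  have h3 := Isomorphic.trans h1 h2
  rcases hv with hv | hv
  · exact Isomorphic.trans h3 (isomorphic_of_mem_orb (mem_orb_of_cofinal hv.symm))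
  · exact Isomorphic.trans (Isomorphic.trans h3 (isomorphic_reflect j _)) (isomorphic_of_mem_orb
      (mem_orb_of_cofinal ((reflect_lineWord_cofinal hβ j).trans hv.symm)))

/-! ### Rigidity of one-ended graphs -/

/-- An isomorphism maps the vertices `zeroed (P m) u`, through which the graph of `u` is exhausted, to
the corresponding vertices for the image of `u`, whose blocks therefore have the same lengths; the
path between consecutive vertices of this kind is determined up to reflection. -/
theorem blocks_of_isomorphism (hp : 2 ≤ p) {u v : Word p} {P : ℕ → ℕ} {α : ℕ → Fin p}
    (hB : Blocks u P α) {f : orb u ≃ orb v}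
    (hf : ∀ a b, (schreier v).mult (f a) (f b) = (schreier u).mult a b) :
    ∃ β : ℕ → Fin p, Blocks (f ⟨u, mem_orb_self u⟩).1 P β ∧
      ∀ m, (∀ n, P m < n → n < P (m + 1) → (f ⟨u, mem_orb_self u⟩).1 n =
          relabel (Equiv.swap (α m) (β m)) (u n)) ∨
        ∀ n, P m < n → n < P (m + 1) → (f ⟨u, mem_orb_self u⟩).1 n =
          Equiv.swap 0 (β m).succ (relabel (Equiv.swap (α m) (β m)) (u n)) := by
  have hu0 : u ∉ orb (fun _ => 0) := hB.mixed.notMem (by omega)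
  have hv0 : v ∉ orb (fun _ => 0) := fun hc =>
    hu0 (mem_orb_zero_of_isomorphic hp hc (Isomorphic.symm ⟨f, hf⟩))
  have hlt : ∀ m, P m < P (m + 1) := fun m => hB.mono (Nat.lt_succ_self m)
  set ρ : ℕ → orb u := fun m =>
    ⟨zeroed (P m) u, mem_orb_of_cofinal ⟨P m, fun n hn => zeroed_of_le u hn⟩⟩ with hρ
  have hρ0 : ρ 0 = ⟨u, mem_orb_self u⟩ := Subtype.ext (funext fun n => by
    rcases lt_or_ge n (P 0) with hn | hn
    · exact (zeroed_of_lt u hn).trans (hB.zeros n hn).symm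
    · exact zeroed_of_le u hn)
  have hlead : ∀ m, Lead (ρ m).1 (P m) := fun m => lead_zeroed (hB.ne_zero m)
  have hlead' : ∀ m, Lead (f (ρ m)).1 (P m) := fun m => lead_map hf hp hu0 hv0 (hlead m)
  choose β δ hβ using fun m => exists_map_move hf hu0 hv0 (ρ m) (α m)
  have hρblock : ∀ m, ∀ l < P (m + 1), (ρ m).1 l = 0 ∨ (ρ m).1 l = (α m).succ := by
    intro m l hl
    rcases lt_or_ge l (P m) with h | h
    · exact .inl ((hlead m).1 l h)
    · change zeroed (P m) u l = 0 ∨ zeroed (P m) u l = _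
      rw [zeroed_of_le u h]
      exact hB.mem_block h hl
  have hblock : ∀ m, ∀ l < P (m + 1), (f (ρ m)).1 l = 0 ∨ (f (ρ m)).1 l = (β m).succ := by
    intro m l hl
    exact (prefix_iff (hβ m) l).mp (fun s hs => hρblock m s (by omega)) l le_rfl
  have hend : ∀ m, (f (ρ m)).1 (P (m + 1)) ≠ 0 ∧ (f (ρ m)).1 (P (m + 1)) ≠ (β m).succ := by
    intro m
    have h1 := (prefix_iff (hβ m) (P (m + 1))).not.mp fun hc => by
      have h2 : zeroed (P m) u (P (m + 1)) = 0 ∨ zeroed (P m) u (P (m + 1)) = (α m).succ :=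
        hc _ le_rfl
      rw [zeroed_of_le u (hlt m).le, hB.start] at h2
      rcases h2 with h2 | h2
      · exact Fin.succ_ne_zero _ h2
      · exact hB.ne_succ m (Fin.succ_injective p h2).symm
    push Not at h1
    obtain ⟨l, hl, h3⟩ := h1
    rcases hl.lt_or_eq with hl | rfl
    · exact ((hblock m l hl).elim h3.1 h3.2).elim
    · exact h3
  have hnext : ∀ m, ∃ t : ℤ, ρ (m + 1) = move (α m) t (ρ m) := by
    intro m
    obtain ⟨t, h1, h2⟩ := exists_zpow_zero (α m) (P (m + 1)) (ρ m).1 (hρblock m)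
    refine ⟨t, Subtype.ext (funext fun n => ?_)⟩
    change zeroed (P (m + 1)) u n = (gen (α m) ^ t) (ρ m).1 n
    rcases lt_or_ge n (P (m + 1)) with hn | hn
    · rw [h1 n hn, zeroed_of_lt u hn]
    · rw [h2 n hn, zeroed_of_le u hn]
      exact (zeroed_of_le u ((hlt m).le.trans hn)).symm
  choose t ht using hnext
  have htail : ∀ m, ∀ n ≥ P m, (f (ρ m)).1 n = (f (ρ 0)).1 n := by
    intro m
    induction m with
    | zero => exact fun _ _ => rfl
    | succ m ih =>
      intro n hn
      rw [← ih n ((hlt m).le.trans hn), ht m, hβ m]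
      exact zpow_tail _ (hend m).1 (hend m).2 n hn
  rw [← hρ0]
  have hstart : ∀ m, (f (ρ m)).1 (P m) = (β m).succ := fun m =>
    (hblock m _ (hlt m)).resolve_left (hlead' m).2
  refine ⟨β, ⟨hB.mono, fun n hn => (hlead' 0).1 n hn, fun m => ?_, fun m n h1 h2 => ?_,
    fun m hc => ?_⟩, fun m => ?_⟩
  · rw [← htail m _ le_rfl, hstart m]
  · rw [← htail m _ h1.le]
    exact hblock m n h2
  · have h1 := (hend m).2
    rw [htail m _ (hlt m).le, ← htail (m + 1) _ le_rfl, hstart (m + 1), hc] at h1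
    exact h1 rfl
  · set π := Equiv.swap (α m) (β m) with hπ
    have hπα : π (α m) = β m := Equiv.swap_apply_left _ _
    set x := relabelWord π (ρ m).1 with hx
    have hxu : ∀ n, P m ≤ n → x n = relabel π (u n) := fun n hn =>
      congrArg (relabel π) (zeroed_of_le u hn)
    have hx0 : ∀ l < P (m + 1), (gen (β m) ^ t m) x l = 0 := by
      intro l hl
      rw [hx, ← hπα, zpow_relabelWord]
      have h1 : (gen (α m) ^ t m) (ρ m).1 = zeroed (P (m + 1)) u :=
        (congrArg Subtype.val (ht m)).symm
      rw [h1, relabelWord, zeroed_of_lt u hl, relabel_zero]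
    have hy0 : ∀ l < P (m + 1), (gen (β m) ^ (dir (δ m) * t m)) (f (ρ m)).1 l = 0 := by
      have := (hlead' (m + 1)).1
      rwa [ht m, hβ m] at this
    have hxblock : ∀ l < P (m + 1), x l = 0 ∨ x l = (β m).succ := by
      intro l hl
      rw [hx, ← hπα, relabelWord, relabel_eq_zero, relabel_eq_succ]
      exact hρblock m l hl
    rcases dir_cases (δ m) with hd | hd
    · left
      intro n h1 h2
      rw [← htail m n h1.le, ← hxu n h1.le]
      rw [hd, one_mul] at hy0
      have h3 := zpow_congr_lt (i := β m) (-t m) (fun l hl => (hy0 l hl).trans (hx0 l hl).symm) n h2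
      rwa [zpow_neg_zpow, zpow_neg_zpow] at h3
    · right
      intro n h1 h2
      rw [← htail m n h1.le, ← hxu n h1.le]
      rw [hd, neg_one_mul] at hy0
      have hxend : ∀ n : ℕ, ((P (m + 1) : ℕ) : ℕ∞) = n → x n ≠ 0 ∧ x n ≠ (β m).succ := by
        intro n hn
        obtain rfl : P (m + 1) = n := by exact_mod_cast hn
        rw [hxu _ (hlt m).le, ← hπα, hB.start, ne_eq, ne_eq, relabel_eq_zero, relabel_eq_succ]
        exact ⟨Fin.succ_ne_zero _, fun hc => hB.ne_succ m (Fin.succ_injective p hc).symm⟩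
      have hr := reflect_zpow (i := β m) (N := (P (m + 1) : ℕ)) (t m)
        (fun l hl => hxblock l (by exact_mod_cast hl)) hxend
      have hr0 : ∀ l < P (m + 1),
          (gen (β m) ^ (-t m)) (reflect (β m) (P (m + 1) : ℕ) x) l = 0 := by
        rw [← hr]
        exact reflect_forall_zero_iff.mpr hx0
      have h3 := zpow_congr_lt (i := β m) (t m) (fun l hl => (hy0 l hl).trans (hr0 l hl).symm) n h2
      rw [zpow_zpow_neg, zpow_zpow_neg] at h3
      rw [h3, reflect_of_flips]
      refine ⟨by exact_mod_cast h2, P m, h1, ?_, fun l hl hl' => hxblock l (by exact_mod_cast hl')⟩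
      rw [hxu _ le_rfl, hB.start, relabel_succ, hπα]

/-! ### Decompositions into blocks -/

/-- The blocks start at the first nonzero letter and then at every letter different from `0` and from
the letter of the preceding block. -/
theorem Mixed.exists_blocks {u : Word p} (hu : Mixed u) (hp : 0 < p) : ∃ P α, Blocks u P α := by
  classical
  obtain ⟨k, hk⟩ := exists_lead (y := u) (by
    obtain ⟨n, -, hn, -⟩ := hu ⟨0, hp⟩ 0
    exact ⟨n, hn⟩)
  have hex : ∀ q : {q // u q ≠ 0}, ∃ n, q.1 < n ∧ u n ≠ 0 ∧ u n ≠ u q.1 := by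
    intro q
    obtain ⟨i, hi⟩ := Fin.exists_succ_eq.mpr q.2
    obtain ⟨n, hn, h0, h1⟩ := hu i (q.1 + 1)
    exact ⟨n, by omega, h0, by rwa [← hi]⟩
  let next : {q // u q ≠ 0} → {q // u q ≠ 0} := fun q =>
    ⟨Nat.find (hex q), (Nat.find_spec (hex q)).2.1⟩
  let Q : ℕ → {q // u q ≠ 0} := fun m => next^[m] ⟨k, hk.2⟩
  have hQ : ∀ m, Q (m + 1) = next (Q m) := fun m => Function.iterate_succ_apply' next m _
  choose α hα using fun m => Fin.exists_succ_eq.mpr (Q m).2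
  refine ⟨fun m => (Q m).1, α, strictMono_nat_of_lt_succ fun m => ?_, hk.1,
    fun m => (hα m).symm, fun m n h1 h2 => ?_, fun m hc => ?_⟩
  · rw [hQ]
    exact (Nat.find_spec (hex (Q m))).1
  · rw [hQ] at h2
    have := Nat.find_min (hex (Q m)) h2
    rw [hα]
    tauto
  · have h1 := (Nat.find_spec (hex (Q m))).2.2
    have h2 : u (Q (m + 1)).1 ≠ u (Q m).1 := by rw [hQ]; exact h1
    rw [← hα, ← hα, hc] at h2
    exact h2 rfl

/-- The position at which the block `n` of a decomposition starts. -/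
def blockStart (k : ℕ) (U : ℕ → List (Fin (p + 1))) (n : ℕ) : ℕ :=
  k + ∑ m ∈ Finset.range n, (1 + (U m).length)

theorem blockStart_succ (k : ℕ) (U : ℕ → List (Fin (p + 1))) (n : ℕ) :
    blockStart k U (n + 1) = blockStart k U n + 1 + (U n).length := by
  rw [blockStart, blockStart, Finset.sum_range_succ]
  omega

theorem blockStart_congr (k : ℕ) {U V : ℕ → List (Fin (p + 1))}
    (h : ∀ n, (V n).length = (U n).length) : blockStart k V = blockStart k U := by
  funext n
  simp only [blockStart, h]

theorem exists_getElem {k : ℕ} {U : ℕ → List (Fin (p + 1))} {m n : ℕ}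
    (h1 : blockStart k U m < n) (h2 : n < blockStart k U (m + 1)) :
    ∃ r, r < (U m).length ∧ n = blockStart k U m + 1 + r := by
  rw [blockStart_succ] at h2
  exact ⟨n - (blockStart k U m + 1), by omega, by omega⟩

theorem IsDecomposition.blocks {u : Word p} {k : ℕ} {a : ℕ → Fin (p + 1)}
    {U : ℕ → List (Fin (p + 1))} (h : IsDecomposition u k a U) :
    ∃ α : ℕ → Fin p, (∀ n, a n = (α n).succ) ∧ Blocks u (blockStart k U) α := by
  choose α hα using fun n => Fin.exists_succ_eq.mpr (h.ne_zero n)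
  refine ⟨α, fun n => (hα n).symm, strictMono_nat_of_lt_succ fun m => ?_, fun n hn => ?_,
    fun m => ?_, fun m n h1 h2 => ?_, fun m hc => ?_⟩
  · rw [blockStart_succ]; omega
  · exact h.zeros n (by simpa [blockStart] using hn)
  · rw [hα]
    exact h.letter m
  · obtain ⟨r, hr, rfl⟩ := exists_getElem h1 h2
    have h3 : u (blockStart k U m + 1 + r) = (U m)[r] := h.block m r hr
    rw [h3, hα]
    exact h.mem m _ (List.getElem_mem hr)
  · exact h.ne_succ m (by rw [← hα, ← hα, hc])

/-- The inner part of the `m`-th block of a word. -/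
def innerBlock (u : Word p) (P : ℕ → ℕ) (m : ℕ) : List (Fin (p + 1)) :=
  List.ofFn fun r : Fin (P (m + 1) - (P m + 1)) => u (P m + 1 + r)

theorem Blocks.blockStart_eq {u : Word p} {P : ℕ → ℕ} {α : ℕ → Fin p} (h : Blocks u P α) (n : ℕ) :
    blockStart (P 0) (innerBlock u P) n = P n := by
  induction n with
  | zero => simp [blockStart]
  | succ n ih =>
    have : P n < P (n + 1) := h.mono (Nat.lt_succ_self n)
    rw [blockStart_succ, ih, innerBlock, List.length_ofFn]
    omega

theorem Blocks.isDecomposition {u : Word p} {P : ℕ → ℕ} {α : ℕ → Fin p} (h : Blocks u P α) :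
    IsDecomposition u (P 0) (fun n => (α n).succ) (innerBlock u P) where
  ne_zero n := Fin.succ_ne_zero _
  ne_succ n hc := h.ne_succ n (Fin.succ_injective p hc)
  mem n x hx := by
    obtain ⟨r, rfl⟩ := (List.mem_ofFn' _ _).mp hx
    exact h.inner n _ (by omega) (by have := r.2; omega)
  zeros := h.zeros
  letter n := by
    have := h.blockStart_eq n
    rw [blockStart] at this
    rw [this, h.start]
  block n r hr := by
    have := h.blockStart_eq n
    rw [blockStart] at this
    have h1 : (innerBlock u P n)[r] = u (P n + 1 + r) := by
      simp only [innerBlock, List.getElem_ofFn]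
    rw [this, h1]

theorem phi_eq_relabel {π : Equiv.Perm (Fin p)} {i j : Fin p} (hπ : π i = j) {x : Fin (p + 1)}
    (hx : x = 0 ∨ x = i.succ) : phi i.succ j.succ x = relabel π x := by
  rcases hx with rfl | rfl
  · simp [phi, (Fin.succ_ne_zero i).symm]
  · simp [phi, hπ]

theorem exists_perm_two {i i' j j' : Fin p} (hi : i ≠ i') (hj : j ≠ j') :
    ∃ π : Equiv.Perm (Fin p), π i = j ∧ π i' = j' := by
  refine ⟨(Equiv.swap i j).trans (Equiv.swap (Equiv.swap i j i') j'), ?_, ?_⟩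
  · rw [Equiv.trans_apply, Equiv.swap_apply_left, Equiv.swap_apply_of_ne_of_ne _ hj]
    intro hc
    exact hi ((Equiv.swap i j).injective (by rw [Equiv.swap_apply_left, ← hc]))
  · rw [Equiv.trans_apply, Equiv.swap_apply_left]

theorem isomorphic_of_decomposition (hp : 0 < p) {u v : Word p} {k : ℕ} {a b : ℕ → Fin (p + 1)}
    {U V : ℕ → List (Fin (p + 1))} (hu : IsDecomposition u k a U) (hv : IsDecomposition v k b V)
    (h : ∀ n, (V n).length = (U n).length ∧ (V n = (U n).map (phi (a n) (b n)) ∨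
      V n = ((U n).map (phi (a n) (b n))).map (Equiv.swap 0 (b n)))) :
    (schreier u).Isomorphic (schreier v) := by
  obtain ⟨α, hα, hA⟩ := hu.blocks
  obtain ⟨β, hβ, hB⟩ := hv.blocks
  have hPV := blockStart_congr k fun n => (h n).1
  rw [hPV] at hB
  choose π hπ hπ' using fun m => exists_perm_two (hA.ne_succ m) (hB.ne_succ m)
  refine Similar.isomorphic (π := π) (α := α) (β := β) (P := blockStart k U)
    (ε := fun m => ¬ V m = (U m).map (phi (a m) (b m))) ⟨hA, hB, hπ, hπ', fun m n h1 h2 => ?_⟩ hp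
  obtain ⟨r, hr, rfl⟩ := exists_getElem h1 h2
  have hmem := hA.inner m _ h1 h2
  have hu' : u (blockStart k U m + 1 + r) = (U m)[r] := hu.block m r hr
  have hr' : r < (V m).length := by rw [(h m).1]; exact hr
  have hv' : v (blockStart k U m + 1 + r) = (V m)[r] := by
    rw [← hPV]
    exact hv.block m r hr'
  rw [hv']
  have hphi : phi (a m) (b m) ((U m)[r]) = relabel (π m) (u (blockStart k U m + 1 + r)) := by
    rw [hα, hβ, ← hu', phi_eq_relabel (hπ m) hmem]
  split_ifs with hc
  · have : (V m)[r] = ((U m).map (phi (a m) (b m)))[r]'(by simpa) := by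
      congr 1
    rw [this, List.getElem_map, hphi]
  · have hV := (h m).2.resolve_left hc
    have : (V m)[r] = (((U m).map (phi (a m) (b m))).map (Equiv.swap 0 (b m)))[r]'(by simpa) := by
      congr 1
    rw [this, List.getElem_map, List.getElem_map, hphi, relabel_swap, hπ, hβ]

theorem decomposition_of_isomorphic (hp : 2 ≤ p) {u v : Word p} {k : ℕ} {a : ℕ → Fin (p + 1)}
    {U : ℕ → List (Fin (p + 1))} (hu : IsDecomposition u k a U)
    (h : (schreier u).Isomorphic (schreier v)) :
    ∃ (v' : Word p) (b : ℕ → Fin (p + 1)) (V : ℕ → List (Fin (p + 1))),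
      Cofinal v v' ∧ IsDecomposition v' k b V ∧ ∀ n, (V n).length = (U n).length ∧
        (V n = (U n).map (phi (a n) (b n)) ∨
          V n = ((U n).map (phi (a n) (b n))).map (Equiv.swap 0 (b n))) := by
  obtain ⟨α, hα, hA⟩ := hu.blocks
  obtain ⟨f, hf⟩ := h
  have hv0 : v ∉ orb (fun _ => 0) := fun hc => hA.mixed.notMem (by omega)
    (mem_orb_zero_of_isomorphic hp hc (Isomorphic.symm ⟨f, hf⟩))
  obtain ⟨β, hB, hβ⟩ := blocks_of_isomorphism hp hA hf
  set v' := (f ⟨u, mem_orb_self u⟩).1 with hv'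
  have hdec := hB.isDecomposition
  have hk : blockStart k U 0 = k := by simp [blockStart]
  rw [hk] at hdec
  have hlen : ∀ n, (innerBlock v' (blockStart k U) n).length = (U n).length := by
    intro n
    rw [innerBlock, List.length_ofFn, blockStart_succ]
    omega
  refine ⟨v', _, _, ((mem_orb_iff_cofinal hv0).mp (f ⟨u, mem_orb_self u⟩).2).symm, hdec,
    fun n => ⟨hlen n, ?_⟩⟩
  have hpos : ∀ r, r < (U n).length → blockStart k U n < blockStart k U n + 1 + r ∧
      blockStart k U n + 1 + r < blockStart k U (n + 1) := by
    intro r hr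
    rw [blockStart_succ]
    omega
  have hU : ∀ r (hr : r < (U n).length), u (blockStart k U n + 1 + r) = (U n)[r] := fun r hr =>
    hu.block n r hr
  have hphi : ∀ r (hr : r < (U n).length), phi (a n) (β n).succ ((U n)[r]) =
      relabel (Equiv.swap (α n) (β n)) (u (blockStart k U n + 1 + r)) := by
    intro r hr
    rw [hα, ← hU r hr]
    exact phi_eq_relabel (Equiv.swap_apply_left _ _) (hA.inner n _ (hpos r hr).1 (hpos r hr).2)
  rcases hβ n with h | h
  · left
    refine List.ext_getElem (by simpa using hlen n) fun r h1 h2 => ?_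
    have hr : r < (U n).length := by simpa using h2
    rw [List.getElem_map, hphi r hr, ← h _ (hpos r hr).1 (hpos r hr).2]
    simp only [innerBlock, List.getElem_ofFn]
  · right
    refine List.ext_getElem (by simpa using hlen n) fun r h1 h2 => ?_
    have hr : r < (U n).length := by simpa using h2
    rw [List.getElem_map, List.getElem_map, hphi r hr, ← h _ (hpos r hr).1 (hpos r hr).2]
    simp only [innerBlock, List.getElem_ofFn]

/-! ### Uncountability -/

theorem countable_eventuallyEq {X : Type} [Finite X] (y : ℕ → X) :
    {z : ℕ → X | ∃ k, ∀ n ≥ k, z n = y n}.Countable := by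
  have : {z : ℕ → X | ∃ k, ∀ n ≥ k, z n = y n} = ⋃ k : ℕ, {z | ∀ n ≥ k, z n = y n} := by
    ext z; simp
  rw [this]
  exact Set.countable_iUnion fun k => (finite_of_tail k y).countable

/-- A map on the binary sequences with countable fibres takes uncountably many values. -/
theorem not_countable_range {C : Type} (c : (ℕ → Bool) → C)
    (hc : ∀ s, {s' | c s' = c s}.Countable) : ¬ (Set.range c).Countable := by
  intro h
  have huniv : (Set.univ : Set (ℕ → Bool)).Countable := by
    refine (h.biUnion (t := fun x _ => {s | c s = x}) ?_).mono fun s _ => ?_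
    · rintro _ ⟨s, rfl⟩
      exact hc s
    · simp
  have : Countable (ℕ → Bool) := Set.countable_univ_iff.mp huniv
  obtain ⟨f, hf⟩ := exists_surjective_nat (ℕ → Bool)
  obtain ⟨n, hn⟩ := hf fun n => !f n n
  simpa using congrFun hn n

theorem isomorphic_of_isoClass_eq {u v : Word p} (h : isoClass u = isoClass v) :
    (schreier u).Isomorphic (schreier v) := by
  have hv : orb v ∈ isoClass u := h ▸ ⟨v, rfl, Isomorphic.refl _⟩
  obtain ⟨v', hO, hv'⟩ := hv
  exact Isomorphic.trans hv' (isomorphic_of_mem_orb (hO ▸ mem_orb_self v'))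

/-- A balanced sequence from which `s` can be read off. -/
def interleave (s : ℕ → Bool) (n : ℕ) : Bool := if n % 2 = 0 then s (n / 2) else !s (n / 2)

theorem interleave_balanced (s : ℕ → Bool) : Balanced (interleave s) := by
  intro c N
  have h0 : interleave s (2 * N) = s N := by simp [interleave]
  have h1 : interleave s (2 * N + 1) = !s N := by
    have : (2 * N + 1) / 2 = N := by omega
    simp [interleave, this]
  by_cases h : s N = c
  · exact ⟨2 * N, by omega, h0.trans h⟩
  · exact ⟨2 * N + 1, by omega, h1.trans (by cases c <;> simp_all)⟩

theorem interleave_injective : Function.Injective interleave := by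
  intro s t h
  funext n
  have := congrFun h (2 * n)
  simpa [interleave] using this

/-- If the words `x s`, for balanced `s`, have isomorphic graphs only if the sequences `s` agree
eventually, up to complement, then there are uncountably many isomorphism classes among them. -/
theorem not_countable_isoClass_image {x : (ℕ → Bool) → Word p} {E : Set (Word p)}
    (hE : ∀ s, Balanced s → x s ∈ E)
    (hx : ∀ s s', Balanced s → Balanced s' → (schreier (x s)).Isomorphic (schreier (x s')) →
      (∃ k, ∀ n ≥ k, s' n = s n) ∨ ∃ k, ∀ n ≥ k, s' n = !s n) :
    ¬ (isoClass '' E).Countable := by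
  intro h
  refine not_countable_range (fun s => isoClass (x (interleave s))) (fun s => ?_) (h.mono ?_)
  · refine (((countable_eventuallyEq (interleave s)).union
      (countable_eventuallyEq fun n => !interleave s n)).preimage_of_injOn
      interleave_injective.injOn).mono fun s' hs' => ?_
    exact hx _ _ (interleave_balanced s) (interleave_balanced s')
      (isomorphic_of_isoClass_eq (Eq.symm hs'))
  · rintro _ ⟨s, rfl⟩
    exact ⟨_, hE _ (interleave_balanced s), rfl⟩

theorem Mixed.orb_countable (hp : 0 < p) {u : Word p} (hu : Mixed u) : (orb u).Countable :=
  (countable_eventuallyEq u).mono fun _ hz => (mem_orb_iff_cofinal (hu.notMem hp)).mp hz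

theorem not_countable_isoClass (hp : 0 < p) {u : Word p} {x : (ℕ → Bool) → Word p}
    (hinj : Function.Injective x) (hx : ∀ s, Mixed (x s))
    (hiso : ∀ s, (schreier u).Isomorphic (schreier (x s))) : ¬ (isoClass u).Countable := by
  intro h
  refine not_countable_range (fun s => orb (x s)) (fun s => ?_) (h.mono ?_)
  · refine (((hx s).orb_countable hp).preimage_of_injOn hinj.injOn).mono fun s' hs' => ?_
    have hs'' : orb (x s') = orb (x s) := hs'
    exact hs'' ▸ mem_orb_self (x s')
  · rintro _ ⟨s, rfl⟩
    exact ⟨x s, rfl, hiso s⟩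

theorem Blocks.exists_block {u : Word p} {P : ℕ → ℕ} {α : ℕ → Fin p} (h : Blocks u P α) {M n : ℕ}
    (hn : P M ≤ n) : ∃ m ≥ M, P m ≤ n ∧ n < P (m + 1) := by
  induction n, hn using Nat.le_induction with
  | base => exact ⟨M, le_rfl, le_rfl, h.mono (Nat.lt_succ_self M)⟩
  | succ n _ ih =>
    obtain ⟨m, hm, h1, h2⟩ := ih
    rcases (Nat.succ_le_of_lt h2).lt_or_eq with h3 | h3
    · exact ⟨m, hm, by omega, h3⟩
    · exact ⟨m + 1, by omega, h3.ge, h3.trans_lt (h.mono (Nat.lt_succ_self (m + 1)))⟩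

/-- The letters and the reflections of the blocks can be prescribed. -/
theorem exists_similar {u : Word p} {P : ℕ → ℕ} {α : ℕ → Fin p} (h : Blocks u P α)
    {β : ℕ → Fin p} (hβ : ∀ m, β m ≠ β (m + 1)) (ε : ℕ → Prop) :
    ∃ v π, Similar u v P α β π ε := by
  classical
  choose π hπ hπ' using fun m => exists_perm_two (h.ne_succ m) (hβ m)
  have hex : ∀ n, ∃ m, P 0 ≤ n → P m ≤ n ∧ n < P (m + 1) := by
    intro n
    by_cases hn : P 0 ≤ n
    · obtain ⟨m, -, hm⟩ := h.exists_block hn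
      exact ⟨m, fun _ => hm⟩
    · exact ⟨0, fun hc => (hn hc).elim⟩
  choose b hb using hex
  have hbu : ∀ m n, P m ≤ n → n < P (m + 1) → b n = m := by
    intro m n h1 h2
    obtain ⟨h3, h4⟩ := hb n ((h.mono.monotone (Nat.zero_le m)).trans h1)
    have h5 := h.mono.lt_iff_lt.mp (h3.trans_lt h2)
    have h6 := h.mono.lt_iff_lt.mp (h1.trans_lt h4)
    omega
  set v : Word p := fun n => relabel (π (b n))
    (if ε (b n) ∧ n ≠ P (b n) then Equiv.swap 0 (α (b n)).succ (u n) else u n) with hv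
  have hlt : ∀ m, P m < P (m + 1) := fun m => h.mono (Nat.lt_succ_self m)
  have hstart : ∀ m, v (P m) = (β m).succ := by
    intro m
    simp [hv, hbu m _ le_rfl (hlt m), h.start, hπ]
  have hinner : ∀ m n, P m < n → n < P (m + 1) →
      v n = relabel (π m) (if ε m then Equiv.swap 0 (α m).succ (u n) else u n) := by
    intro m n h1 h2
    simp [hv, hbu m n h1.le h2, h1.ne']
  refine ⟨fun n => if n < P 0 then 0 else v n, π, h, ⟨h.mono, fun n hn => if_pos hn, fun m => ?_,
    fun m n h1 h2 => ?_, hβ⟩, hπ, hπ', fun m n h1 h2 => ?_⟩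
  · have := h.mono.monotone (Nat.zero_le m)
    rw [if_neg (by omega), hstart]
  · have := h.mono.monotone (Nat.zero_le m)
    rw [if_neg (by omega), hinner m n h1 h2, ← hπ, relabel_eq_zero, relabel_eq_succ]
    split_ifs
    exacts [swap_mem (h.inner m n h1 h2), h.inner m n h1 h2]
  · have := h.mono.monotone (Nat.zero_le m)
    rw [if_neg (by omega), hinner m n h1 h2]

/-- With three nonzero letters, the letter of every second block can be chosen freely among two. -/
theorem not_countable_isoClass_of_three_le (hp : 3 ≤ p) {u : Word p} {P : ℕ → ℕ} {α : ℕ → Fin p}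
    (h : Blocks u P α) : ¬ (isoClass u).Countable := by
  set β : (ℕ → Bool) → ℕ → Fin p := fun s m =>
    if m % 2 = 0 then ⟨0, by omega⟩ else if s (m / 2) then ⟨1, by omega⟩ else ⟨2, by omega⟩ with hβ
  have hne : ∀ s m, β s m ≠ β s (m + 1) := by
    intro s m
    rcases Nat.mod_two_eq_zero_or_one m with h0 | h0
    · have h1 : (m + 1) % 2 = 1 := by omega
      simp only [hβ]
      split_ifs <;> first | omega | simp
    · have h1 : (m + 1) % 2 = 0 := by omega
      simp only [hβ]
      split_ifs <;> first | omega | simp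
  choose x π hx using fun s => exists_similar h (hne s) fun _ => False
  refine not_countable_isoClass (by omega) (x := x) (fun s t hst => funext fun n => ?_)
    (fun s => (hx s).right.mixed) fun s => (hx s).isomorphic (by omega)
  have h1 := (hx s).right.start (2 * n + 1)
  rw [hst, (hx t).right.start] at h1
  have h2 := Fin.succ_injective p h1
  have e1 : (2 * n + 1) % 2 = 1 := by omega
  have e2 : (2 * n + 1) / 2 = n := by omega
  simp only [hβ, e1, e2] at h2
  cases h3 : s n <;> cases h4 : t n <;> simp_all

/-- The reflection of each nonempty inner part of a block can be chosen freely. -/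
theorem not_countable_isoClass_of_infinite (hp : 0 < p) {u : Word p} {P : ℕ → ℕ} {α : ℕ → Fin p}
    (h : Blocks u P α) (hinf : {m | P m + 1 < P (m + 1)}.Infinite) : ¬ (isoClass u).Countable := by
  set e := hinf.natEmbedding with he
  choose x π hx using fun s : ℕ → Bool =>
    exists_similar h h.ne_succ fun m => ∃ k, (e k).1 = m ∧ s k = true
  refine not_countable_isoClass hp (x := x) (fun s t hst => funext fun k => ?_)
    (fun s => (hx s).right.mixed) fun s => (hx s).isomorphic hp
  set m := (e k).1 with hm
  have hlt : P m + 1 < P (m + 1) := (e k).2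
  have hiff : ∀ s : ℕ → Bool, (∃ l, (e l).1 = m ∧ s l = true) ↔ s k = true := by
    intro s
    refine ⟨?_, fun h => ⟨k, rfl, h⟩⟩
    rintro ⟨l, hl, h⟩
    rwa [e.injective (Subtype.ext hl)] at h
  have hval : ∀ s : ℕ → Bool, x s (P m + 1) =
      if s k then Equiv.swap 0 (α m).succ (u (P m + 1)) else u (P m + 1) := by
    intro s
    have hmem := h.inner m (P m + 1) (by omega) hlt
    have hrel : ∀ y : Fin (p + 1), (y = 0 ∨ y = (α m).succ) → relabel (π s m) y = y := by
      rintro y (rfl | rfl)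
      · rfl
      · rw [relabel_succ, (hx s).map]
    rw [(hx s).inner m _ (by omega) hlt, hrel]
    · simp only [hiff]
    · split_ifs
      exacts [swap_mem hmem, hmem]
  have hswap : Equiv.swap 0 (α m).succ (u (P m + 1)) ≠ u (P m + 1) := by
    rcases h.inner m (P m + 1) (by omega) hlt with h' | h' <;> rw [h']
    · rw [Equiv.swap_apply_left]; exact Fin.succ_ne_zero _
    · rw [Equiv.swap_apply_right]; exact (Fin.succ_ne_zero _).symm
  have h1 := (hval s).symm.trans ((congrFun hst _).trans (hval t))
  cases h3 : s k <;> cases h4 : t k <;> rw [h3, h4] at h1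
  · exact (hswap (by simpa using h1.symm)).elim
  · exact (hswap (by simpa using h1)).elim

/-! ### The classes of two-ended graphs -/

theorem eventually_eq_of_lineWord_cofinal {i j : Fin p} {β γ : ℕ → Bool}
    (h : Cofinal (lineWord i β) (lineWord j γ)) : ∃ k, ∀ n ≥ k, β n = γ n := by
  obtain ⟨k, hk⟩ := h
  refine ⟨k, fun n hn => ?_⟩
  have h1 := hk n hn
  cases h2 : β n <;> cases h3 : γ n <;>
    simp [lineWord, h2, h3, Fin.succ_ne_zero, (Fin.succ_ne_zero _).symm] at h1 ⊢

theorem lineWord_cofinal_iff {i j : Fin p} {β : ℕ → Bool} (hβ : Balanced β) {ε δ : Bool} :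
    Cofinal (lineWord i fun n => xor (β n) ε) (lineWord j fun n => xor (β n) δ) ↔
      i = j ∧ ε = δ := by
  refine ⟨fun h => ?_, fun h => h.1 ▸ h.2 ▸ Cofinal.refl _⟩
  obtain ⟨k, hk⟩ := eventually_eq_of_lineWord_cofinal h
  have hε : ε = δ := by simpa using hk k le_rfl
  subst hε
  obtain ⟨l, hl⟩ := h
  obtain ⟨n, hn, h1⟩ := hβ (!ε) l
  have h2 := hl n hn
  simp only [lineWord, h1] at h2
  exact ⟨Fin.succ_injective p (by simpa using h2), rfl⟩

theorem phi_cofinal {u : Word p} {i : Fin p} {β : ℕ → Bool} (hu : Cofinal u (lineWord i β))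
    (i' j : Fin p) : Cofinal (fun n => phi i'.succ j.succ (u n))
      (lineWord (if i = i' then j else i) β) := by
  obtain ⟨k, hk⟩ := hu
  refine ⟨k, fun n hn => ?_⟩
  simp only [hk n hn]
  cases h : β n
  · simp [lineWord, h, phi, (Fin.succ_ne_zero _).symm]
  · by_cases hi : i = i' <;> simp [lineWord, h, phi, hi]

theorem bar_cofinal {w : Word p} {j : Fin p} {β : ℕ → Bool} (hβ : Balanced β)
    (hw : Cofinal w (lineWord j β)) : Cofinal (bar w) (lineWord j fun n => !β n) := by
  obtain ⟨N, hN⟩ := hw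
  obtain ⟨l, hl, hβl⟩ := hβ true N
  have hwl : w l = j.succ := by rw [hN l hl]; simp [lineWord, hβl]
  have htail : TailAt w l := by
    refine ⟨hwl ▸ Fin.succ_ne_zero j, fun n hn => ?_⟩
    rw [hwl, hN n (hl.trans hn)]
    exact lineWord_full j β n
  refine ⟨l + 1, fun n hn => ?_⟩
  have hex : ∃ m < n, TailAt w m := ⟨l, hn, htail⟩
  have hletter : w hex.choose = j.succ := by
    obtain ⟨-, h0, h1⟩ := hex.choose_spec
    rcases le_total hex.choose l with h | h
    · rcases h1 l h with h2 | h2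
      · exact (htail.1 h2).elim
      · exact h2.symm.trans hwl
    · exact ((htail.2 _ h).resolve_left h0).trans hwl
  rw [bar, dif_pos hex, hletter, hN n (by omega)]
  cases h : β n <;> simp [lineWord, h]

theorem isomorphic_iff_cofinal (hp : 2 ≤ p) {u v : Word p} (hu : u ∈ ended p 2) :
    (schreier u).Isomorphic (schreier v) ↔ ∃ i j : Fin (p + 1), i ≠ 0 ∧ j ≠ 0 ∧
      (Cofinal v (fun n => phi i j (u n)) ∨ Cofinal v (bar fun n => phi i j (u n))) := by
  obtain ⟨i, β, hβ, hu⟩ := (mem_ended_two hp).mp hu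
  constructor
  · intro h
    obtain ⟨j, hv⟩ := cofinal_of_isomorphic hp hβ hu h
    have hphi := phi_cofinal hu i j
    rw [if_pos rfl] at hphi
    exact ⟨i.succ, j.succ, Fin.succ_ne_zero i, Fin.succ_ne_zero j,
      hv.imp (fun hv => hv.trans hphi.symm) fun hv => hv.trans (bar_cofinal hβ hphi).symm⟩
  · rintro ⟨i', j', hi, hj, hv⟩
    obtain ⟨i', rfl⟩ := Fin.exists_succ_eq.mpr hi
    obtain ⟨j', rfl⟩ := Fin.exists_succ_eq.mpr hj
    have hphi := phi_cofinal hu i' j'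
    exact isomorphic_of_cofinal hβ hu
      (hv.imp (fun hv => hv.trans hphi) fun hv => hv.trans (bar_cofinal hβ hphi))

theorem encard_isoClass (hp : 2 ≤ p) {u : Word p} (hu : u ∈ ended p 2) :
    (isoClass u).encard = ((2 * p : ℕ) : ℕ∞) := by
  obtain ⟨i, β, hβ, hu⟩ := (mem_ended_two hp).mp hu
  have hβε : ∀ ε, Balanced fun n => xor (β n) ε := by
    rintro (_ | _)
    · simpa using hβ
    · simpa using hβ.not
  set g : Fin p × Bool → Set (Word p) := fun q => orb (lineWord q.1 fun n => xor (β n) q.2) with hg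
  have hinj : Function.Injective g := by
    rintro ⟨j, ε⟩ ⟨j', δ⟩ h
    have h1 : lineWord j (fun n => xor (β n) ε) ∈ orb (lineWord j' fun n => xor (β n) δ) := by
      have h' : orb (lineWord j fun n => xor (β n) ε) =
        orb (lineWord j' fun n => xor (β n) δ) := h
      exact h' ▸ mem_orb_self _
    rw [mem_orb_iff_cofinal ((hβε δ).lineWord_notMem (Cofinal.refl _)),
      lineWord_cofinal_iff hβ] at h1
    exact Prod.ext h1.1 h1.2
  have hrange : isoClass u = g '' Set.univ := by
    ext O
    constructor
    · rintro ⟨v, rfl, h⟩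
      obtain ⟨j, hv | hv⟩ := cofinal_of_isomorphic hp hβ hu h
      · exact ⟨(j, false), trivial, (orb_eq_of_mem (mem_orb_of_cofinal (by simpa using hv))).symm⟩
      · exact ⟨(j, true), trivial, (orb_eq_of_mem (mem_orb_of_cofinal (by simpa using hv))).symm⟩
    · rintro ⟨⟨j, ε⟩, -, rfl⟩
      refine ⟨_, rfl, isomorphic_of_cofinal (j := j) hβ hu ?_⟩
      cases ε
      · left; simpa using Cofinal.refl (lineWord j β)
      · right; simpa using Cofinal.refl (lineWord j fun n => !β n)
  rw [hrange, hinj.encard_image, Set.encard_univ, ENat.card_eq_coe_fintype_card,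
    Fintype.card_prod, Fintype.card_fin, Fintype.card_bool, mul_comm]

theorem not_countable_isoClass_ended_two (hp : 2 ≤ p) :
    ¬ (isoClass '' ended p 2).Countable := by
  refine not_countable_isoClass_image (x := lineWord ⟨0, by omega⟩)
    (fun s hs => (mem_ended_two hp).mpr ⟨_, s, hs, Cofinal.refl _⟩) fun s s' hs _ h => ?_
  obtain ⟨j, h | h⟩ := cofinal_of_isomorphic hp hs (Cofinal.refl _) h
  exacts [.inl (eventually_eq_of_lineWord_cofinal h), .inr (eventually_eq_of_lineWord_cofinal h)]

/-! ### The classes of one-ended graphs -/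

/-- For words without the letter `0` in two nonzero letters, every block repeats a single letter, and
the letters of successive blocks alternate. An isomorphism preserves the boundaries of the blocks, so
that it either keeps or exchanges the two letters, from some position on. -/
theorem not_countable_isoClass_ended_one (hp : 2 ≤ p) :
    ¬ (isoClass '' ended p 1).Countable := by
  set l : Bool → Fin p := fun c => if c then ⟨0, by omega⟩ else ⟨1, by omega⟩ with hl
  have hinj : Function.Injective l := by
    rintro (_ | _) (_ | _) h <;> simp [hl] at h ⊢
  have hmix : ∀ s, Balanced s → Mixed fun n => (l (s n)).succ := by
    intro s hs i N
    obtain ⟨c, hc⟩ : ∃ c, l c ≠ i := by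
      by_contra hc
      push Not at hc
      exact absurd (hinj ((hc true).trans (hc false).symm)) (by simp)
    obtain ⟨n, hn, rfl⟩ := hs c N
    exact ⟨n, hn, Fin.succ_ne_zero _, fun h => hc (Fin.succ_injective p h)⟩
  refine not_countable_isoClass_image (x := fun s n => (l (s n)).succ)
    (fun s hs => (mem_ended_one hp).mpr (hmix s hs)) fun s s' hs hs' h => ?_
  obtain ⟨P, α, hA⟩ := (hmix s hs).exists_blocks (by omega)
  obtain ⟨f, hf⟩ := h
  obtain ⟨β, hB, -⟩ := blocks_of_isomorphism hp hA hf
  obtain ⟨K, hK⟩ := (mem_orb_iff_cofinal ((hmix s' hs').notMem (by omega))).mp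
    (f ⟨_, mem_orb_self _⟩).2
  have hlt : ∀ m, P m < P (m + 1) := fun m => hA.mono (Nat.lt_succ_self m)
  have hα : ∀ m n, P m ≤ n → n < P (m + 1) → l (s n) = α m := fun m n h1 h2 =>
    Fin.succ_injective p ((hA.mem_block h1 h2).resolve_left (Fin.succ_ne_zero _))
  have hβ : ∀ m n, K ≤ m → P m ≤ n → n < P (m + 1) → l (s' n) = β m := by
    intro m n h0 h1 h2
    have h3 := hB.mem_block h1 h2
    rw [hK n ((h0.trans (hA.mono.id_le m)).trans h1)] at h3
    exact Fin.succ_injective p (h3.resolve_left (Fin.succ_ne_zero _))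
  have hstep : ∀ m ≥ K, (s' (P m) = s (P m) ↔ s' (P K) = s (P K)) := by
    intro m hm
    induction m, hm using Nat.le_induction with
    | base => rfl
    | succ m hm ih =>
      rw [← ih]
      have h1 : s (P (m + 1)) ≠ s (P m) := fun hc => hA.ne_succ m (by
        rw [← hα m _ le_rfl (hlt m), ← hα (m + 1) _ le_rfl (hlt (m + 1)), hc])
      have h2 : s' (P (m + 1)) ≠ s' (P m) := fun hc => hB.ne_succ m (by
        rw [← hβ m _ hm le_rfl (hlt m), ← hβ (m + 1) _ (by omega) le_rfl (hlt (m + 1)), hc])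
      rw [Bool.eq_not.mpr h1, Bool.eq_not.mpr h2, Bool.not_inj_iff]
  have hconst : ∀ n ≥ P K, (s' n = s n ↔ s' (P K) = s (P K)) := by
    intro n hn
    obtain ⟨m, hm, h1, h2⟩ := hA.exists_block hn
    have h3 : s n = s (P m) := hinj ((hα m n h1 h2).trans (hα m _ le_rfl (hlt m)).symm)
    have h4 : s' n = s' (P m) := hinj ((hβ m n hm h1 h2).trans (hβ m _ hm le_rfl (hlt m)).symm)
    rw [h3, h4, hstep m hm]
  by_cases h : s' (P K) = s (P K)
  · exact .inl ⟨P K, fun n hn => (hconst n hn).mpr h⟩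
  · exact .inr ⟨P K, fun n hn => Bool.eq_not.mpr ((hconst n hn).not.mpr h)⟩

theorem not_countable_isoClass_of_isDecomposition (hp : 2 ≤ p) {u : Word p} {k : ℕ}
    {a : ℕ → Fin (p + 1)} {U : ℕ → List (Fin (p + 1))} (hu : IsDecomposition u k a U)
    (h : 3 ≤ p ∨ {n | U n ≠ []}.Infinite) : ¬ (isoClass u).Countable := by
  obtain ⟨α, -, hA⟩ := hu.blocks
  rcases h with h | h
  · exact not_countable_isoClass_of_three_le h hA
  · refine not_countable_isoClass_of_infinite (by omega) hA (h.mono fun n hn => ?_)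
    have := List.length_pos_iff.mpr hn
    rw [Set.mem_ofPred_eq, blockStart_succ]
    omega

/-! ### The classification -/

theorem isoClass_image_ended_two_mul (hp : 2 ≤ p) :
    isoClass '' ended p (2 * p) = {{orb (fun _ => 0 : Word p)}} := by
  have hclass : ∀ u : Word p, u ∈ orb (fun _ => 0) → isoClass u = {orb (fun _ => 0)} := by
    intro u hu
    ext O
    constructor
    · rintro ⟨v, rfl, h⟩
      exact orb_eq_of_mem (mem_orb_zero_of_isomorphic hp hu h)
    · rintro rfl
      exact ⟨_, rfl, isomorphic_of_mem_orb hu⟩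
  ext C
  constructor
  · rintro ⟨u, hu, rfl⟩
    exact hclass u ((mem_ended_two_mul hp).mp hu)
  · rintro rfl
    exact ⟨_, (mem_ended_two_mul hp).mpr (mem_orb_self _), hclass _ (mem_orb_self _)⟩

end StarAut

theorem theorem4p17 (p : ℕ) (hp : 2 ≤ p) :
    -- the graphs with `2p` ends
    (StarAut.isoClass '' StarAut.ended p (2 * p) = {{StarAut.orb (fun _ => 0 : StarAut.Word p)}}) ∧
    -- the graphs with two ends
    ((∀ u ∈ StarAut.ended p 2, ∀ v ∈ StarAut.ended p 2,
        ((StarAut.schreier u).Isomorphic (StarAut.schreier v) ↔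
          ∃ i j : Fin (p + 1), i ≠ 0 ∧ j ≠ 0 ∧
            (StarAut.Cofinal v (fun n => StarAut.phi i j (u n)) ∨
              StarAut.Cofinal v (StarAut.bar (fun n => StarAut.phi i j (u n)))))) ∧
      ¬ (StarAut.isoClass '' StarAut.ended p 2).Countable ∧
      (∀ u ∈ StarAut.ended p 2, (StarAut.isoClass u).encard = ((2 * p : ℕ) : ℕ∞))) ∧
    -- the graphs with one end
    ((∀ u ∈ StarAut.ended p 1, ∃ k a U, StarAut.IsDecomposition u k a U) ∧
      (∀ u ∈ StarAut.ended p 1, ∀ v ∈ StarAut.ended p 1, ∀ k a U,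
        StarAut.IsDecomposition u k a U →
        ((StarAut.schreier u).Isomorphic (StarAut.schreier v) ↔
          ∃ (v' : StarAut.Word p) (b : ℕ → Fin (p + 1)) (V : ℕ → List (Fin (p + 1))),
            StarAut.Cofinal v v' ∧ StarAut.IsDecomposition v' k b V ∧
            ∀ n, (V n).length = (U n).length ∧
              (V n = (U n).map (StarAut.phi (a n) (b n)) ∨
                V n = ((U n).map (StarAut.phi (a n) (b n))).map (Equiv.swap 0 (b n))))) ∧
      ¬ (StarAut.isoClass '' StarAut.ended p 1).Countable ∧
      (∀ u ∈ StarAut.ended p 1, ∀ k a U, StarAut.IsDecomposition u k a U →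
        (3 ≤ p ∨ {n | U n ≠ []}.Infinite) → ¬ (StarAut.isoClass u).Countable)) := by

  refine ⟨StarAut.isoClass_image_ended_two_mul hp,
    ⟨fun u hu v _ => StarAut.isomorphic_iff_cofinal hp hu,
      StarAut.not_countable_isoClass_ended_two hp, fun u hu => StarAut.encard_isoClass hp hu⟩,
    fun u hu => ?_, fun u _ v _ k a U hU => ⟨StarAut.decomposition_of_isomorphic hp hU, ?_⟩,
    StarAut.not_countable_isoClass_ended_one hp,
    fun u _ k a U hU h => StarAut.not_countable_isoClass_of_isDecomposition hp hU h⟩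
  · obtain ⟨P, α, h⟩ := ((StarAut.mem_ended_one hp).mp hu).exists_blocks (by omega)
    exact ⟨_, _, _, h.isDecomposition⟩
  · rintro ⟨v', b, V, hv, hV, h⟩
    exact StarAut.Isomorphic.trans
      (StarAut.isomorphic_of_decomposition (by omega) hU hV h)
      (StarAut.isomorphic_of_mem_orb (StarAut.mem_orb_of_cofinal hv.symm))
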